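/- Let $n\ge 1$, $m=n+1$, let $\langle\ ,\ \rangle$ be a nondegenerate symmetric bilinear form on $\mathbb C^{m}$, and regard $\mathbb C^{m}$ as the complement of the hyperplane $\mathbf P_\infty=\mathbf P(\mathbb C^m)$ in $\mathbf P^{m}=\mathbf P(\mathbb C^m\oplus\mathbb C)$. **Focal degeneracy.** Let $X\subset\mathbb C^{m}$ be an irreducible hypersurface. Let $N_X\subset X_{\rm smooth}\times\mathbf P^m$ be the set of pairs $(x,y)$ with $x$ a smooth point of $X$ and $y$ on the projective normal line to $X$ at $x$ (the join of $x$ and of the direction orthogonal to $T_xX$). It is smooth and irreducible of dimension $m$. Let $\pi:N_X\to\mathbf P^m$ be the second projection and $Y_X\subset N_X$ the set of points where $d\pi$ is not an isomorphism. $X$ is *focally degenerate* if either $\pi$ is not dominant (isotropic degeneracy; then $Y_X=N_X$) or some irreducible component $Z$ of $Y_X$ satisfies $\dim\overline{\pi(Z)}<n$. An irreducible component $Z$ of $Y_X$ is called *degenerate* if $\pi$ is not dominant or $\dim\overline{\pi(Z)}<n$; $\Sigma=\overline{\pi(Z)}$ is the corresponding focal component. We are in the *non-vertical case* if $Z$ dominates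 $X$. **Inverse construction.** Let $\Sigma\subset\mathbb C^m$ be an irreducible affine variety and let $\Sigma^\star\subset\Sigma\times\mathbb C$ be the graph of an algebraic (possibly multivalued, possibly with poles) function $r$ on $\Sigma$: a closed irreducible subvariety with $\dim\Sigma^\star=\dim\Sigma$ which dominates $\Sigma$. Let $A^\star$ be the set of triples $(x,O,r)$ with $(O,r)$ a smooth point of $\Sigma^\star$ and $\langle x-O,v\rangle+\tfrac12\rho=0$ for all $(v,\rho)\in T_{(O,r)}\Sigma^\star$; let $Z'$ be the set of those triples in $A^\star$ with $\langle x-O,x-O\rangle=r$; and let $X'\subset\mathbb C^m$ be the Zariski closure of the set of the first components $x$ of the points of $Z'$. The pair $(\Sigma,r)$ is *admissible* if $Z'$ dominates $\Sigma$. **Asymptotic inverse construction.** Let $\Sigma\subset\mathbf P_\infty$ be an irreducible projective variety and $r$ an algebraic (possibly multivalued, possibly with poles) section of $\mathcal O_\Sigma(1)$, i.e. an algebraic function, homogeneous of degree one, on the affine cone over $\Sigma$, with graph $\Sigma^\star$, a closed irreducible cone in $\mathbb C^m\times\mathbb C$. Then $X'$ is the Zariski closure of the union, over the smooth points $(O,r)$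 of $\Sigma^\star$ with $O\ne0$, of the affine spaces $\{x:\langle x,v\rangle=\rho\ \text{for all}\ (v,\rho)\in T_{(O,r)}\Sigma^\star\}$, that is, $\{x : \langle x,O\rangle=r,\ \langle x,\partial O/\partial s_j\rangle=\partial r/\partial s_j \text{ for all } j\}$ for a local parametrization $s\mapsto (O(s),r(s))$, where $s=(s_1,\dots,s_a)$ are local coordinates on $\Sigma$ and $O(s)$ is a local lift to $\mathbb C^m\setminus 0$. **Theorem.** Let $X\subset\mathbb C^{n+1}$ be an irreducible focally degenerate hypersurface in the non-vertical case: $Z$ is a degenerate component of $Y_X$ which dominates $X$, and $\Sigma=\overline{\pi(Z)}\subset\mathbf P^m$. * If $\Sigma\subset\mathbf P_\infty$, then there is an algebraic section $r$ of $\mathcal O_\Sigma(1)$ such that $X=X'$ is obtained from $(\Sigma,r)$ by the asymptotic inverse construction. * If $\Sigma\not\subset\mathbf P_\infty$, then there is an algebraic function $r$ on the affine part $\Sigma\cap\mathbb C^m$ such that $(\Sigma\cap\mathbb C^m,r)$ is admissible, the algebraic set $X'$ given by the inverse construction has dimension $n$, and $X$ is an irreducible component of $X'$. Conversely, let $X\subset\mathbb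 C^{n+1}$ be an irreducible hypersurface which is an irreducible component of the algebraic set $X'$ obtained * either by the inverse construction from an admissible pair $(\Sigma,r)$ such that $\dim\Sigma<n$, or such that $\dim\Sigma=n$ and $Z'=A^\star$, * or by the asymptotic inverse construction from $\Sigma\subset\mathbf P_\infty$ with $\dim\Sigma<n$ and an algebraic section $r$ of $\mathcal O_\Sigma(1)$. Then $X$ is focally degenerate, again in the non-vertical case. -/

import Mathlib

open MvPolynomial

noncomputable section

namespace FocalLoci

/-! ### Zariski geometry in complex affine spaces -/

section Zariski

variable {σ : Type} [Fintype σ]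

/-- The Zariski closure of a subset of `ℂ^σ`. -/
def zcl (S : Set (σ → ℂ)) : Set (σ → ℂ) :=
  zeroLocus ℂ (vanishingIdeal ℂ S)

/-- `S` is Zariski closed, i.e. an algebraic set. -/
def IsZClosed (S : Set (σ → ℂ)) : Prop :=
  zcl S = S

/-- `S` (with its Zariski topology) is irreducible; in particular it is nonempty. -/
def IsZIrreducible (S : Set (σ → ℂ)) : Prop :=
  (vanishingIdeal ℂ S).IsPrime

/-- The dimension of (the Zariski closure of) `S`: the Krull dimension of the coordinate ring. -/
def zdim (S : Set (σ → ℂ)) : WithBot ℕ∞ :=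
  ringKrullDim (MvPolynomial σ ℂ ⧸ vanishingIdeal ℂ S)

/-- `C` is an irreducible component of `S`, i.e. a maximal irreducible subset. -/
def IsZComponent (S C : Set (σ → ℂ)) : Prop :=
  Maximal (fun T : Set (σ → ℂ) => IsZIrreducible T ∧ T ⊆ S) C

/-- The Zariski tangent space at `p` of a locally closed set `S` containing `p`, as a vector
subspace of `ℂ^σ`. -/
def tangentSpace (S : Set (σ → ℂ)) (p : σ → ℂ) : Submodule ℂ (σ → ℂ) where
  carrier := {ξ | ∀ f ∈ vanishingIdeal ℂ S, ∑ i, eval p (pderiv i f) * ξ i = 0}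
  add_mem' := by
    intro a b ha hb f hf
    simp only [Pi.add_apply, mul_add, Finset.sum_add_distrib, ha f hf, hb f hf, add_zero]
  zero_mem' := by
    intro f _
    simp
  smul_mem' := by
    intro c a ha f hf
    have h : ∀ i, eval p (pderiv i f) * (c • a) i = c * (eval p (pderiv i f) * a i) := by
      intro i
      simp only [Pi.smul_apply, smul_eq_mul]
      ring
    simp only [h, ← Finset.mul_sum, ha f hf, mul_zero]

/-- The smooth points of an irreducible algebraic set. -/
def smoothPoints (S : Set (σ → ℂ)) : Set (σ → ℂ) :=
  {p | p ∈ S ∧ ((Module.finrank ℂ (tangentSpace S p) : ℕ) : WithBot ℕ∞) = zdim S}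

/-- An irreducible hypersurface: the zero set of an irreducible polynomial. -/
def IsIrreducibleHypersurface (X : Set (σ → ℂ)) : Prop :=
  ∃ F : MvPolynomial σ ℂ, Irreducible F ∧ X = {x | eval x F = 0}

end Zariski

/-! ### Coordinates

`ℂ^m` is `Fin m → ℂ`.  Both `V = ℂ^m ⊕ ℂ` (homogeneous coordinates of `ℙ^m = ℙ(V)`, in which
`x ∈ ℂ^m` is the point `[x : 1]` and `ℙ_∞ = ℙ(ℂ^m ⊕ 0)`) and the product `ℂ^m × ℂ` are
`Fin m ⊕ Unit → ℂ`.  A subset of `ℙ^m` is given by the set of its nonzero homogeneous coordinate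
vectors; a closed subset by its closed affine cone, whose dimension is larger by one. -/

section Coordinates

variable {m : ℕ}

/-- The vector `(u, a)` of `ℂ^m ⊕ ℂ`. -/
def pair (u : Fin m → ℂ) (a : ℂ) : Fin m ⊕ Unit → ℂ :=
  Sum.elim u (fun _ => a)

/-- The component in `ℂ^m` of a vector of `ℂ^m ⊕ ℂ`. -/
def vec (q : Fin m ⊕ Unit → ℂ) : Fin m → ℂ :=
  fun i => q (Sum.inl i)

/-- The last component of a vector of `ℂ^m ⊕ ℂ`. -/
def last (q : Fin m ⊕ Unit → ℂ) : ℂ :=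
  q (Sum.inr ())

/-- The cone `K` defines a subset of the hyperplane at infinity. -/
def AtInfinity (K : Set (Fin m ⊕ Unit → ℂ)) : Prop :=
  ∀ q ∈ K, last q = 0

/-- The affine part, in `ℂ^m`, of the subset of `ℙ^m` with cone `K`. -/
def affinePart (K : Set (Fin m ⊕ Unit → ℂ)) : Set (Fin m → ℂ) :=
  {x | pair x 1 ∈ K}

/-- The part at infinity of the subset of `ℙ^m` with cone `K`, as a cone in `ℂ^m`. -/
def infinitePart (K : Set (Fin m ⊕ Unit → ℂ)) : Set (Fin m → ℂ) :=
  {u | pair u 0 ∈ K}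

end Coordinates

/-! ### Normal variety, ramification, focal components

`B` is the bilinear form `⟨ , ⟩` on `ℂ^m` that defines `Q_∞`. -/

section Focal

variable {m : ℕ} (B : LinearMap.BilinForm ℂ (Fin m → ℂ))

/-- The base point `x` of a point `(x, v)` of `ℂ^m × V`. -/
def basePoint (p : Fin m ⊕ (Fin m ⊕ Unit) → ℂ) : Fin m → ℂ :=
  fun i => p (Sum.inl i)

/-- The endpoint map (second projection) on `ℂ^m × V`. -/
def endPoint (p : Fin m ⊕ (Fin m ⊕ Unit) → ℂ) : Fin m ⊕ Unit → ℂ :=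
  fun j => p (Sum.inr j)

/-- The good part of the normal variety: all `(x, [v])` with `x` a smooth point of `X` and
`[v] ∈ ℙ^m` in the projective normal space `N_x(X)`, the join of `[x : 1]` and of the
orthogonal direction `{[w : 0] | w ⊥ T_x X}`; written with homogeneous coordinate vectors `v`. -/
def normalVariety (X : Set (Fin m → ℂ)) : Set (Fin m ⊕ (Fin m ⊕ Unit) → ℂ) :=
  {p | basePoint p ∈ smoothPoints X ∧ endPoint p ≠ 0 ∧
    ∀ ξ ∈ tangentSpace X (basePoint p),
      B (vec (endPoint p) - last (endPoint p) • basePoint p) ξ = 0}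

/-- The ramification locus of `π : (x, [v]) ↦ [v]` on the good normal variety, which is smooth of
dimension `m`: the points where the differential of `π` is not injective.  (On coordinate vectors,
the kernel of the differential of `(x, v) ↦ v` maps isomorphically onto that of `π`.) -/
def ramificationLocus (X : Set (Fin m → ℂ)) : Set (Fin m ⊕ (Fin m ⊕ Unit) → ℂ) :=
  {p | p ∈ normalVariety B X ∧
    ∃ ξ : Fin m → ℂ, ξ ≠ 0 ∧ Sum.elim ξ 0 ∈ tangentSpace (normalVariety B X) p}

/-- `X` is isotropically focally degenerate: `π` is not dominant. -/
def IsIsotropicallyDegenerate (X : Set (Fin m → ℂ)) : Prop :=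
  zcl (endPoint '' normalVariety B X) ≠ Set.univ

/-- The closed cone over the closure of `π(Z)`. -/
def focalCone (Z : Set (Fin m ⊕ (Fin m ⊕ Unit) → ℂ)) : Set (Fin m ⊕ Unit → ℂ) :=
  zcl (endPoint '' Z)

/-- `Z` is a component of the ramification locus which makes `X` focally degenerate: either `X` is
isotropically focally degenerate (and then `Z` is the whole normal variety), or the image of `Z`
is not a hypersurface: it has dimension `< m - 1`, hence its cone has dimension `< m`. -/
def IsDegenerateComponent (X : Set (Fin m → ℂ)) (Z : Set (Fin m ⊕ (Fin m ⊕ Unit) → ℂ)) : Prop :=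
  IsZComponent (ramificationLocus B X) Z ∧
    (IsIsotropicallyDegenerate B X ∨ zdim (focalCone Z) < (m : WithBot ℕ∞))

/-- The non-vertical case: `Z` dominates `X`. -/
def IsNonvertical (X : Set (Fin m → ℂ)) (Z : Set (Fin m ⊕ (Fin m ⊕ Unit) → ℂ)) : Prop :=
  zcl (basePoint '' Z) = X

end Focal

/-! ### The inverse construction -/

section Inverse

variable {m : ℕ} (B : LinearMap.BilinForm ℂ (Fin m → ℂ))

/-- `R ⊆ S × ℂ` is the graph of an algebraic (possibly multivalued, possibly with poles) function
`r` on the irreducible affine variety `S`: it is closed, irreducible, of the same dimension as `S`,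
and dominates `S`. -/
structure IsAlgebraicFunction (S : Set (Fin m → ℂ)) (R : Set (Fin m ⊕ Unit → ℂ)) : Prop where
  closed : IsZClosed R
  irreducible : IsZIrreducible R
  dominant : zcl (vec '' R) = S
  dim_eq : zdim R = zdim S

/-- The family of spheres `⟨x - O, x - O⟩ = r`, `(O, r) ∈ R`. -/
def sphereFamily (R : Set (Fin m ⊕ Unit → ℂ)) :
    Set ((Fin m → ℂ) × (Fin m ⊕ Unit → ℂ)) :=
  {p | p.2 ∈ R ∧ B (p.1 - vec p.2) (p.1 - vec p.2) = last p.2}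

/-- The bundle of affine spaces over the smooth points `(O, r)` of `R`: the points `x` such that
`(x - O, 1/2)` is orthogonal to the tangent space of `R` at `(O, r)`. -/
def affineBundle (R : Set (Fin m ⊕ Unit → ℂ)) :
    Set ((Fin m → ℂ) × (Fin m ⊕ Unit → ℂ)) :=
  {p | p.2 ∈ smoothPoints R ∧
    ∀ τ ∈ tangentSpace R p.2, B (p.1 - vec p.2) (vec τ) + (1 / 2) * last τ = 0}

/-- The total space `Z'` of the inverse construction. -/
def inverseTotal (R : Set (Fin m ⊕ Unit → ℂ)) :
    Set ((Fin m → ℂ) × (Fin m ⊕ Unit → ℂ)) :=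
  sphereFamily B R ∩ affineBundle B R

/-- The closed algebraic set `X'` of the inverse construction. -/
def inverseConstruction (R : Set (Fin m ⊕ Unit → ℂ)) : Set (Fin m → ℂ) :=
  zcl (Prod.fst '' inverseTotal B R)

/-- The pair `(S, r)`, `R` being the graph of `r`, is admissible: `Z'` dominates `S`. -/
def IsAdmissible (S : Set (Fin m → ℂ)) (R : Set (Fin m ⊕ Unit → ℂ)) : Prop :=
  zcl ((fun p => vec p.2) '' inverseTotal B R) = S

/-- For a cone `S` in `ℂ^m` over a nonempty irreducible projective variety at infinity, `R` is the
graph of an algebraic section `r` of `O(1)` on that variety (possibly multivalued and with poles),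
i.e. of an algebraic function on `S` homogeneous of degree one. -/
structure IsAlgebraicSection (S : Set (Fin m → ℂ)) (R : Set (Fin m ⊕ Unit → ℂ)) : Prop where
  graph : IsAlgebraicFunction S R
  homogeneous : ∀ (c : ℂ), ∀ q ∈ R, c • q ∈ R
  nonempty : ∃ u ∈ S, u ≠ 0

/-- The total space of the asymptotic inverse construction: `(x, (O, r))` with `(O, r)` a smooth
point of `R`, `O ≠ 0`, and `⟨x, v⟩ = ρ` for all tangent vectors `(v, ρ)` of `R` at `(O, r)`.  As `R`
is a cone, `(O, r)` is one of them: the conditions are `⟨x, O⟩ = r` and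
`⟨x, ∂O/∂s_j⟩ = ∂r/∂s_j`. -/
def asymptoticTotal (R : Set (Fin m ⊕ Unit → ℂ)) :
    Set ((Fin m → ℂ) × (Fin m ⊕ Unit → ℂ)) :=
  {p | p.2 ∈ smoothPoints R ∧ vec p.2 ≠ 0 ∧
    ∀ τ ∈ tangentSpace R p.2, B p.1 (vec τ) = last τ}

/-- The closed algebraic set `X'` of the asymptotic inverse construction. -/
def asymptoticConstruction (R : Set (Fin m ⊕ Unit → ℂ)) : Set (Fin m → ℂ) :=
  zcl (Prod.fst '' asymptoticTotal B R)

end Inverse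

end FocalLoci

end

noncomputable section

namespace FocalLoci

set_option linter.unusedSectionVars false

/-! ### Zariski closure and irreducibility through polynomial functions. -/

section Basics

variable {σ τ υ : Type} [Fintype σ] [Fintype τ] [Fintype υ]

/-! Everything rests on one differential identity. Let `x` and `O` vary with `x - O` normal to `X`,
and put `r = ⟨x - O, x - O⟩`. Normality says `⟨x - O, dx⟩ = 0`, hence `dr = -2⟨x - O, dO⟩`, which is
the equation of the affine bundle. Conversely, half the differentiated sphere equation added to the
bundle equation gives back `⟨x - O, dx⟩ = 0`. At infinity the pair is `r = ⟨x, O⟩`, with `⟨O, dx⟩ =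
0` equivalent to `dr = ⟨x, dO⟩`.

From a focal component to `r`: along `Z` the differential of `r` factors through `dO`, so at a
generic point of the closure of the pairs `(O, r)` a tangent vector is determined by its `O`-part.
This closure is therefore the graph of an algebraic function (`isAlgebraicFunction_of_factor`), and
the points of `Z` land in the total space of the construction, so `X ⊆ X'`. If `X'` were the whole
space, `dx` would be arbitrary at a generic point and nondegeneracy would force `O = 0` at infinity,
which is excluded, or `x = O` in the finite case, so that the focal cone would be everything,
against degeneracy. A hypersurface contained in a proper closed set is a component of it; at
infinity `X'` is moreover irreducible, so `X = X'`.

Converse: `X` is the closure of the base points of an irreducible subset `W` of the total space.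
Orthogonality puts the scaled pairs `(x, c • O)`, over an open part of `W`, in the normal variety.
Let `m = n + 1`. With homogeneous coordinates this cone has dimension at least `m`. If its image has
dimension below `m`, every generic point carries a kernel vector of `dπ`, so the cone lies in the
ramification locus; when `π` is dominant that locus has dimension at most `m`, so the cone is dense
in a component. If instead `dim Σ = n` and `Z' = A⋆`, the fibres over `(O, r)` contain lines, the
cone fills the normal variety, and its image is too small for `π` to be dominant. The common
statement is `exists_degenerateComponent`.

All dimension arguments are carried out on tangent spaces. The bridge is generic smoothness in
characteristic zero (`exists_smooth_eval`, `IsZIrreducible.exists_submersion`): tangent vectors over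
the function field are derivations, their rank is the Krull dimension, and derivations extend along
dominant maps. Irreducibility of the bundles of affine spaces comes from rational sections
(`exists_section`). -/

theorem aeval_complex (p : σ → ℂ) (f : MvPolynomial σ ℂ) : aeval p f = eval p f := by
  rw [← MvPolynomial.coe_aeval_eq_eval, RingHom.coe_coe]

theorem mem_ideal {S : Set (σ → ℂ)} {f : MvPolynomial σ ℂ} :
    f ∈ vanishingIdeal ℂ S ↔ ∀ x ∈ S, eval x f = 0 := by
  simp only [mem_vanishingIdeal_iff, aeval_complex]

theorem mem_zcl {S : Set (σ → ℂ)} {p : σ → ℂ} :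
    p ∈ zcl S ↔ ∀ f : MvPolynomial σ ℂ, (∀ x ∈ S, eval x f = 0) → eval p f = 0 := by
  simp only [zcl, mem_zeroLocus_iff, mem_ideal, aeval_complex]

theorem subset_zcl (S : Set (σ → ℂ)) : S ⊆ zcl S := fun _ hp => mem_zcl.2 fun _ hf => hf _ hp

theorem zcl_mono {S T : Set (σ → ℂ)} (h : S ⊆ T) : zcl S ⊆ zcl T := fun _ hp =>
  mem_zcl.2 fun f hf => mem_zcl.1 hp f fun x hx => hf x (h hx)

theorem ideal_zcl (S : Set (σ → ℂ)) : vanishingIdeal ℂ (zcl S) = vanishingIdeal ℂ S := by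
  ext f
  rw [mem_ideal, mem_ideal]
  exact ⟨fun h x hx => h x (subset_zcl S hx), fun h x hx => mem_zcl.1 hx f h⟩

theorem zcl_zcl (S : Set (σ → ℂ)) : zcl (zcl S) = zcl S := by
  rw [zcl, ideal_zcl, zcl]

theorem zcl_eq_iff {S T : Set (σ → ℂ)} :
    zcl S = zcl T ↔ vanishingIdeal ℂ S = vanishingIdeal ℂ T :=
  ⟨fun h => by rw [← ideal_zcl S, h, ideal_zcl], fun h => by rw [zcl, h, zcl]⟩

theorem zcl_subset_iff {S T : Set (σ → ℂ)} : zcl S ⊆ zcl T ↔ S ⊆ zcl T :=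
  ⟨fun h => (subset_zcl S).trans h, fun h => by
    rw [← zcl_zcl T]; exact zcl_mono h⟩

theorem irreducible_congr {S T : Set (σ → ℂ)}
    (h : vanishingIdeal ℂ S = vanishingIdeal ℂ T) : IsZIrreducible S ↔ IsZIrreducible T := by
  rw [IsZIrreducible, h, IsZIrreducible]

theorem irreducible_zcl {S : Set (σ → ℂ)} : IsZIrreducible (zcl S) ↔ IsZIrreducible S :=
  irreducible_congr (ideal_zcl S)

theorem zdim_zcl (S : Set (σ → ℂ)) : zdim (zcl S) = zdim S := by
  rw [zdim, ideal_zcl, zdim]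

theorem tangentSpace_congr {S T : Set (σ → ℂ)}
    (h : vanishingIdeal ℂ S = vanishingIdeal ℂ T) (p : σ → ℂ) :
    tangentSpace S p = tangentSpace T p := by
  ext ξ
  change (∀ f ∈ vanishingIdeal ℂ S, _) ↔ (∀ f ∈ vanishingIdeal ℂ T, _)
  rw [h]

/-- The form of primeness used throughout: two nonempty principal open subsets of `S` meet. -/
theorem irreducible_iff {S : Set (σ → ℂ)} :
    IsZIrreducible S ↔ S.Nonempty ∧ ∀ f g : MvPolynomial σ ℂ, (∃ x ∈ S, eval x f ≠ 0) →
      (∃ x ∈ S, eval x g ≠ 0) → ∃ x ∈ S, eval x f ≠ 0 ∧ eval x g ≠ 0 := by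
  rw [IsZIrreducible, Ideal.isPrime_iff]
  refine and_congr ?_ ⟨fun h f g hf hg => ?_, fun h f g hfg => ?_⟩
  · rw [Ne, Ideal.eq_top_iff_one, mem_ideal]
    simp [Set.Nonempty]
  · by_contra! hc
    have : f * g ∈ vanishingIdeal ℂ S := mem_ideal.2 fun x hx => by
      rw [map_mul]
      by_cases h0 : eval x f = 0
      · rw [h0, zero_mul]
      · rw [hc x hx h0, mul_zero]
    rcases h this with h1 | h1
    · obtain ⟨x, hx, hx'⟩ := hf
      exact hx' (mem_ideal.1 h1 x hx)
    · obtain ⟨x, hx, hx'⟩ := hg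
      exact hx' (mem_ideal.1 h1 x hx)
  · by_contra! hc
    rw [mem_ideal, mem_ideal] at hc
    push Not at hc
    obtain ⟨x, hx, h1, h2⟩ := h f g hc.1 hc.2
    have := mem_ideal.1 hfg x hx
    rw [map_mul] at this
    exact (mul_ne_zero h1 h2) this

theorem IsZIrreducible.nonempty {S : Set (σ → ℂ)} (h : IsZIrreducible S) : S.Nonempty :=
  (irreducible_iff.1 h).1

/-! ### Polynomial functions and maps -/

/-- `φ` is a polynomial function. -/
def IsPoly (φ : (σ → ℂ) → ℂ) : Prop :=
  ∃ f : MvPolynomial σ ℂ, ∀ x, eval x f = φ x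

/-- `Φ` is a polynomial map. -/
def IsPolyMap (Φ : (σ → ℂ) → (τ → ℂ)) : Prop :=
  ∀ j, IsPoly fun x => Φ x j

theorem isPoly_eval (f : MvPolynomial σ ℂ) : IsPoly fun x => eval x f := ⟨f, fun _ => rfl⟩

theorem isPoly_const (c : ℂ) : IsPoly fun _ : σ → ℂ => c := ⟨C c, fun x => by simp⟩

theorem isPoly_coord (i : σ) : IsPoly fun x : σ → ℂ => x i := ⟨X i, fun x => by simp⟩

theorem IsPoly.add {φ ψ : (σ → ℂ) → ℂ} (h : IsPoly φ) (k : IsPoly ψ) :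
    IsPoly fun x => φ x + ψ x := by
  obtain ⟨f, hf⟩ := h
  obtain ⟨g, hg⟩ := k
  exact ⟨f + g, fun x => by simp [hf, hg]⟩

theorem IsPoly.sub {φ ψ : (σ → ℂ) → ℂ} (h : IsPoly φ) (k : IsPoly ψ) :
    IsPoly fun x => φ x - ψ x := by
  obtain ⟨f, hf⟩ := h
  obtain ⟨g, hg⟩ := k
  exact ⟨f - g, fun x => by simp [hf, hg]⟩

theorem IsPoly.mul {φ ψ : (σ → ℂ) → ℂ} (h : IsPoly φ) (k : IsPoly ψ) :
    IsPoly fun x => φ x * ψ x := by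
  obtain ⟨f, hf⟩ := h
  obtain ⟨g, hg⟩ := k
  exact ⟨f * g, fun x => by simp [hf, hg]⟩

theorem IsPoly.pow {φ : (σ → ℂ) → ℂ} (h : IsPoly φ) (n : ℕ) :
    IsPoly fun x => φ x ^ n := by
  obtain ⟨f, hf⟩ := h
  exact ⟨f ^ n, fun x => by simp [hf]⟩

theorem IsPoly.sum {ι : Type*} {s : Finset ι} {φ : ι → (σ → ℂ) → ℂ}
    (h : ∀ i ∈ s, IsPoly (φ i)) : IsPoly fun x => ∑ i ∈ s, φ i x := by
  classical
  induction s using Finset.induction_on with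
  | empty => simpa using isPoly_const 0
  | insert a s ha ih =>
    simp only [Finset.sum_insert ha]
    exact (h a (Finset.mem_insert_self a s)).add
      (ih fun i hi => h i (Finset.mem_insert_of_mem hi))

theorem IsPoly.comp {φ : (τ → ℂ) → ℂ} (h : IsPoly φ) {Φ : (σ → ℂ) → (τ → ℂ)}
    (k : IsPolyMap Φ) : IsPoly fun x => φ (Φ x) := by
  obtain ⟨f, hf⟩ := h
  choose g hg using k
  refine ⟨bind₁ g f, fun x => ?_⟩
  have hx : (fun j => eval x (g j)) = Φ x := funext fun j => hg j x
  change _ = φ (Φ x)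
  rw [← hf, ← hx, ← aeval_complex, MvPolynomial.aeval_bind₁, ← aeval_complex]
  simp only [aeval_complex]

theorem IsPolyMap.comp {Ψ : (τ → ℂ) → (υ → ℂ)} (h : IsPolyMap Ψ) {Φ : (σ → ℂ) → (τ → ℂ)}
    (k : IsPolyMap Φ) : IsPolyMap fun x => Ψ (Φ x) := fun j => (h j).comp k

theorem isPolyMap_id : IsPolyMap fun x : σ → ℂ => x := isPoly_coord

theorem isPolyMap_const (c : τ → ℂ) : IsPolyMap fun _ : σ → ℂ => c :=
  fun j => isPoly_const (c j)

theorem isPolyMap_line (p l : σ → ℂ) :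
    IsPolyMap fun t : Unit → ℂ => p + t () • l := fun j =>
  (isPoly_const (p j)).add ((isPoly_coord ()).mul (isPoly_const (l j)))

theorem mem_ideal_of_isPoly {S : Set (σ → ℂ)} {p : σ → ℂ} (hp : p ∈ zcl S) {φ : (σ → ℂ) → ℂ}
    (h : IsPoly φ) (k : ∀ x ∈ S, φ x = 0) : φ p = 0 := by
  obtain ⟨f, hf⟩ := h
  rw [← hf]
  exact mem_zcl.1 hp f fun x hx => by rw [hf, k x hx]

theorem IsZIrreducible.exists_ne {S : Set (σ → ℂ)} (hS : IsZIrreducible S) {φ ψ : (σ → ℂ) → ℂ}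
    (hφ : IsPoly φ) (hψ : IsPoly ψ) (h : ∃ x ∈ S, φ x ≠ 0) (k : ∃ x ∈ S, ψ x ≠ 0) :
    ∃ x ∈ S, φ x ≠ 0 ∧ ψ x ≠ 0 := by
  obtain ⟨f, hf⟩ := hφ
  obtain ⟨g, hg⟩ := hψ
  simp only [← hf, ← hg] at *
  exact (irreducible_iff.1 hS).2 f g h k

theorem irreducible_of {S : Set (σ → ℂ)} (h0 : S.Nonempty)
    (h : ∀ φ ψ : (σ → ℂ) → ℂ, IsPoly φ → IsPoly ψ → (∃ x ∈ S, φ x ≠ 0) → (∃ x ∈ S, ψ x ≠ 0) →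
      ∃ x ∈ S, φ x ≠ 0 ∧ ψ x ≠ 0) : IsZIrreducible S :=
  irreducible_iff.2 ⟨h0, fun f g => h _ _ (isPoly_eval f) (isPoly_eval g)⟩

/-- Nonempty open subsets of irreducible sets are dense. -/
theorem IsZIrreducible.ideal_open {S : Set (σ → ℂ)} (hS : IsZIrreducible S) {φ : (σ → ℂ) → ℂ}
    (hφ : IsPoly φ) (h : ∃ x ∈ S, φ x ≠ 0) :
    vanishingIdeal ℂ {x | x ∈ S ∧ φ x ≠ 0} = vanishingIdeal ℂ S := by
  ext f
  rw [mem_ideal, mem_ideal]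
  refine ⟨fun hf => ?_, fun hf _ hx => hf _ hx.1⟩
  by_contra! hc
  obtain ⟨x, hx, h1, h2⟩ := hS.exists_ne hφ (isPoly_eval f) h hc
  exact h2 (hf x ⟨hx, h1⟩)

theorem IsZIrreducible.zcl_open {S : Set (σ → ℂ)} (hS : IsZIrreducible S) {φ : (σ → ℂ) → ℂ}
    (hφ : IsPoly φ) (h : ∃ x ∈ S, φ x ≠ 0) :
    zcl {x | x ∈ S ∧ φ x ≠ 0} = zcl S :=
  zcl_eq_iff.2 (hS.ideal_open hφ h)

theorem IsZIrreducible.open {S : Set (σ → ℂ)} (hS : IsZIrreducible S) {φ : (σ → ℂ) → ℂ}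
    (hφ : IsPoly φ) (h : ∃ x ∈ S, φ x ≠ 0) : IsZIrreducible {x | x ∈ S ∧ φ x ≠ 0} :=
  (irreducible_congr (hS.ideal_open hφ h)).2 hS

theorem image_zcl_subset {S : Set (σ → ℂ)} {Φ : (σ → ℂ) → (τ → ℂ)} (hΦ : IsPolyMap Φ) :
    Φ '' zcl S ⊆ zcl (Φ '' S) := by
  rintro _ ⟨x, hx, rfl⟩
  refine mem_zcl.2 fun f hf => ?_
  exact mem_ideal_of_isPoly hx ((isPoly_eval f).comp hΦ)
    fun y hy => hf _ (Set.mem_image_of_mem Φ hy)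

theorem zcl_image_zcl (S : Set (σ → ℂ)) {Φ : (σ → ℂ) → (τ → ℂ)} (hΦ : IsPolyMap Φ) :
    zcl (Φ '' zcl S) = zcl (Φ '' S) :=
  Set.Subset.antisymm (zcl_subset_iff.2 (image_zcl_subset hΦ))
    (zcl_mono (Set.image_mono (subset_zcl S)))

/-- The image of a dense subset is dense in the image. -/
theorem zcl_image_congr {S T : Set (σ → ℂ)} (h : zcl S = zcl T) {Φ : (σ → ℂ) → (τ → ℂ)}
    (hΦ : IsPolyMap Φ) : zcl (Φ '' S) = zcl (Φ '' T) := by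
  rw [← zcl_image_zcl S hΦ, h, zcl_image_zcl T hΦ]

theorem IsZIrreducible.image {S : Set (σ → ℂ)} (hS : IsZIrreducible S) {Φ : (σ → ℂ) → (τ → ℂ)}
    (hΦ : IsPolyMap Φ) : IsZIrreducible (Φ '' S) := by
  refine irreducible_of (hS.nonempty.image Φ) fun φ ψ hφ hψ h k => ?_
  simp only [Set.exists_mem_image] at *
  exact hS.exists_ne (hφ.comp hΦ) (hψ.comp hΦ) h k

theorem isZClosed_zcl (S : Set (σ → ℂ)) : IsZClosed (zcl S) := zcl_zcl S

theorem zcl_subset_of_closed {S Y : Set (σ → ℂ)} (hY : IsZClosed Y) (h : S ⊆ Y) : zcl S ⊆ Y := by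
  have := zcl_mono h
  rwa [hY] at this

/-- An irreducible closed set contained in the union of two closed sets lies in one of them. -/
theorem IsZIrreducible.subset_or {S A B : Set (σ → ℂ)} (hS : IsZIrreducible S)
    (hA : IsZClosed A) (hB : IsZClosed B) (h : S ⊆ A ∪ B) : S ⊆ A ∨ S ⊆ B := by
  by_contra! hc
  obtain ⟨⟨x, hx, hxA⟩, ⟨y, hy, hyB⟩⟩ := And.intro (Set.not_subset.1 hc.1) (Set.not_subset.1 hc.2)
  rw [← hA, mem_zcl] at hxA
  rw [← hB, mem_zcl] at hyB
  push Not at hxA hyB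
  obtain ⟨f, hf, hfx⟩ := hxA
  obtain ⟨g, hg, hgy⟩ := hyB
  obtain ⟨z, hz, h1, h2⟩ := (irreducible_iff.1 hS).2 f g ⟨x, hx, hfx⟩ ⟨y, hy, hgy⟩
  rcases h hz with hz | hz
  · exact h1 (hf z hz)
  · exact h2 (hg z hz)

theorem irreducible_univ : IsZIrreducible (Set.univ : Set (σ → ℂ)) := by
  refine irreducible_iff.2 ⟨⟨0, trivial⟩, fun f g ⟨x, _, hx⟩ ⟨y, _, hy⟩ => ?_⟩
  by_contra! hc
  have : f * g = 0 := MvPolynomial.funext fun z => by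
    rw [map_mul, map_zero]
    by_cases h0 : eval z f = 0
    · rw [h0, zero_mul]
    · rw [hc z trivial h0, mul_zero]
  rcases mul_eq_zero.1 this with h | h
  · exact hx (by rw [h, map_zero])
  · exact hy (by rw [h, map_zero])

theorem ideal_univ : vanishingIdeal ℂ (Set.univ : Set (σ → ℂ)) = ⊥ := by
  rw [eq_bot_iff]
  intro f hf
  rw [Ideal.mem_bot]
  exact MvPolynomial.funext fun x => by rw [mem_ideal.1 hf x trivial, map_zero]

theorem zcl_eq_univ_iff {S : Set (σ → ℂ)} : zcl S = Set.univ ↔ vanishingIdeal ℂ S = ⊥ := by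
  rw [← ideal_univ, ← zcl_eq_iff]
  have : zcl (Set.univ : Set (σ → ℂ)) = Set.univ := Set.eq_univ_of_univ_subset (subset_zcl _)
  rw [this]

/-- The product of irreducible sets is irreducible. -/
theorem IsZIrreducible.prod {S : Set (σ → ℂ)} {T : Set (τ → ℂ)} (hS : IsZIrreducible S)
    (hT : IsZIrreducible T) :
    IsZIrreducible {p : σ ⊕ τ → ℂ | (fun i => p (Sum.inl i)) ∈ S ∧ (fun j => p (Sum.inr j)) ∈ T} := by
  have hl : ∀ y : τ → ℂ, IsPolyMap fun x : σ → ℂ => (Sum.elim x y : σ ⊕ τ → ℂ) := by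
    rintro y (i | j)
    · exact isPoly_coord i
    · exact isPoly_const _
  have hr : ∀ x : σ → ℂ, IsPolyMap fun y : τ → ℂ => (Sum.elim x y : σ ⊕ τ → ℂ) := by
    rintro x (i | j)
    · exact isPoly_const _
    · exact isPoly_coord j
  have hp : ∀ p : σ ⊕ τ → ℂ, Sum.elim (fun i => p (Sum.inl i)) (fun j => p (Sum.inr j)) = p := by
    intro p
    funext k
    cases k <;> rfl
  refine irreducible_of ?_ ?_
  · obtain ⟨x, hx⟩ := hS.nonempty
    obtain ⟨y, hy⟩ := hT.nonempty
    exact ⟨Sum.elim x y, hx, hy⟩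
  · rintro φ ψ hφ hψ ⟨p, ⟨hp1, hp2⟩, hp3⟩ ⟨q, ⟨hq1, hq2⟩, hq3⟩
    rw [← hp p] at hp3
    rw [← hp q] at hq3
    -- First the `S`-coordinate moves with the two `T`-coordinates fixed, then the `T`-coordinate
    -- moves over the common `x` so obtained.
    obtain ⟨x, hx, h1, h2⟩ := hS.exists_ne (hφ.comp (hl _)) (hψ.comp (hl _)) ⟨_, hp1, hp3⟩
      ⟨_, hq1, hq3⟩
    obtain ⟨y, hy, h3, h4⟩ := hT.exists_ne (hφ.comp (hr x)) (hψ.comp (hr x)) ⟨_, hp2, h1⟩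
      ⟨_, hq2, h2⟩
    exact ⟨Sum.elim x y, ⟨hx, hy⟩, h3, h4⟩

/-- On a line, two polynomial functions which do not vanish identically do not vanish at a common
point. -/
theorem exists_ne_on_line {φ ψ : (σ → ℂ) → ℂ} (hφ : IsPoly φ) (hψ : IsPoly ψ) {p l : σ → ℂ}
    (h : ∃ t : ℂ, φ (p + t • l) ≠ 0) (k : ∃ t : ℂ, ψ (p + t • l) ≠ 0) :
    ∃ t : ℂ, φ (p + t • l) ≠ 0 ∧ ψ (p + t • l) ≠ 0 := by
  obtain ⟨s, hs⟩ := h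
  obtain ⟨t, ht⟩ := k
  obtain ⟨x, -, h1, h2⟩ := irreducible_univ.exists_ne (hφ.comp (isPolyMap_line p l))
    (hψ.comp (isPolyMap_line p l)) ⟨fun _ => s, trivial, hs⟩ ⟨fun _ => t, trivial, ht⟩
  exact ⟨x (), h1, h2⟩

/-- Numerators: a polynomial function composed with a map with coordinates `a j / b`. -/
theorem exists_numerator {φ : (τ → ℂ) → ℂ} (hφ : IsPoly φ) {a : (σ → ℂ) → (τ → ℂ)}
    (ha : IsPolyMap a) {b : (σ → ℂ) → ℂ} (hb : IsPoly b) :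
    ∃ (N : ℕ) (ψ : (σ → ℂ) → ℂ), IsPoly ψ ∧
      ∀ x, b x ≠ 0 → ψ x = b x ^ N * φ ((b x)⁻¹ • a x) := by
  obtain ⟨f, hf⟩ := hφ
  have : ∃ (N : ℕ) (ψ : (σ → ℂ) → ℂ), IsPoly ψ ∧
      ∀ x, b x ≠ 0 → ψ x = b x ^ N * eval ((b x)⁻¹ • a x) f := by
    clear hf
    induction f using MvPolynomial.induction_on with
    | C c => exact ⟨0, fun _ => c, isPoly_const c, fun x _ => by simp⟩
    | add p q hp hq =>
      obtain ⟨N, ψ, h1, h2⟩ := hp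
      obtain ⟨M, χ, h3, h4⟩ := hq
      refine ⟨N + M, _, ((hb.pow M).mul h1).add ((hb.pow N).mul h3), fun x hx => ?_⟩
      rw [h2 x hx, h4 x hx, map_add]
      ring
    | mul_X p i hp =>
      obtain ⟨N, ψ, h1, h2⟩ := hp
      refine ⟨N + 1, _, h1.mul (ha i), fun x hx => ?_⟩
      rw [h2 x hx, map_mul, eval_X, Pi.smul_apply, smul_eq_mul, pow_succ]
      linear_combination (-(b x ^ N * eval ((b x)⁻¹ • a x) p * a x i)) * mul_inv_cancel₀ hx
  simpa only [hf] using this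

/-! ### Tangent vectors -/

theorem hasDerivAt_eval (f : MvPolynomial σ ℂ) {u : ℂ → σ → ℂ} {ξ : σ → ℂ} {t : ℂ}
    (hu : HasDerivAt u ξ t) :
    HasDerivAt (fun s => eval (u s) f) (∑ i, eval (u t) (pderiv i f) * ξ i) t := by
  have hui := hasDerivAt_pi.1 hu
  induction f using MvPolynomial.induction_on with
  | C c => simpa using hasDerivAt_const t c
  | add p q hp hq =>
    have h : (fun s => eval (u s) (p + q)) = (fun s => eval (u s) p) + fun s => eval (u s) q := by
      funext s
      simp
    rw [h]
    refine (hp.add hq).congr_deriv ?_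
    simp only [map_add, add_mul, Finset.sum_add_distrib]
  | mul_X p i hp =>
    classical
    have h : (fun s => eval (u s) (p * X i)) = (fun s => eval (u s) p) * fun s => u s i := by
      funext s
      simp
    rw [h]
    refine (hp.mul (hui i)).congr_deriv ?_
    simp only [Derivation.leibniz, map_add, smul_eq_mul, map_mul, eval_X, pderiv_X, add_mul,
      Finset.sum_add_distrib, Finset.sum_mul]
    rw [add_comm]
    congr 1
    · rw [Finset.sum_eq_single i]
      · simp
      · intro j _ hj
        simp [hj.symm]
      · simp
    · exact Finset.sum_congr rfl fun j _ => by ring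

theorem hasDerivAt_line (p ξ : σ → ℂ) (t : ℂ) : HasDerivAt (fun t : ℂ => p + t • ξ) ξ t := by
  have := ((hasDerivAt_id t).smul_const ξ).const_add p
  simpa using this

theorem mem_tangentSpace_iff {S : Set (σ → ℂ)} {p ξ : σ → ℂ} :
    ξ ∈ tangentSpace S p ↔ ∀ f ∈ vanishingIdeal ℂ S, ∑ i, eval p (pderiv i f) * ξ i = 0 :=
  Iff.rfl

theorem tangentSpace_mono {S T : Set (σ → ℂ)} (h : S ⊆ zcl T) (p : σ → ℂ) :
    tangentSpace S p ≤ tangentSpace T p := fun _ hξ f hf => hξ f (mem_ideal.2 fun _ hx =>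
  mem_zcl.1 (h hx) f (mem_ideal.1 hf))

theorem deriv_eq_of_mem_tangentSpace {S : Set (σ → ℂ)} {p ξ : σ → ℂ} (hξ : ξ ∈ tangentSpace S p)
    {φ : (σ → ℂ) → ℂ} (hφ : IsPoly φ) (h0 : ∀ x ∈ S, φ x = 0) {c : ℂ}
    (hc : HasDerivAt (fun t : ℂ => φ (p + t • ξ)) c 0) : c = 0 := by
  obtain ⟨f, hf⟩ := hφ
  simp only [← hf] at *
  have h1 := hasDerivAt_eval f (hasDerivAt_line p ξ 0)
  rw [hc.unique h1]
  simpa using hξ f (mem_ideal.2 h0)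

/-- Derivatives of polynomial maps are maps of tangent spaces. -/
theorem map_mem_tangentSpace {S : Set (σ → ℂ)} {Y : Set (τ → ℂ)} {Φ : (σ → ℂ) → (τ → ℂ)}
    (hΦ : IsPolyMap Φ) (hY : ∀ x ∈ S, Φ x ∈ zcl Y) {p ξ : σ → ℂ} (hξ : ξ ∈ tangentSpace S p)
    {η : τ → ℂ} (hη : HasDerivAt (fun t : ℂ => Φ (p + t • ξ)) η 0) : η ∈ tangentSpace Y (Φ p) := by
  intro f hf
  refine deriv_eq_of_mem_tangentSpace hξ ((isPoly_eval f).comp hΦ)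
    (fun x hx => mem_zcl.1 (hY x hx) f (mem_ideal.1 hf)) ?_
  have := hasDerivAt_eval f hη
  simpa using this

/-- Velocity vectors of lines and curves in a set are tangent vectors. -/
theorem mem_tangentSpace_of_curve {S : Set (σ → ℂ)} {u : (Unit → ℂ) → (σ → ℂ)} (hu : IsPolyMap u)
    {φ : (Unit → ℂ) → ℂ} (hφ : IsPoly φ) {t : Unit → ℂ} (ht : φ t ≠ 0)
    (h : ∀ s, φ s ≠ 0 → u s ∈ zcl S) {ξ : σ → ℂ} {τ₀ : Unit → ℂ}
    (hξ : HasDerivAt (fun s : ℂ => u (t + s • τ₀)) ξ 0) : ξ ∈ tangentSpace S (u t) := by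
  have h1 : IsZIrreducible {s : Unit → ℂ | s ∈ Set.univ ∧ φ s ≠ 0} :=
    irreducible_univ.open hφ ⟨t, trivial, ht⟩
  refine map_mem_tangentSpace hu (S := {s : Unit → ℂ | s ∈ Set.univ ∧ φ s ≠ 0})
    (fun _ hx => h _ hx.2) ?_ hξ
  -- A nonempty open part of the line is dense, so its ideal is zero and every vector is tangent to
  -- it.
  rw [tangentSpace_congr (irreducible_univ.ideal_open hφ ⟨t, trivial, ht⟩)]
  intro f hf
  rw [ideal_univ, Ideal.mem_bot] at hf
  simp [hf]

end Basics

/-! ### Derivations and transcendence -/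

section Derivations

open scoped TensorProduct

/-- Derivations extend uniquely along formally étale algebras. -/
theorem existsUnique_derivation_of_formallyEtale {R S T Q : Type*} [CommRing R] [CommRing S]
    [CommRing T] [Algebra R S] [Algebra R T] [Algebra S T] [IsScalarTower R S T]
    [Algebra.FormallyEtale S T] [AddCommGroup Q] [Module R Q] [Module S Q] [Module T Q]
    [IsScalarTower S T Q] [IsScalarTower R S Q] [IsScalarTower R T Q] (D : Derivation R S Q) :
    ∃! D' : Derivation R T Q, ∀ s, D' (algebraMap S T s) = D s := by
  have hb := KaehlerDifferential.isBaseChange_of_formallyEtale R S T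
  refine ⟨(hb.lift D.liftKaehlerDifferential).compDer (KaehlerDifferential.D R T), fun s => ?_,
    fun D' hD' => ?_⟩
  · change hb.lift _ (KaehlerDifferential.D R T (algebraMap S T s)) = _
    rw [← KaehlerDifferential.map_D R R S T, hb.lift_eq, Derivation.liftKaehlerDifferential_comp_D]
  · have h : D'.liftKaehlerDifferential = hb.lift D.liftKaehlerDifferential := by
      refine hb.algHom_ext _ _ fun ω => ?_
      rw [hb.lift_eq]
      have h2 : (D'.liftKaehlerDifferential.restrictScalars S).comp
          (KaehlerDifferential.map R R S T) = D.liftKaehlerDifferential :=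
        Derivation.liftKaehlerDifferential_unique _ _ (Derivation.ext fun s => by
          change D'.liftKaehlerDifferential (KaehlerDifferential.map R R S T (KaehlerDifferential.D R S s)) =
            D.liftKaehlerDifferential (KaehlerDifferential.D R S s)
          rw [KaehlerDifferential.map_D, Derivation.liftKaehlerDifferential_comp_D,
            Derivation.liftKaehlerDifferential_comp_D, hD'])
      exact LinearMap.congr_fun h2 ω
    rw [← h]
    exact (Derivation.liftKaehlerDifferential_comp D').symm

/-- Formal smoothness kills the `H1Cotangent` term, so `Ω[L/k] ⊗ K → Ω[K/k]` is injective; over a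
field it has a left inverse, with which the derivation is composed. -/
theorem exists_derivation_of_formallySmooth {k L K : Type*} [Field k] [Field L] [Field K]
    [Algebra k L] [Algebra k K] [Algebra L K] [IsScalarTower k L K] [Algebra.FormallySmooth L K]
    (D : Derivation k L K) : ∃ D' : Derivation k K K, ∀ s, D' (algebraMap L K s) = D s := by
  have hinj : Function.Injective (KaehlerDifferential.mapBaseChange k L K) := by
    rw [injective_iff_map_eq_zero]
    intro x hx
    obtain ⟨x, rfl⟩ := (Algebra.H1Cotangent.exact_δ_mapBaseChange k L K x).mp hx
    rw [Subsingleton.elim x 0, map_zero]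
  obtain ⟨g, hg⟩ := LinearMap.exists_leftInverse_of_injective _ (LinearMap.ker_eq_bot.2 hinj)
  refine ⟨((D.liftKaehlerDifferential.liftBaseChange K).comp g).compDer
    (KaehlerDifferential.D k K), fun s => ?_⟩
  change D.liftKaehlerDifferential.liftBaseChange K (g (KaehlerDifferential.D k K _)) = _
  have h1 : KaehlerDifferential.D k K (algebraMap L K s) =
      KaehlerDifferential.mapBaseChange k L K (1 ⊗ₜ KaehlerDifferential.D k L s) := by
    rw [KaehlerDifferential.mapBaseChange_tmul, one_smul, KaehlerDifferential.map_D]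
  rw [h1]
  have h2 := LinearMap.congr_fun hg (1 ⊗ₜ KaehlerDifferential.D k L s)
  rw [LinearMap.comp_apply, LinearMap.id_apply] at h2
  rw [h2, LinearMap.liftBaseChange_tmul, one_smul, Derivation.liftKaehlerDifferential_comp_D]

/-- Incomparability gives one inequality, lying over and going up the other. -/
theorem ringKrullDim_eq_of_integral {R S : Type*} [CommRing R] [CommRing S] [Algebra R S]
    [Algebra.IsIntegral R S] (h : Function.Injective (algebraMap R S)) :
    ringKrullDim S = ringKrullDim R := by
  refine le_antisymm ?_ ?_
  · refine Order.krullDim_le_of_strictMono (PrimeSpectrum.comap (algebraMap R S)) ?_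
    intro p q hpq
    exact Ideal.IsIntegral.comap_lt_comap (I := p.asIdeal) (J := q.asIdeal) hpq
  · refine iSup_le fun l => ?_
    obtain ⟨Q, -, hQ, hQ'⟩ := Ideal.exists_ideal_over_prime_of_isIntegral l.head.asIdeal (⊥ : Ideal S)
      (by rw [← RingHom.ker_eq_comap_bot, (RingHom.injective_iff_ker_eq_bot _).1 h]; exact bot_le)
    have : Q.LiesOver l.head.asIdeal := ⟨hQ'.symm⟩
    obtain ⟨L, hL, -⟩ := Ideal.exists_ltSeries_of_hasGoingUp (S := S) l Q
    rw [← hL]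
    exact le_iSup (fun L : LTSeries (PrimeSpectrum S) => (L.length : WithBot ℕ∞)) L

/-- The module of derivations of an affine domain into an extension of its field of fractions has
rank equal to the Krull dimension. -/
theorem finrank_derivation (k B K : Type) [Field k] [CharZero k] [CommRing B] [IsDomain B]
    [Algebra k B] [Algebra.FiniteType k B] [Field K] [Algebra k K] [Algebra B K]
    [IsScalarTower k B K] (hBK : Function.Injective (algebraMap B K)) :
    Module.Finite K (Derivation k B K) ∧
      ((Module.finrank K (Derivation k B K) : ℕ) : WithBot ℕ∞) = ringKrullDim B := by
  -- Noether normalization: `s` is both the Krull dimension of `B` and the number of free values of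
  -- a derivation.
  obtain ⟨s, g, hg, hfin⟩ := exists_finite_inj_algHom_of_fg k B
  let _ : Algebra (MvPolynomial (Fin s) k) B := g.toRingHom.toAlgebra
  have : IsScalarTower k (MvPolynomial (Fin s) k) B := .of_algebraMap_eq fun x => (g.commutes x).symm
  have : Module.Finite (MvPolynomial (Fin s) k) B := hfin
  have : Algebra.IsIntegral (MvPolynomial (Fin s) k) B := inferInstance
  let _ : Algebra (MvPolynomial (Fin s) k) K := ((algebraMap B K).comp g.toRingHom).toAlgebra
  have : IsScalarTower (MvPolynomial (Fin s) k) B K := .of_algebraMap_eq fun x => rfl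
  have : IsScalarTower k (MvPolynomial (Fin s) k) K := .of_algebraMap_eq fun x => by
    rw [IsScalarTower.algebraMap_apply k B K, IsScalarTower.algebraMap_apply k
      (MvPolynomial (Fin s) k) B]
    rfl
  have hdim : ringKrullDim B = (s : WithBot ℕ∞) := by
    rw [ringKrullDim_eq_of_integral (R := MvPolynomial (Fin s) k) (S := B) hg,
      MvPolynomial.ringKrullDim_of_isNoetherianRing, ringKrullDim_eq_zero_of_field]
    simp
  have : FaithfulSMul B K := (faithfulSMul_iff_algebraMap_injective B K).2 hBK
  have : FaithfulSMul (MvPolynomial (Fin s) k) B :=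
    (faithfulSMul_iff_algebraMap_injective _ B).2 hg
  let L := FractionRing B
  let L₀ := FractionRing (MvPolynomial (Fin s) k)
  have : FaithfulSMul (MvPolynomial (Fin s) k) L := FaithfulSMul.trans _ B L
  let _ : Algebra L K := FractionRing.liftAlgebra B K
  have : IsScalarTower B L K := FractionRing.isScalarTower_liftAlgebra B K
  let _ : Algebra L₀ L := FractionRing.liftAlgebra (MvPolynomial (Fin s) k) L
  have : IsScalarTower (MvPolynomial (Fin s) k) L₀ L := FractionRing.isScalarTower_liftAlgebra _ L
  have : IsScalarTower k L K := .of_algebraMap_eq fun x => by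
    rw [IsScalarTower.algebraMap_apply k B K, IsScalarTower.algebraMap_apply k B L,
      ← IsScalarTower.algebraMap_apply B L K]
  have : IsScalarTower (MvPolynomial (Fin s) k) L K := .of_algebraMap_eq fun x => by
    rw [IsScalarTower.algebraMap_apply _ B K, IsScalarTower.algebraMap_apply _ B L,
      ← IsScalarTower.algebraMap_apply B L K]
  have : Algebra.IsAlgebraic L₀ L :=
    isAlgebraic_of_isFractionRing (MvPolynomial (Fin s) k) B L₀ L
  have : CharZero L₀ := charZero_of_injective_algebraMap (FaithfulSMul.algebraMap_injective k L₀)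
  have : Algebra.FormallyEtale L₀ L := Algebra.FormallyEtale.of_isSeparable L₀ L
  have : Algebra.FormallyEtale (MvPolynomial (Fin s) k) L₀ :=
    .of_isLocalization (nonZeroDivisors _)
  -- The fraction field of `B` is formally étale over `B` and over the polynomial ring, so both
  -- rings have the same derivations into `K`.
  have : Algebra.FormallyEtale (MvPolynomial (Fin s) k) L := .comp _ L₀ L
  have : Algebra.FormallyEtale B L := .of_isLocalization (nonZeroDivisors _)
  let e : Derivation k B K →ₗ[K] (Fin s → K) :=
    { toFun := fun D i => D (algebraMap (MvPolynomial (Fin s) k) B (X i))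
      map_add' := fun _ _ => rfl
      map_smul' := fun _ _ => rfl }
  have he : Function.Bijective e := by
    constructor
    · rw [injective_iff_map_eq_zero]
      intro D hD
      obtain ⟨D', h1, -⟩ := existsUnique_derivation_of_formallyEtale (T := L) D
      obtain ⟨D'', -, h2⟩ := existsUnique_derivation_of_formallyEtale (T := L)
        (0 : Derivation k (MvPolynomial (Fin s) k) K)
      have h3 : D'.compAlgebraMap (MvPolynomial (Fin s) k) = 0 := by
        refine MvPolynomial.derivation_ext fun i => ?_
        rw [Derivation.compAlgebraMap_apply]
        rw [IsScalarTower.algebraMap_apply _ B L, h1]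
        exact congrFun hD i
      have h4 : D' = 0 := (h2 D' fun s => DFunLike.congr_fun h3 s).trans
        (h2 0 fun s => rfl).symm
      ext b
      rw [← h1, h4]
      rfl
    · intro v
      obtain ⟨D', h1, -⟩ := existsUnique_derivation_of_formallyEtale (T := L)
        (MvPolynomial.mkDerivation k v : Derivation k (MvPolynomial (Fin s) k) K)
      refine ⟨D'.compAlgebraMap B, funext fun i => ?_⟩
      change D' (algebraMap B L (algebraMap (MvPolynomial (Fin s) k) B (X i))) = v i
      rw [← IsScalarTower.algebraMap_apply, h1, mkDerivation_X]
  let e' := LinearEquiv.ofBijective e he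
  refine ⟨Module.Finite.equiv e'.symm, ?_⟩
  rw [hdim, e'.finrank_eq, Module.finrank_fin_fun]

/-- Derivations extend to affine domains containing the given one. -/
theorem exists_derivation_extension (k B A K : Type) [Field k] [CharZero k] [CommRing B]
    [IsDomain B] [Algebra k B] [CommRing A] [IsDomain A] [Algebra k A] [Algebra.FiniteType k A]
    [Algebra B A] [IsScalarTower k B A] [Field K] [Algebra k K] [Algebra B K] [Algebra A K]
    [IsScalarTower k B K] [IsScalarTower k A K] [IsScalarTower B A K] [IsFractionRing A K]
    (hBA : Function.Injective (algebraMap B A)) (D : Derivation k B K) :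
    ∃ D' : Derivation k A K, ∀ b, D' (algebraMap B A b) = D b := by
  have hBK : Function.Injective (algebraMap B K) := by
    rw [IsScalarTower.algebraMap_eq B A K]
    exact (IsFractionRing.injective A K).comp hBA
  have : FaithfulSMul B K := (faithfulSMul_iff_algebraMap_injective B K).2 hBK
  let L := FractionRing B
  let _ : Algebra L K := FractionRing.liftAlgebra B K
  have : IsScalarTower B L K := FractionRing.isScalarTower_liftAlgebra B K
  have : IsScalarTower k L K := .of_algebraMap_eq fun x => by
    rw [IsScalarTower.algebraMap_apply k B K, IsScalarTower.algebraMap_apply k B L,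
      ← IsScalarTower.algebraMap_apply B L K]
  have : Algebra.FormallyEtale B L := .of_isLocalization (nonZeroDivisors _)
  have : CharZero L := charZero_of_injective_algebraMap (FaithfulSMul.algebraMap_injective k L)
  -- A finitely generated field extension in characteristic zero is formally smooth, so derivations
  -- extend along it.
  have : Algebra.EssFiniteType A K := .of_isLocalization K (nonZeroDivisors A)
  have : Algebra.EssFiniteType k K := .comp k A K
  have : Algebra.EssFiniteType L K := .of_comp k L K
  obtain ⟨D₁, h1, -⟩ := existsUnique_derivation_of_formallyEtale (T := L) D
  obtain ⟨D₂, h2⟩ := exists_derivation_of_formallySmooth D₁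
  refine ⟨D₂.compAlgebraMap A, fun b => ?_⟩
  rw [Derivation.compAlgebraMap_apply, ← IsScalarTower.algebraMap_apply B A K,
    IsScalarTower.algebraMap_apply B L K, h2, h1]

end Derivations

/-! ### Generic tangent vectors -/

section GenericTangent

variable {σ : Type} [Fintype σ] (I : Ideal (MvPolynomial σ ℂ)) (K : Type) [Field K] [Algebra ℂ K]
  [Algebra (MvPolynomial σ ℂ ⧸ I) K] [IsScalarTower ℂ (MvPolynomial σ ℂ ⧸ I) K]

/-- The value of a polynomial at the point of `V(I)` with coordinates in `K`. -/
def gen : MvPolynomial σ ℂ →+* K :=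
  (algebraMap (MvPolynomial σ ℂ ⧸ I) K).comp (Ideal.Quotient.mk I)

/-- The tangent space at the point of `V(I)` with coordinates in `K`. -/
def genTangent : Submodule K (σ → K) where
  carrier := {ξ | ∀ f ∈ I, ∑ i, gen I K (pderiv i f) * ξ i = 0}
  add_mem' := by
    intro a b ha hb f hf
    simp only [Pi.add_apply, mul_add, Finset.sum_add_distrib, ha f hf, hb f hf, add_zero]
  zero_mem' := by
    intro f _
    simp
  smul_mem' := by
    intro c a ha f hf
    have h : ∀ i, gen I K (pderiv i f) * (c • a) i = c * (gen I K (pderiv i f) * a i) := by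
      intro i
      simp only [Pi.smul_apply, smul_eq_mul]
      ring
    simp only [h, ← Finset.mul_sum, ha f hf, mul_zero]

variable {I K}

theorem gen_C (c : ℂ) : gen I K (C c) = algebraMap ℂ K c := by
  rw [IsScalarTower.algebraMap_apply ℂ (MvPolynomial σ ℂ ⧸ I) K]
  rfl

theorem derivation_mk (D : Derivation ℂ (MvPolynomial σ ℂ ⧸ I) K) (f : MvPolynomial σ ℂ) :
    D (Ideal.Quotient.mk I f) =
      ∑ i, gen I K (pderiv i f) * D (Ideal.Quotient.mk I (X i)) := by
  classical
  induction f using MvPolynomial.induction_on with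
  | C c =>
    have h : Ideal.Quotient.mk I (C c) = algebraMap ℂ _ c := rfl
    rw [h, D.map_algebraMap]
    simp
  | add p q hp hq => simp only [map_add, hp, hq, add_mul, Finset.sum_add_distrib]
  | mul_X p i hp =>
    rw [map_mul, D.leibniz, hp]
    simp only [Derivation.leibniz, map_add, smul_eq_mul, map_mul, pderiv_X, add_mul,
      Finset.sum_add_distrib]
    congr 1
    · rw [Finset.sum_eq_single i]
      · simp [gen, Algebra.smul_def]
      · intro j _ hj
        simp [hj.symm]
      · simp
    · rw [Algebra.smul_def, Finset.mul_sum]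
      exact Finset.sum_congr rfl fun j _ => by
        rw [← mul_assoc]
        rfl

/-- The vector `ξ` annihilates the differentials of the elements of `I`, so `d f = ∑ ∂ᵢf ξᵢ` does
not depend on the representative chosen by `Quotient.out`. -/
theorem exists_derivation_of_mem_genTangent {ξ : σ → K} (hξ : ξ ∈ genTangent I K) :
    ∃ D : Derivation ℂ (MvPolynomial σ ℂ ⧸ I) K, ∀ i, D (Ideal.Quotient.mk I (X i)) = ξ i := by
  classical
  let d : MvPolynomial σ ℂ → K := fun f => ∑ i, gen I K (pderiv i f) * ξ i
  have hadd : ∀ f g, d (f + g) = d f + d g := fun f g => by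
    simp only [d, map_add, add_mul, Finset.sum_add_distrib]
  have hmul : ∀ f g, d (f * g) = gen I K f * d g + gen I K g * d f := fun f g => by
    simp only [d, Derivation.leibniz, map_add, smul_eq_mul, map_mul, add_mul,
      Finset.sum_add_distrib, Finset.mul_sum, mul_assoc]
  have hC : ∀ c, d (C c) = 0 := fun c => by simp [d]
  have hout : ∀ f, d (Quotient.out (Ideal.Quotient.mk I f)) = d f := fun f => by
    have h1 : Quotient.out (Ideal.Quotient.mk I f) - f ∈ I :=
      Ideal.Quotient.eq.1 (Quotient.out_eq _)
    have h2 : d (Quotient.out (Ideal.Quotient.mk I f) - f) = 0 := hξ _ h1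
    have h3 := hadd (Quotient.out (Ideal.Quotient.mk I f) - f) f
    rwa [sub_add_cancel, h2, zero_add] at h3
  refine ⟨Derivation.mk' (R := ℂ)
    { toFun := fun a => d (Quotient.out a)
      map_add' := ?_
      map_smul' := ?_ } ?_, fun i => ?_⟩
  · intro a b
    obtain ⟨f, rfl⟩ := Ideal.Quotient.mk_surjective a
    obtain ⟨g, rfl⟩ := Ideal.Quotient.mk_surjective b
    rw [← map_add, hout, hout, hout, hadd]
  · intro c a
    obtain ⟨f, rfl⟩ := Ideal.Quotient.mk_surjective a
    have h : c • Ideal.Quotient.mk I f = Ideal.Quotient.mk I (C c * f) := by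
      rw [← MvPolynomial.smul_eq_C_mul]
      rfl
    rw [h, hout, hout, hmul, hC, mul_zero, add_zero, gen_C, RingHom.id_apply, Algebra.smul_def]
  · intro a b
    obtain ⟨f, rfl⟩ := Ideal.Quotient.mk_surjective a
    obtain ⟨g, rfl⟩ := Ideal.Quotient.mk_surjective b
    change d (Quotient.out (_ * _)) = _ • d (Quotient.out _) + _ • d (Quotient.out _)
    rw [← map_mul, hout, hout, hout, hmul, Algebra.smul_def, Algebra.smul_def]
    rfl
  · change d (Quotient.out _) = _
    rw [hout]
    change ∑ j, gen I K (pderiv j (X i)) * ξ j = ξ i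
    rw [Finset.sum_eq_single i]
    · simp
    · intro j _ hj
      simp [hj.symm]
    · simp

theorem derivation_mem_genTangent (D : Derivation ℂ (MvPolynomial σ ℂ ⧸ I) K) :
    (fun i => D (Ideal.Quotient.mk I (X i))) ∈ genTangent I K := fun f hf => by
  rw [← derivation_mk, Ideal.Quotient.eq_zero_iff_mem.2 hf, map_zero]

/-- A derivation is determined by its values on the coordinates, and these are exactly the tangent
vectors; `finrank_derivation` counts them. Here `K` need not be the fraction field of the coordinate
ring, which matters for dominant maps. -/
theorem finrank_genTangent (hI : I.IsPrime)
    (hK : Function.Injective (algebraMap (MvPolynomial σ ℂ ⧸ I) K)) :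
    ((Module.finrank K (genTangent I K) : ℕ) : WithBot ℕ∞) =
      ringKrullDim (MvPolynomial σ ℂ ⧸ I) := by
  have h := (finrank_derivation ℂ (MvPolynomial σ ℂ ⧸ I) K hK).2
  let e : Derivation ℂ (MvPolynomial σ ℂ ⧸ I) K →ₗ[K] genTangent I K :=
    { toFun := fun D => ⟨_, derivation_mem_genTangent D⟩
      map_add' := fun _ _ => rfl
      map_smul' := fun _ _ => rfl }
  have he : Function.Bijective e := by
    constructor
    · intro D D' hDD
      ext a
      obtain ⟨f, rfl⟩ := Ideal.Quotient.mk_surjective a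
      rw [derivation_mk, derivation_mk]
      exact Finset.sum_congr rfl fun i _ => by
        rw [show D (Ideal.Quotient.mk I (X i)) = D' (Ideal.Quotient.mk I (X i)) from
          congrFun (congrArg Subtype.val hDD) i]
    · rintro ⟨ξ, hξ⟩
      obtain ⟨D, hD⟩ := exists_derivation_of_mem_genTangent hξ
      exact ⟨D, Subtype.ext (funext hD)⟩
  rw [← h, (LinearEquiv.ofBijective e he).finrank_eq]

end GenericTangent

/-! ### Specialization -/

section Specialization

variable {σ τ : Type} [Fintype σ] [Fintype τ]

theorem gen_eq_zero_iff {I : Ideal (MvPolynomial σ ℂ)} [I.IsPrime] {f : MvPolynomial σ ℂ} :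
    gen I (FractionRing (MvPolynomial σ ℂ ⧸ I)) f = 0 ↔ f ∈ I := by
  rw [gen, RingHom.comp_apply, map_eq_zero_iff _ (IsFractionRing.injective _ _),
    Ideal.Quotient.eq_zero_iff_mem]

/-- Common denominators. -/
theorem exists_denominator {I : Ideal (MvPolynomial σ ℂ)} [I.IsPrime] {κ : Type} [Finite κ]
    (v : κ → FractionRing (MvPolynomial σ ℂ ⧸ I)) :
    ∃ b, b ∉ I ∧ ∃ u : κ → MvPolynomial σ ℂ, ∀ k, gen I _ (u k) = gen I _ b * v k := by
  obtain ⟨b, hb⟩ := IsLocalization.exist_integer_multiples_of_finite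
    (nonZeroDivisors (MvPolynomial σ ℂ ⧸ I)) v
  obtain ⟨b₀, hb₀⟩ := Ideal.Quotient.mk_surjective (b : MvPolynomial σ ℂ ⧸ I)
  refine ⟨b₀, fun h => ?_, ?_⟩
  · have := nonZeroDivisors.coe_ne_zero b
    rw [← hb₀, Ideal.Quotient.eq_zero_iff_mem.2 h] at this
    exact this rfl
  · choose u hu using hb
    choose w hw using fun k => Ideal.Quotient.mk_surjective (u k)
    refine ⟨w, fun k => ?_⟩
    rw [gen, RingHom.comp_apply, hw, hu, RingHom.comp_apply, hb₀, Algebra.smul_def]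

/-- Generic linear independence implies linear independence at the points of a nonempty open
subset. -/
theorem exists_linearIndependent_eval {W : Set (σ → ℂ)} [hW : (vanishingIdeal ℂ W).IsPrime]
    {κ ι : Type} [Finite κ] [Finite ι] (v : κ → ι → MvPolynomial σ ℂ)
    (hv : LinearIndependent (FractionRing (MvPolynomial σ ℂ ⧸ vanishingIdeal ℂ W))
      (fun k i => gen (vanishingIdeal ℂ W)
        (FractionRing (MvPolynomial σ ℂ ⧸ vanishingIdeal ℂ W)) (v k i))) :
    ∃ h ∉ vanishingIdeal ℂ W, ∀ w ∈ W, eval w h ≠ 0 →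
      LinearIndependent ℂ fun k i => eval w (v k i) := by
  classical
  have := Fintype.ofFinite κ
  have := Fintype.ofFinite ι
  set K := FractionRing (MvPolynomial σ ℂ ⧸ vanishingIdeal ℂ W)
  set g := gen (vanishingIdeal ℂ W) K
  -- Independence over the function field is witnessed by a left inverse. Its cleared denominator
  -- `b` is the open condition: where `b ≠ 0`, the numerators still invert the evaluated family.
  obtain ⟨r, hr⟩ := LinearMap.exists_leftInverse_of_injective
    (Fintype.linearCombination K fun k i => g (v k i))
    (LinearMap.ker_eq_bot.2 (linearIndependent_iff_injective_fintypeLinearCombination.1 hv))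
  have hr' : ∀ k l, ∑ i, r (Pi.single i 1) l * g (v k i) = if k = l then 1 else 0 := by
    intro k l
    have h1 := LinearMap.congr_fun hr (Pi.single k 1)
    rw [LinearMap.comp_apply, Fintype.linearCombination_apply_single, one_smul,
      LinearMap.id_apply] at h1
    have h2 := congrFun h1 l
    rw [Pi.single_apply] at h2
    rw [LinearMap.pi_apply_eq_sum_univ r, Finset.sum_apply] at h2
    simp only [eq_comm (a := l)] at h2
    rw [← h2]
    refine Finset.sum_congr rfl fun i _ => ?_
    rw [Pi.smul_apply, smul_eq_mul, mul_comm]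
    congr 1
    refine congrFun (congrArg r (funext fun j => ?_)) l
    simp [Pi.single_apply, eq_comm]
  obtain ⟨b, hb, u, hu⟩ := exists_denominator (I := vanishingIdeal ℂ W)
    fun p : ι × κ => r (Pi.single p.1 1) p.2
  refine ⟨b, hb, fun w hw hbw => ?_⟩
  have key : ∀ k l, ∑ i, eval w (u (i, l)) * eval w (v k i) =
      if k = l then eval w b else 0 := by
    intro k l
    have h1 : ∑ i, u (i, l) * v k i - (if k = l then b else 0) ∈ vanishingIdeal ℂ W := by
      rw [← gen_eq_zero_iff, map_sub, map_sum, sub_eq_zero]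
      simp only [map_mul, hu, mul_assoc, ← Finset.mul_sum]
      rw [hr']
      split_ifs <;> simp
    have h2 := mem_ideal.1 h1 w hw
    rw [map_sub, map_sum, sub_eq_zero] at h2
    simp only [map_mul] at h2
    rw [h2]
    split_ifs <;> simp
  rw [Fintype.linearIndependent_iff]
  intro c hc l
  have h1 : ∑ i, eval w (u (i, l)) * (∑ k, c k • fun i => eval w (v k i)) i = 0 := by
    rw [hc]
    simp
  simp only [Finset.sum_apply, Pi.smul_apply, smul_eq_mul, Finset.mul_sum] at h1
  rw [Finset.sum_comm] at h1
  have h2 : ∀ k, ∑ i, eval w (u (i, l)) * (c k * eval w (v k i)) =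
      c k * if k = l then eval w b else 0 := by
    intro k
    rw [← key, Finset.mul_sum]
    exact Finset.sum_congr rfl fun i _ => by ring
  simp only [h2] at h1
  simpa [hbw] using h1

/-- Solutions of a system of linear equations: the dimension formula. -/
theorem finrank_add_finrank_annihilator {K ι : Type} [Field K] [Fintype ι] (G : Set (ι → K))
    (T : Submodule K (ι → K)) (hT : ∀ ξ, ξ ∈ T ↔ ∀ a ∈ G, ∑ i, a i * ξ i = 0) :
    Module.finrank K T + Module.finrank K (Submodule.span K G) = Fintype.card ι ∧
      ∀ a : ι → K, (∀ ξ ∈ T, ∑ i, a i * ξ i = 0) → a ∈ Submodule.span K G := by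
  classical
  let e := dotProductEquiv K ι
  have hT' : T = ((Submodule.span K G).map e.toLinearMap).dualCoannihilator := by
    ext ξ
    rw [hT, Submodule.mem_dualCoannihilator]
    constructor
    · rintro h _ ⟨a, ha, rfl⟩
      induction ha using Submodule.span_induction with
      | mem a ha => exact h a ha
      | zero => simp
      | add a b _ _ ha hb => rw [map_add, LinearMap.add_apply, ha, hb, add_zero]
      | smul c a _ ha => rw [map_smul, LinearMap.smul_apply, ha, smul_zero]
    · intro h a ha
      exact h _ ⟨a, Submodule.subset_span ha, rfl⟩
  have h1 := Subspace.finrank_add_finrank_dualCoannihilator_eq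
    ((Submodule.span K G).map e.toLinearMap)
  rw [← hT', LinearEquiv.finrank_map_eq, Module.finrank_fintype_fun_eq_card] at h1
  refine ⟨by rw [add_comm]; exact h1, fun a ha => ?_⟩
  have h2 : e a ∈ T.dualAnnihilator := by
    rw [Submodule.mem_dualAnnihilator]
    exact ha
  rw [hT', Subspace.dualCoannihilator_dualAnnihilator_eq] at h2
  obtain ⟨b, hb, hab⟩ := h2
  rwa [← e.injective hab]

end Specialization

/-! ### Generic smoothness -/

section GenericSmoothness

variable {σ τ : Type} [Fintype σ] [Fintype τ]

theorem card_le_finrank_of_linearIndependent {K V κ : Type*} [Field K] [AddCommGroup V]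
    [Module K V] [FiniteDimensional K V] [Fintype κ] {v : κ → V} (hv : LinearIndependent K v)
    {T : Submodule K V} (hT : ∀ k, v k ∈ T) : Fintype.card κ ≤ Module.finrank K T := by
  have : LinearIndependent K fun k => (⟨v k, hT k⟩ : T) :=
    LinearIndependent.of_comp T.subtype hv
  exact this.fintype_card_le_finrank

theorem notMem_ideal {S : Set (σ → ℂ)} {f : MvPolynomial σ ℂ} :
    f ∉ vanishingIdeal ℂ S ↔ ∃ x ∈ S, eval x f ≠ 0 := by
  rw [mem_ideal]
  push Not
  rfl

/-- Generic tangent vectors specialize to tangent vectors. -/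
theorem exists_tangent_lift {W : Set (σ → ℂ)} [hW : (vanishingIdeal ℂ W).IsPrime] {κ : Type}
    [Finite κ] {ξ : κ → σ → FractionRing (MvPolynomial σ ℂ ⧸ vanishingIdeal ℂ W)}
    (hξ : ∀ k, ξ k ∈ genTangent (vanishingIdeal ℂ W) _) :
    ∃ b ∉ vanishingIdeal ℂ W, ∃ v : κ → σ → MvPolynomial σ ℂ,
      (∀ k i, gen (vanishingIdeal ℂ W) (FractionRing (MvPolynomial σ ℂ ⧸ vanishingIdeal ℂ W))
        (v k i) = gen (vanishingIdeal ℂ W) _ b * ξ k i) ∧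
      ∀ w ∈ W, ∀ k, (fun i => eval w (v k i)) ∈ tangentSpace W w := by
  obtain ⟨b, hb, u, hu⟩ := exists_denominator (I := vanishingIdeal ℂ W)
    fun p : κ × σ => ξ p.1 p.2
  refine ⟨b, hb, fun k i => u (k, i), fun k i => hu (k, i), fun w hw k f hf => ?_⟩
  have h1 : ∑ i, pderiv i f * u (k, i) ∈ vanishingIdeal ℂ W := by
    rw [← gen_eq_zero_iff, map_sum]
    simp only [map_mul, hu]
    have h2 := hξ k f hf
    have h3 : ∀ i, gen (vanishingIdeal ℂ W)
        (FractionRing (MvPolynomial σ ℂ ⧸ vanishingIdeal ℂ W)) (pderiv i f) *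
        (gen (vanishingIdeal ℂ W) _ b * ξ k i) = gen (vanishingIdeal ℂ W) _ b *
        (gen (vanishingIdeal ℂ W) _ (pderiv i f) * ξ k i) := fun i => by ring
    simp only [h3, ← Finset.mul_sum, h2, mul_zero]
  have h2 := mem_ideal.1 h1 w hw
  simpa only [map_sum, map_mul] using h2

theorem finrank_genTangent_eq_zdim {W : Set (σ → ℂ)} [hW : (vanishingIdeal ℂ W).IsPrime] :
    ((Module.finrank (FractionRing (MvPolynomial σ ℂ ⧸ vanishingIdeal ℂ W))
      (genTangent (vanishingIdeal ℂ W) (FractionRing (MvPolynomial σ ℂ ⧸ vanishingIdeal ℂ W))) : ℕ)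
      : WithBot ℕ∞) = zdim W :=
  finrank_genTangent hW (IsFractionRing.injective _ _)

/-- With `d` the dimension and `N` the number of coordinates, choose generically independent
families of `d` tangent vectors and `N - d` gradients. Both stay independent on an open set. Since
the tangent space and the span of the gradients always have total dimension `N`, both lower bounds
are equalities there. -/
theorem exists_smooth_eval {W : Set (σ → ℂ)} (hW : IsZIrreducible W) :
    ∃ h ∉ vanishingIdeal ℂ W, ∀ w ∈ W, eval w h ≠ 0 → w ∈ smoothPoints W := by
  have : (vanishingIdeal ℂ W).IsPrime := hW
  have hdim := finrank_genTangent_eq_zdim (W := W)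
  set I := vanishingIdeal ℂ W with hI
  set K := FractionRing (MvPolynomial σ ℂ ⧸ I) with hK
  let G : Set (σ → K) := (fun f i => gen I K (pderiv i f)) '' I
  obtain ⟨h1, -⟩ := finrank_add_finrank_annihilator G (genTangent I K)
    fun ξ => by simp only [G, Set.forall_mem_image]; rfl
  obtain ⟨g, hgG, -, hgl⟩ := Submodule.exists_fun_fin_finrank_span_eq K G
  choose f hf hfg using hgG
  obtain ⟨p, hp, hp'⟩ := exists_linearIndependent_eval (W := W)
    (fun k i => pderiv i (f k)) (by
      have : (fun k i => gen (vanishingIdeal ℂ W) (FractionRing (MvPolynomial σ ℂ ⧸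
        vanishingIdeal ℂ W)) (pderiv i (f k))) = g := funext fun k => hfg k
      rw [this]
      exact hgl)
  let B := Module.finBasis K (genTangent I K)
  obtain ⟨b, hb, v, hv, hvW⟩ := exists_tangent_lift (W := W) (ξ := fun k => (B k : σ → K))
    fun k => (B k).2
  obtain ⟨q, hq, hq'⟩ := exists_linearIndependent_eval (W := W) v (by
    have hb' : gen (vanishingIdeal ℂ W) K b ≠ 0 := fun h => hb (gen_eq_zero_iff.1 h)
    have h2 : LinearIndependent K fun k => (B k : σ → K) :=
      B.linearIndependent.map' (genTangent I K).subtype (Submodule.ker_subtype _)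
    have h3 := h2.units_smul fun _ => Units.mk0 _ hb'
    convert h3 using 1
    funext k i
    exact hv k i)
  refine ⟨p * q, fun h => (hW.mem_or_mem h).elim hp hq, fun w hw hpq => ⟨hw, ?_⟩⟩
  rw [map_mul] at hpq
  have hpw := hp' w hw (left_ne_zero_of_mul hpq)
  have hqw := hq' w hw (right_ne_zero_of_mul hpq)
  rw [← hdim]
  congr 1
  let Gw : Set (σ → ℂ) := (fun f i => eval w (pderiv i f)) '' I
  obtain ⟨h2, -⟩ := finrank_add_finrank_annihilator Gw (tangentSpace W w)
    fun ξ => by simp only [Gw, Set.forall_mem_image]; rfl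
  have h3 := card_le_finrank_of_linearIndependent hqw (T := tangentSpace W w)
    fun k => hvW w hw k
  have h4 := card_le_finrank_of_linearIndependent hpw (T := Submodule.span ℂ Gw)
    fun k => Submodule.subset_span ⟨f k, hf k, rfl⟩
  rw [Fintype.card_fin] at h3 h4
  have h5 : Module.finrank K (genTangent I K) ≤ Module.finrank ℂ (tangentSpace W w) := h3
  have h6 : Module.finrank K (Submodule.span K G) ≤ Module.finrank ℂ (Submodule.span ℂ Gw) := h4
  change Module.finrank ℂ (tangentSpace W w) = Module.finrank K (genTangent I K)
  omega

theorem eval_bind {f : τ → MvPolynomial σ ℂ} {Φ : (σ → ℂ) → (τ → ℂ)}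
    (hf : ∀ j x, eval x (f j) = Φ x j) (x : σ → ℂ) (g : MvPolynomial τ ℂ) :
    eval x (bind₁ f g) = eval (Φ x) g := by
  rw [← show (fun j => eval x (f j)) = Φ x from funext fun j => hf j x, ← aeval_complex,
    MvPolynomial.aeval_bind₁, ← aeval_complex]
  simp only [aeval_complex]

/-- Polynomial tangent vector fields which generically push forward to a frame of the tangent
bundle of the closure of the image. -/
theorem exists_pushforward_frame {W : Set (σ → ℂ)} (hW : IsZIrreducible W)
    (f : τ → MvPolynomial σ ℂ) {Φ : (σ → ℂ) → (τ → ℂ)} (hf : ∀ j x, eval x (f j) = Φ x j) :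
    ∃ (d : ℕ) (v : Fin d → σ → MvPolynomial σ ℂ), (d : WithBot ℕ∞) = zdim (Φ '' W) ∧
      (∀ w ∈ W, ∀ k, (fun i => eval w (v k i)) ∈ tangentSpace W w) ∧
      ∃ q ∉ vanishingIdeal ℂ W, ∀ w ∈ W, eval w q ≠ 0 →
        LinearIndependent ℂ fun k j => eval w (∑ i, pderiv i (f j) * v k i) := by
  classical
  have hprime : (vanishingIdeal ℂ W).IsPrime := hW
  have hprimeY : (vanishingIdeal ℂ (Φ '' W)).IsPrime := hW.image fun j => ⟨f j, hf j⟩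
  have hmem : ∀ g, bind₁ f g ∈ vanishingIdeal ℂ W ↔ g ∈ vanishingIdeal ℂ (Φ '' W) := fun g => by
    rw [mem_ideal, mem_ideal, Set.forall_mem_image]
    simp only [eval_bind hf]
  let A := MvPolynomial σ ℂ ⧸ vanishingIdeal ℂ W
  let B := MvPolynomial τ ℂ ⧸ vanishingIdeal ℂ (Φ '' W)
  let K := FractionRing A
  let φ : B →ₐ[ℂ] A := Ideal.Quotient.liftₐ _
    ((Ideal.Quotient.mkₐ ℂ (vanishingIdeal ℂ W)).comp (bind₁ f)) fun g hg =>
      Ideal.Quotient.eq_zero_iff_mem.2 ((hmem g).2 hg)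
  have hφ : ∀ g, φ (Ideal.Quotient.mk _ g) = Ideal.Quotient.mk _ (bind₁ f g) := fun g => rfl
  -- The image is dense in its closure, so its coordinate ring embeds in that of `W`, and the
  -- function field `K` of `W` serves for both.
  have hφi : Function.Injective φ := by
    rw [injective_iff_map_eq_zero]
    intro b hb
    obtain ⟨g, rfl⟩ := Ideal.Quotient.mk_surjective b
    rw [hφ, Ideal.Quotient.eq_zero_iff_mem, hmem] at hb
    exact Ideal.Quotient.eq_zero_iff_mem.2 hb
  let _ : Algebra B A := φ.toRingHom.toAlgebra
  have : IsScalarTower ℂ B A := .of_algebraMap_eq fun x => (φ.commutes x).symm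
  have : IsScalarTower B A K := inferInstance
  have : IsScalarTower ℂ B K := inferInstance
  have hBK : Function.Injective (algebraMap B K) := by
    rw [IsScalarTower.algebraMap_eq B A K]
    exact (IsFractionRing.injective A K).comp hφi
  have hdimY := finrank_genTangent (K := K) hprimeY hBK
  -- Lifting a tangent vector of the image means extending a derivation from `B` to `A`.
  have hlift : ∀ η ∈ genTangent (vanishingIdeal ℂ (Φ '' W)) K,
      ∃ ξ ∈ genTangent (vanishingIdeal ℂ W) K,
        ∀ j, ∑ i, gen (vanishingIdeal ℂ W) K (pderiv i (f j)) * ξ i = η j := by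
    intro η hη
    obtain ⟨D, hD⟩ := exists_derivation_of_mem_genTangent hη
    obtain ⟨D', hD'⟩ := exists_derivation_extension ℂ B A K hφi D
    refine ⟨_, derivation_mem_genTangent D', fun j => ?_⟩
    rw [← derivation_mk, ← hD j, ← hD']
    change _ = D' (φ (Ideal.Quotient.mk _ (X j)))
    rw [hφ, bind₁_X_right]
  let b := Module.finBasis K (genTangent (vanishingIdeal ℂ (Φ '' W)) K)
  choose ξ hξ hξ' using fun k => hlift (b k) (b k).2
  obtain ⟨d, hd, v, hv, hvW⟩ := exists_tangent_lift (W := W) hξ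
  obtain ⟨q, hq, hq'⟩ := exists_linearIndependent_eval (W := W)
    (fun k j => ∑ i, pderiv i (f j) * v k i) (by
    have hd' : gen (vanishingIdeal ℂ W) K d ≠ 0 := fun h => hd (gen_eq_zero_iff.1 h)
    have h2 : LinearIndependent K fun k => (b k : τ → K) :=
      b.linearIndependent.map' (genTangent _ K).subtype (Submodule.ker_subtype _)
    have h3 := h2.units_smul fun _ => Units.mk0 _ hd'
    convert h3 using 1
    funext k j
    change _ = gen (vanishingIdeal ℂ W) K d * (b k : τ → K) j
    rw [← hξ' k j, map_sum, Finset.mul_sum]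
    refine Finset.sum_congr rfl fun i _ => ?_
    rw [map_mul, hv]
    ring)
  exact ⟨_, v, hdimY, hvW, q, hq, hq'⟩

/-- Generic smoothness: at the points of a nonempty open subset of an irreducible set, the set
and the closure of its image are smooth and the map is a submersion. -/
theorem IsZIrreducible.exists_submersion {W : Set (σ → ℂ)} (hW : IsZIrreducible W)
    {Φ : (σ → ℂ) → (τ → ℂ)} (hΦ : IsPolyMap Φ) :
    ∃ h : (σ → ℂ) → ℂ, IsPoly h ∧ (∃ w ∈ W, h w ≠ 0) ∧ ∀ w ∈ W, h w ≠ 0 →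
      w ∈ smoothPoints W ∧ Φ w ∈ smoothPoints (zcl (Φ '' W)) ∧
      ∀ η ∈ tangentSpace (zcl (Φ '' W)) (Φ w), ∃ ξ ∈ tangentSpace W w,
        HasDerivAt (fun t : ℂ => Φ (w + t • ξ)) η 0 := by
  have hY : IsZIrreducible (Φ '' W) := hW.image hΦ
  choose f hf using hΦ
  have hbind := eval_bind hf
  obtain ⟨e, v, he, hvW, q, hq, hq'⟩ := exists_pushforward_frame hW f hf
  obtain ⟨p, hp, hp'⟩ := exists_smooth_eval hW
  obtain ⟨r, hr, hr'⟩ := exists_smooth_eval hY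
  have hr2 : bind₁ f r ∉ vanishingIdeal ℂ W := fun h => hr (by
    rw [mem_ideal] at h ⊢
    simpa only [Set.forall_mem_image, hbind] using h)
  refine ⟨_, isPoly_eval (p * (q * bind₁ f r)), ?_, ?_⟩
  · rw [← notMem_ideal]
    exact fun h => (Ideal.IsPrime.mem_or_mem hW h).elim hp fun h => (Ideal.IsPrime.mem_or_mem hW h).elim hq hr2
  intro w hw hne
  rw [map_mul, map_mul, hbind] at hne
  have hpw := hp' w hw (left_ne_zero_of_mul hne)
  have hqw := hq' w hw (left_ne_zero_of_mul (right_ne_zero_of_mul hne))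
  have hrw := hr' (Φ w) ⟨w, hw, rfl⟩ (right_ne_zero_of_mul (right_ne_zero_of_mul hne))
  have hT : tangentSpace (zcl (Φ '' W)) (Φ w) = tangentSpace (Φ '' W) (Φ w) :=
    tangentSpace_congr (ideal_zcl _) _
  have hsm : Φ w ∈ smoothPoints (zcl (Φ '' W)) :=
    ⟨subset_zcl _ hrw.1, by rw [hT, zdim_zcl]; exact hrw.2⟩
  refine ⟨hpw, hsm, ?_⟩
  rw [hT]
  have hder : ∀ k, HasDerivAt (fun t : ℂ => Φ (w + t • fun i => eval w (v k i)))
      (fun j => eval w (∑ i, pderiv i (f j) * v k i)) 0 := by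
    intro k
    rw [hasDerivAt_pi]
    intro j
    have h1 := hasDerivAt_eval (f j) (hasDerivAt_line w (fun i => eval w (v k i)) 0)
    simp only [hf, zero_smul, add_zero] at h1
    simpa only [map_sum, map_mul] using h1
  have hmemT : ∀ k, (fun j => eval w (∑ i, pderiv i (f j) * v k i)) ∈
      tangentSpace (Φ '' W) (Φ w) := fun k =>
    map_mem_tangentSpace (fun j => ⟨f j, hf j⟩)
      (fun x hx => subset_zcl _ (Set.mem_image_of_mem Φ hx)) (hvW w hw k) (hder k)
  have hli : LinearIndependent ℂ fun k =>
      (⟨_, hmemT k⟩ : tangentSpace (Φ '' W) (Φ w)) :=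
    LinearIndependent.of_comp (tangentSpace (Φ '' W) (Φ w)).subtype hqw
  -- At a smooth point of the image, the `e` independent pushed-forward vectors are as many as the
  -- dimension of the tangent space, so they span it.
  have hcard : Fintype.card (Fin e) = Module.finrank ℂ (tangentSpace (Φ '' W) (Φ w)) := by
    rw [Fintype.card_fin]
    exact_mod_cast he.trans hrw.2.symm
  have hspan := hli.span_eq_top_of_card_eq_finrank' hcard
  intro η hη
  have h1 : (⟨η, hη⟩ : tangentSpace (Φ '' W) (Φ w)) ∈ Submodule.span ℂ
      (Set.range fun k => (⟨_, hmemT k⟩ : tangentSpace (Φ '' W) (Φ w))) := by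
    rw [hspan]
    trivial
  rw [Submodule.mem_span_range_iff_exists_fun] at h1
  obtain ⟨c, hc⟩ := h1
  refine ⟨∑ k, c k • fun i => eval w (v k i),
    Submodule.sum_mem _ fun k _ => Submodule.smul_mem _ _ (hvW w hw k), ?_⟩
  have hη' := congrArg Subtype.val hc
  rw [← show _ = η from hη', hasDerivAt_pi]
  intro j
  have h1 := hasDerivAt_eval (f j) (hasDerivAt_line w (∑ k, c k • fun i => eval w (v k i)) 0)
  simp only [hf, zero_smul, add_zero] at h1
  refine h1.congr_deriv ?_
  simp only [Finset.sum_apply, Pi.smul_apply, smul_eq_mul, Finset.mul_sum,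
    AddSubmonoidClass.coe_finsetSum, SetLike.val_smul, map_sum, map_mul]
  rw [Finset.sum_comm]
  exact Finset.sum_congr rfl fun k _ => Finset.sum_congr rfl fun i _ => by ring

/-- A variant of generic smoothness for a map with values in a set in which the image is dense. -/
theorem IsZIrreducible.exists_submersion_onto {W : Set (σ → ℂ)} (hW : IsZIrreducible W)
    {Φ : (σ → ℂ) → (τ → ℂ)} (hΦ : IsPolyMap Φ) {Y : Set (τ → ℂ)} (hY : zcl (Φ '' W) = Y) :
    ∃ h : (σ → ℂ) → ℂ, IsPoly h ∧ (∃ w ∈ W, h w ≠ 0) ∧ ∀ w ∈ W, h w ≠ 0 →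
      w ∈ smoothPoints W ∧ Φ w ∈ smoothPoints Y ∧
      ∀ η ∈ tangentSpace Y (Φ w), ∃ ξ ∈ tangentSpace W w,
        HasDerivAt (fun t : ℂ => Φ (w + t • ξ)) η 0 := by
  rw [← hY]
  exact hW.exists_submersion hΦ

end GenericSmoothness

section Dimension

variable {σ τ : Type} [Fintype σ] [Fintype τ]

/-! ### Dimension -/

theorem zdim_univ : zdim (Set.univ : Set (σ → ℂ)) = (Fintype.card σ : WithBot ℕ∞) := by
  rw [zdim, ideal_univ, ringKrullDim_eq_of_ringEquiv (RingEquiv.quotientBot _),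
    MvPolynomial.ringKrullDim_of_isNoetherianRing, ringKrullDim_eq_zero_of_field]
  simp

theorem zdim_mono {S T : Set (σ → ℂ)} (h : S ⊆ zcl T) : zdim S ≤ zdim T := by
  have h1 : vanishingIdeal ℂ T ≤ vanishingIdeal ℂ S := fun f hf => mem_ideal.2 fun x hx =>
    mem_zcl.1 (h hx) f (mem_ideal.1 hf)
  exact ringKrullDim_le_of_surjective (Ideal.Quotient.factor h1) (Ideal.Quotient.factor_surjective h1)

theorem IsZIrreducible.exists_smooth {S : Set (σ → ℂ)} (hS : IsZIrreducible S) :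
    ∃ p, p ∈ smoothPoints S := by
  obtain ⟨h, hh, hs⟩ := exists_smooth_eval hS
  obtain ⟨p, hp, hp'⟩ := notMem_ideal.1 hh
  exact ⟨p, hs p hp hp'⟩

theorem IsZIrreducible.exists_zdim_eq {S : Set (σ → ℂ)} (hS : IsZIrreducible S) :
    ∃ d : ℕ, zdim S = d := by
  obtain ⟨p, hp⟩ := hS.exists_smooth
  exact ⟨_, hp.2.symm⟩

/-- A polynomial vanishing on `S` but not on `T` is a nonzerodivisor in the coordinate domain of
`T`, and killing it lowers the dimension. -/
theorem zdim_add_one_le {S T : Set (σ → ℂ)} (hT : IsZIrreducible T) (h : S ⊆ zcl T)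
    (hne : zcl S ≠ zcl T) : zdim S + 1 ≤ zdim T := by
  have h1 : vanishingIdeal ℂ T ≤ vanishingIdeal ℂ S := fun f hf => mem_ideal.2 fun x hx =>
    mem_zcl.1 (h hx) f (mem_ideal.1 hf)
  have h2 : ¬ vanishingIdeal ℂ S ≤ vanishingIdeal ℂ T := fun h3 =>
    hne (zcl_eq_iff.2 (le_antisymm h3 h1))
  obtain ⟨f, hf, hf'⟩ := SetLike.not_le_iff_exists.1 h2
  have : (vanishingIdeal ℂ T).IsPrime := hT
  refine ringKrullDim_succ_le_of_surjective (Ideal.Quotient.factor h1)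
    (Ideal.Quotient.factor_surjective h1) (r := Ideal.Quotient.mk _ f) ?_ ?_
  · rw [mem_nonZeroDivisors_iff_ne_zero, Ne, Ideal.Quotient.eq_zero_iff_mem]
    exact hf'
  · rw [Ideal.Quotient.factor_mk, Ideal.Quotient.eq_zero_iff_mem]
    exact hf

theorem zcl_eq_of_zdim_le {S T : Set (σ → ℂ)} (hS : IsZIrreducible S) (hT : IsZIrreducible T)
    (h : S ⊆ zcl T) (hd : zdim T ≤ zdim S) : zcl S = zcl T := by
  by_contra hne
  have h1 := (zdim_add_one_le hT h hne).trans hd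
  obtain ⟨d, hd⟩ := hS.exists_zdim_eq
  rw [hd] at h1
  have : d + 1 ≤ d := by exact_mod_cast h1
  omega

theorem zdim_add_one_le_card {S : Set (σ → ℂ)} (h : zcl S ≠ Set.univ) :
    zdim S + 1 ≤ (Fintype.card σ : WithBot ℕ∞) := by
  rw [← zdim_univ]
  have h1 : zcl (Set.univ : Set (σ → ℂ)) = Set.univ := Set.eq_univ_of_univ_subset (subset_zcl _)
  refine zdim_add_one_le irreducible_univ ?_ ?_
  · rw [h1]
    exact Set.subset_univ _
  · rwa [h1]

/-! ### Dimension of images and kernels of differentials. -/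

/-- The differential at `w` along directions of `W` has a linear description. -/
theorem exists_linear_deriv {Φ : (σ → ℂ) → (τ → ℂ)} (hΦ : IsPolyMap Φ) (w : σ → ℂ) :
    ∃ L : (σ → ℂ) →ₗ[ℂ] (τ → ℂ), ∀ ξ, HasDerivAt (fun t : ℂ => Φ (w + t • ξ)) (L ξ) 0 := by
  choose f hf using hΦ
  refine ⟨{ toFun := fun ξ j => ∑ i, eval w (pderiv i (f j)) * ξ i
            map_add' := fun a b => ?_
            map_smul' := fun c a => ?_ }, fun ξ => ?_⟩
  · funext j
    simp only [Pi.add_apply, mul_add, Finset.sum_add_distrib]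
  · funext j
    simp only [Pi.smul_apply, smul_eq_mul, RingHom.id_apply, Finset.mul_sum]
    exact Finset.sum_congr rfl fun i _ => by ring
  · rw [hasDerivAt_pi]
    intro j
    have h1 := hasDerivAt_eval (f j) (hasDerivAt_line w ξ 0)
    simp only [hf, zero_smul, add_zero] at h1
    exact h1

/-- The dimension of the image does not exceed the dimension, and the generic fibre has tangent
vectors if it is smaller. -/
theorem zdim_image_le {S : Set (σ → ℂ)} (hS : IsZIrreducible S) {Φ : (σ → ℂ) → (τ → ℂ)}
    (hΦ : IsPolyMap Φ) : zdim (Φ '' S) ≤ zdim S := by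
  obtain ⟨h, -, ⟨w, hw, hne⟩, hh⟩ := hS.exists_submersion hΦ
  obtain ⟨h1, h2, h3⟩ := hh w hw hne
  obtain ⟨L, hL⟩ := exists_linear_deriv hΦ w
  rw [← zdim_zcl, ← h1.2, ← h2.2]
  have h4 : tangentSpace (zcl (Φ '' S)) (Φ w) ≤ (tangentSpace S w).map L := fun η hη => by
    obtain ⟨ξ, hξ, hd⟩ := h3 η hη
    exact ⟨ξ, hξ, (hL ξ).unique hd⟩
  exact_mod_cast (Submodule.finrank_mono h4).trans (Submodule.finrank_map_le L _)

/-- If the image has smaller dimension, there are generically tangent vectors to the fibres. -/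
theorem exists_kernel_vector {S : Set (σ → ℂ)} {Φ : (σ → ℂ) → (τ → ℂ)}
    (hΦ : IsPolyMap Φ) {Y : Set (τ → ℂ)} (hY : ∀ x ∈ S, Φ x ∈ zcl Y) {w : σ → ℂ}
    (hw : w ∈ smoothPoints S) (hΦw : Φ w ∈ smoothPoints Y) (hd : zdim Y < zdim S) :
    ∃ ξ ∈ tangentSpace S w, ξ ≠ 0 ∧ HasDerivAt (fun t : ℂ => Φ (w + t • ξ)) 0 0 := by
  obtain ⟨L, hL⟩ := exists_linear_deriv hΦ w
  rw [← hw.2, ← hΦw.2] at hd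
  have hd' : Module.finrank ℂ (tangentSpace Y (Φ w)) < Module.finrank ℂ (tangentSpace S w) := by
    exact_mod_cast hd
  let L' : tangentSpace S w →ₗ[ℂ] tangentSpace Y (Φ w) :=
    (L.domRestrict _).codRestrict _ fun ξ => map_mem_tangentSpace hΦ hY ξ.2 (hL ξ)
  have hk : LinearMap.ker L' ≠ ⊥ := LinearMap.ker_ne_bot_of_finrank_lt hd'
  obtain ⟨ξ, hξ, hne⟩ := Submodule.exists_mem_ne_zero_of_ne_bot hk
  refine ⟨ξ, ξ.2, fun h => hne (Subtype.ext h), ?_⟩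
  have : L ξ = 0 := congrArg Subtype.val (LinearMap.mem_ker.1 hξ)
  rw [← this]
  exact hL ξ

/-- If the map is a submersion with injective differential, the dimensions agree. -/
theorem zdim_eq_of_injective {S : Set (σ → ℂ)} {Φ : (σ → ℂ) → (τ → ℂ)} (hS : IsZIrreducible S)
    (hΦ : IsPolyMap Φ) {Y : Set (τ → ℂ)} (hY : zcl (Φ '' S) = Y) {w : σ → ℂ}
    (hw : w ∈ smoothPoints S) (hΦw : Φ w ∈ smoothPoints Y)
    (h : ∀ ξ ∈ tangentSpace S w, HasDerivAt (fun t : ℂ => Φ (w + t • ξ)) 0 0 → ξ = 0) :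
    zdim S = zdim Y := by
  refine le_antisymm (not_lt.1 fun hlt => ?_) ?_
  · obtain ⟨ξ, hξ, hne, hd⟩ := exists_kernel_vector hΦ
      (fun x hx => by rw [← hY, zcl_zcl]; exact subset_zcl _ (Set.mem_image_of_mem Φ hx))
      hw hΦw hlt
    exact hne (h ξ hξ hd)
  · rw [← hY, zdim_zcl]
    exact zdim_image_le hS hΦ

/-- The coordinate ring of the product with a line is a quotient of the polynomial ring in one
variable over the Noetherian coordinate ring of `S`. -/
theorem zdim_prod_line_le (S : Set (σ → ℂ)) :
    zdim {p : σ ⊕ Unit → ℂ | (fun i => p (Sum.inl i)) ∈ S} ≤ zdim S + 1 := by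
  set T := {p : σ ⊕ Unit → ℂ | (fun i => p (Sum.inl i)) ∈ S}
  let φ : MvPolynomial σ ℂ ⧸ vanishingIdeal ℂ S →+* MvPolynomial (σ ⊕ Unit) ℂ ⧸ vanishingIdeal ℂ T :=
    Ideal.quotientMap _ (rename Sum.inl : MvPolynomial σ ℂ →ₐ[ℂ] _).toRingHom (by
      intro f hf
      rw [Ideal.mem_comap, mem_ideal]
      intro p hp
      change eval p (rename Sum.inl f) = 0
      rw [eval_rename]
      exact mem_ideal.1 hf _ hp)
  let ψ : Polynomial (MvPolynomial σ ℂ ⧸ vanishingIdeal ℂ S) →+*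
      MvPolynomial (σ ⊕ Unit) ℂ ⧸ vanishingIdeal ℂ T :=
    Polynomial.eval₂RingHom φ (Ideal.Quotient.mk _ (X (Sum.inr ())))
  have hψ : Function.Surjective ψ := by
    intro a
    obtain ⟨f, rfl⟩ := Ideal.Quotient.mk_surjective a
    induction f using MvPolynomial.induction_on with
    | C c =>
      refine ⟨Polynomial.C (Ideal.Quotient.mk _ (C c)), ?_⟩
      simp only [ψ, Polynomial.coe_eval₂RingHom, Polynomial.eval₂_C, φ, Ideal.quotientMap_mk]
      change Ideal.Quotient.mk _ (rename Sum.inl (C c)) = _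
      rw [rename_C]
    | add p q hp hq =>
      obtain ⟨a, ha⟩ := hp
      obtain ⟨b, hb⟩ := hq
      exact ⟨a + b, by rw [map_add, ha, hb, map_add]⟩
    | mul_X p i hp =>
      obtain ⟨a, ha⟩ := hp
      rcases i with i | i
      · refine ⟨a * Polynomial.C (Ideal.Quotient.mk _ (X i)), ?_⟩
        rw [map_mul, ha, map_mul]
        congr 1
        simp only [ψ, Polynomial.coe_eval₂RingHom, Polynomial.eval₂_C, φ, Ideal.quotientMap_mk]
        change Ideal.Quotient.mk _ (rename Sum.inl (X i)) = _
        rw [rename_X]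
      · refine ⟨a * Polynomial.X, ?_⟩
        rw [map_mul, ha, map_mul]
        congr 1
        simp only [ψ, Polynomial.coe_eval₂RingHom, Polynomial.eval₂_X]
  calc _ ≤ ringKrullDim (Polynomial (MvPolynomial σ ℂ ⧸ vanishingIdeal ℂ S)) :=
        ringKrullDim_le_of_surjective ψ hψ
    _ = _ := Polynomial.ringKrullDim_of_isNoetherianRing

/-! ### Components -/

/-- Irreducible subsets are contained in irreducible components. -/
theorem IsZIrreducible.exists_component {T W : Set (σ → ℂ)} (hW : IsZIrreducible W) (h : W ⊆ T) :
    ∃ Z, IsZComponent T Z ∧ W ⊆ Z := by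
  have key : ∀ c ⊆ {T' : Set (σ → ℂ) | IsZIrreducible T' ∧ T' ⊆ T}, IsChain (· ⊆ ·) c →
      c.Nonempty → ∃ ub ∈ {T' : Set (σ → ℂ) | IsZIrreducible T' ∧ T' ⊆ T}, ∀ s ∈ c, s ⊆ ub := by
    intro c hc hchain hne
    refine ⟨⋃₀ c, ⟨?_, Set.sUnion_subset fun s hs => (hc hs).2⟩,
      fun s hs => Set.subset_sUnion_of_mem hs⟩
    obtain ⟨s, hs⟩ := hne
    refine irreducible_of ((hc hs).1.nonempty.mono (Set.subset_sUnion_of_mem hs)) ?_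
    rintro φ ψ hφ hψ ⟨x, ⟨a, ha, hxa⟩, hx⟩ ⟨y, ⟨b, hb, hyb⟩, hy⟩
    -- The two nonvanishing witnesses lie in a common member of the chain, which is irreducible.
    obtain ⟨d, hd, had, hbd⟩ : ∃ d ∈ c, a ⊆ d ∧ b ⊆ d := by
      rcases hchain.total ha hb with h | h
      · exact ⟨b, hb, h, subset_rfl⟩
      · exact ⟨a, ha, subset_rfl, h⟩
    obtain ⟨z, hz, h1, h2⟩ := (hc hd).1.exists_ne hφ hψ ⟨x, had hxa, hx⟩ ⟨y, hbd hyb, hy⟩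
    exact ⟨z, ⟨d, hd, hz⟩, h1, h2⟩
  obtain ⟨Z, hWZ, hZ⟩ := zorn_subset_nonempty _ key W ⟨hW, h⟩
  exact ⟨Z, hZ, hWZ⟩

/-- A component of the closure of an image is the closure of the image of an irreducible set. -/
theorem IsZComponent.exists_irreducible {T : Set (σ → ℂ)} {Φ : (σ → ℂ) → (τ → ℂ)}
    (hΦ : IsPolyMap Φ) {X : Set (τ → ℂ)} (hX : IsZComponent (zcl (Φ '' T)) X) :
    ∃ W ⊆ T, IsZIrreducible W ∧ zcl (Φ '' W) = X := by
  -- Noetherian minimality: `W` has a maximal vanishing ideal among the subsets of `T` whose image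
  -- closure contains `X`. If `W` were reducible, the irreducible `X` would already lie in the image
  -- closure of a smaller piece.
  obtain ⟨I, ⟨W, hWT, hXW, rfl⟩, hmax⟩ := set_has_maximal_iff_noetherian.2
    (inferInstance : IsNoetherian (MvPolynomial σ ℂ) (MvPolynomial σ ℂ))
    {I | ∃ W ⊆ T, X ⊆ zcl (Φ '' W) ∧ vanishingIdeal ℂ W = I} ⟨_, T, subset_rfl, hX.1.2, rfl⟩
  have hne : W.Nonempty := by
    rw [Set.nonempty_iff_ne_empty]
    rintro rfl
    obtain ⟨x, hx⟩ := hX.1.1.nonempty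
    have := mem_zcl.1 (hXW hx) 1 (by simp)
    simp at this
  have hW : IsZIrreducible W := by
    refine irreducible_iff.2 ⟨hne, fun f g hf hg => ?_⟩
    by_contra! hc
    have hcov : X ⊆ zcl (Φ '' {w | w ∈ W ∧ eval w f = 0}) ∪ zcl (Φ '' {w | w ∈ W ∧ eval w g = 0}) := by
      intro x hx
      by_contra hn
      rw [Set.mem_union, not_or, mem_zcl, mem_zcl] at hn
      push Not at hn
      obtain ⟨⟨p, hp, hpx⟩, q, hq, hqx⟩ := hn
      have := mem_zcl.1 (hXW hx) (p * q) (by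
        rintro _ ⟨w, hw, rfl⟩
        rw [map_mul]
        by_cases h0 : eval w f = 0
        · rw [hp _ ⟨w, ⟨hw, h0⟩, rfl⟩, zero_mul]
        · rw [hq _ ⟨w, ⟨hw, hc w hw h0⟩, rfl⟩, mul_zero])
      rw [map_mul] at this
      exact mul_ne_zero hpx hqx this
    have hsmall : ∀ k : MvPolynomial σ ℂ, (∃ w ∈ W, eval w k ≠ 0) →
        ¬ X ⊆ zcl (Φ '' {w | w ∈ W ∧ eval w k = 0}) := by
      intro k ⟨w, hw, hk⟩ hX'
      refine hmax _ ⟨{w | w ∈ W ∧ eval w k = 0}, fun w hw => hWT hw.1, hX', rfl⟩ ?_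
      refine lt_of_le_of_ne (vanishingIdeal_anti_mono fun w hw => hw.1) fun heq => ?_
      have : k ∈ vanishingIdeal ℂ W := by
        rw [heq]
        exact mem_ideal.2 fun w hw => hw.2
      exact hk (mem_ideal.1 this w hw)
    rcases hX.1.1.subset_or (isZClosed_zcl _) (isZClosed_zcl _) hcov with h | h
    · exact hsmall f hf h
    · exact hsmall g hg h
  refine ⟨W, hWT, hW, Set.Subset.antisymm ?_ hXW⟩
  exact hX.2 ⟨irreducible_zcl.2 (hW.image hΦ), zcl_mono (Set.image_mono hWT)⟩ hXW

end Dimension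

/-! ### Hypersurfaces -/

section Hypersurface

variable {σ : Type} [Fintype σ] {F : MvPolynomial σ ℂ} {X : Set (σ → ℂ)}

/-- The Nullstellensatz for the prime ideal `(F)`. -/
theorem ideal_hypersurface (hF : Irreducible F) (hX : X = {x | eval x F = 0}) :
    vanishingIdeal ℂ X = Ideal.span {F} := by
  have h1 : X = zeroLocus ℂ (Ideal.span {F}) := by
    rw [zeroLocus_span, hX]
    ext x
    simp [aeval_complex]
  have : (Ideal.span {F}).IsPrime := (Ideal.span_singleton_prime hF.ne_zero).2 hF.prime
  rw [h1, IsPrime.vanishingIdeal_zeroLocus]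

theorem irreducible_hypersurface (hF : Irreducible F) (hX : X = {x | eval x F = 0}) :
    IsZIrreducible X := by
  rw [IsZIrreducible, ideal_hypersurface hF hX]
  exact (Ideal.span_singleton_prime hF.ne_zero).2 hF.prime

theorem closed_hypersurface (hX : X = {x | eval x F = 0}) : IsZClosed X := by
  refine Set.Subset.antisymm (fun x hx => ?_) (subset_zcl X)
  rw [hX]
  exact mem_zcl.1 hx F fun y hy => by rw [hX] at hy; exact hy

theorem hypersurface_ne_univ (hF : Irreducible F) (hX : X = {x | eval x F = 0}) :
    zcl X ≠ Set.univ := by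
  rw [Ne, zcl_eq_univ_iff, ideal_hypersurface hF hX, Ideal.span_singleton_eq_bot]
  exact hF.ne_zero

theorem mem_tangentSpace_hypersurface (hF : Irreducible F) (hX : X = {x | eval x F = 0})
    {x ξ : σ → ℂ} (hx : x ∈ X) :
    ξ ∈ tangentSpace X x ↔ ∑ i, eval x (pderiv i F) * ξ i = 0 := by
  rw [mem_tangentSpace_iff, ideal_hypersurface hF hX]
  refine ⟨fun h => h F (Ideal.mem_span_singleton_self F), fun h f hf => ?_⟩
  obtain ⟨g, rfl⟩ := Ideal.mem_span_singleton.1 hf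
  have hx0 : eval x F = 0 := by rw [hX] at hx; exact hx
  simp only [Derivation.leibniz, smul_eq_mul, map_add, map_mul, hx0, zero_mul, zero_add, mul_assoc,
    ← Finset.mul_sum, h, mul_zero]

theorem finrank_tangentSpace_hypersurface (hF : Irreducible F) (hX : X = {x | eval x F = 0})
    {x : σ → ℂ} (hx : x ∈ X) :
    Module.finrank ℂ (tangentSpace X x) +
      Module.finrank ℂ (Submodule.span ℂ {fun i => eval x (pderiv i F)}) = Fintype.card σ :=
  (finrank_add_finrank_annihilator {fun i => eval x (pderiv i F)} (tangentSpace X x)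
    fun ξ => by
      rw [mem_tangentSpace_hypersurface hF hX hx]
      simp).1

theorem zdim_hypersurface (hF : Irreducible F) (hX : X = {x | eval x F = 0}) :
    zdim X + 1 = (Fintype.card σ : WithBot ℕ∞) := by
  refine le_antisymm (zdim_add_one_le_card (hypersurface_ne_univ hF hX)) ?_
  obtain ⟨x, hx⟩ := (irreducible_hypersurface hF hX).exists_smooth
  have h1 := finrank_tangentSpace_hypersurface hF hX hx.1
  have h2 : Module.finrank ℂ (Submodule.span ℂ {fun i => eval x (pderiv i F)}) ≤ 1 := by
    simpa using finrank_span_le_card (R := ℂ) {fun i => eval x (pderiv i F)}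
  rw [← hx.2]
  have : Fintype.card σ ≤ Module.finrank ℂ (tangentSpace X x) + 1 := by omega
  exact_mod_cast this

theorem gradient_ne_zero (hF : Irreducible F) (hX : X = {x | eval x F = 0}) {x : σ → ℂ}
    (hx : x ∈ smoothPoints X) : (fun i => eval x (pderiv i F)) ≠ 0 := by
  intro h0
  have h1 := finrank_tangentSpace_hypersurface hF hX hx.1
  rw [h0, Submodule.span_zero_singleton, finrank_bot] at h1
  have h2 := zdim_hypersurface hF hX
  rw [← hx.2] at h2
  have h3 : Module.finrank ℂ (tangentSpace X x) + 1 = Fintype.card σ := by exact_mod_cast h2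
  omega

/-- A hypersurface is maximal among the irreducible sets which are not dense. -/
theorem eq_of_hypersurface_subset (hF : Irreducible F) (hX : X = {x | eval x F = 0})
    {T : Set (σ → ℂ)} (hT : IsZIrreducible T) (hne : zcl T ≠ Set.univ) (h : X ⊆ T) : T = X := by
  have h1 : zdim T + 1 ≤ zdim X + 1 := by
    rw [zdim_hypersurface hF hX]
    exact zdim_add_one_le_card hne
  have hXi := irreducible_hypersurface hF hX
  obtain ⟨d, hd⟩ := hXi.exists_zdim_eq
  obtain ⟨e, he⟩ := hT.exists_zdim_eq
  have h2 : zdim T ≤ zdim X := by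
    rw [hd, he] at h1 ⊢
    have : e + 1 ≤ d + 1 := by exact_mod_cast h1
    have : e ≤ d := by omega
    exact_mod_cast this
  have h3 := zcl_eq_of_zdim_le hXi hT (h.trans (subset_zcl T)) h2
  refine Set.Subset.antisymm ?_ h
  rw [← show zcl X = X from closed_hypersurface hX, h3]
  exact subset_zcl T

end Hypersurface

/-! ### Coordinates and bilinear forms -/

section Forms

variable {m : ℕ} (B : LinearMap.BilinForm ℂ (Fin m → ℂ)) {σ : Type} [Fintype σ]

theorem bilin_eq_sum (u v : Fin m → ℂ) :
    B u v = ∑ i, ∑ j, u i * v j * B (Pi.single i 1) (Pi.single j 1) := by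
  have h : ∀ w : Fin m → ℂ, w = ∑ i, w i • Pi.single i (1 : ℂ) := fun w => by
    funext k
    simp [Finset.sum_apply, Pi.single_apply]
  conv_lhs => rw [h u, h v]
  simp only [map_sum, map_smul, LinearMap.sum_apply, LinearMap.smul_apply, smul_eq_mul,
    Finset.mul_sum]
  rw [Finset.sum_comm]
  exact Finset.sum_congr rfl fun i _ => Finset.sum_congr rfl fun j _ => by ring

variable {B}

theorem IsPolyMap.bilin {u v : (σ → ℂ) → (Fin m → ℂ)} (hu : IsPolyMap u) (hv : IsPolyMap v) :
    IsPoly fun x => B (u x) (v x) := by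
  simp only [bilin_eq_sum B (u _)]
  exact IsPoly.sum fun i _ => IsPoly.sum fun j _ => ((hu i).mul (hv j)).mul (isPoly_const _)

theorem hasDerivAt_bilin {u v : ℂ → (Fin m → ℂ)} {u' v' : Fin m → ℂ} {t : ℂ}
    (hu : HasDerivAt u u' t) (hv : HasDerivAt v v' t) :
    HasDerivAt (fun s => B (u s) (v s)) (B u' (v t) + B (u t) v') t := by
  have h1 : (fun s => B (u s) (v s)) =
      fun s => ∑ i, ∑ j, u s i * v s j * B (Pi.single i 1) (Pi.single j 1) :=
    funext fun s => bilin_eq_sum B _ _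
  rw [h1, bilin_eq_sum B u', bilin_eq_sum B (u t), ← Finset.sum_add_distrib]
  refine HasDerivAt.fun_sum fun i _ => ?_
  rw [← Finset.sum_add_distrib]
  refine HasDerivAt.fun_sum fun j _ => ?_
  refine ((((hasDerivAt_pi.1 hu i).mul (hasDerivAt_pi.1 hv j))).mul_const _).congr_deriv ?_
  ring

theorem IsPolyMap.add {τ : Type} {u v : (σ → ℂ) → (τ → ℂ)} (hu : IsPolyMap u) (hv : IsPolyMap v) :
    IsPolyMap fun x => u x + v x := fun j => (hu j).add (hv j)

theorem IsPolyMap.sub {τ : Type} {u v : (σ → ℂ) → (τ → ℂ)} (hu : IsPolyMap u) (hv : IsPolyMap v) :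
    IsPolyMap fun x => u x - v x := fun j => (hu j).sub (hv j)

theorem IsPolyMap.smul {τ : Type} {a : (σ → ℂ) → ℂ} {v : (σ → ℂ) → (τ → ℂ)} (ha : IsPoly a)
    (hv : IsPolyMap v) : IsPolyMap fun x => a x • v x := fun j => ha.mul (hv j)

theorem IsPolyMap.sumElim {τ υ : Type} {u : (σ → ℂ) → (τ → ℂ)} {v : (σ → ℂ) → (υ → ℂ)}
    (hu : IsPolyMap u) (hv : IsPolyMap v) :
    IsPolyMap fun x => (Sum.elim (u x) (v x) : τ ⊕ υ → ℂ) := by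
  rintro (j | j)
  · exact hu j
  · exact hv j

theorem IsPolyMap.pair {u : (σ → ℂ) → (Fin m → ℂ)} {a : (σ → ℂ) → ℂ} (hu : IsPolyMap u)
    (ha : IsPoly a) : IsPolyMap fun x => pair (u x) (a x) := hu.sumElim fun _ => ha

theorem isPolyMap_vec : IsPolyMap (vec : (Fin m ⊕ Unit → ℂ) → _) := fun _ => isPoly_coord _

theorem isPoly_last : IsPoly (last : (Fin m ⊕ Unit → ℂ) → ℂ) := isPoly_coord _

theorem isPolyMap_basePoint : IsPolyMap (basePoint : (Fin m ⊕ (Fin m ⊕ Unit) → ℂ) → _) :=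
  fun _ => isPoly_coord _

theorem isPolyMap_endPoint : IsPolyMap (endPoint : (Fin m ⊕ (Fin m ⊕ Unit) → ℂ) → _) :=
  fun _ => isPoly_coord _

theorem pair_vec_last (q : Fin m ⊕ Unit → ℂ) : pair (vec q) (last q) = q := by
  funext k
  cases k <;> rfl

theorem elim_base_end (p : Fin m ⊕ (Fin m ⊕ Unit) → ℂ) :
    Sum.elim (basePoint p) (endPoint p) = p := by
  funext k
  cases k <;> rfl

theorem hasDerivAt_sumElim {τ υ : Type} [Fintype τ] [Fintype υ] {u : ℂ → (τ → ℂ)}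
    {v : ℂ → (υ → ℂ)} {u' : τ → ℂ} {v' : υ → ℂ} {t : ℂ} (hu : HasDerivAt u u' t)
    (hv : HasDerivAt v v' t) :
    HasDerivAt (fun s => (Sum.elim (u s) (v s) : τ ⊕ υ → ℂ)) (Sum.elim u' v') t := by
  rw [hasDerivAt_pi]
  rintro (j | j)
  · exact hasDerivAt_pi.1 hu j
  · exact hasDerivAt_pi.1 hv j

theorem hasDerivAt_pair {u : ℂ → (Fin m → ℂ)} {a : ℂ → ℂ} {u' : Fin m → ℂ} {a' t : ℂ}
    (hu : HasDerivAt u u' t) (ha : HasDerivAt a a' t) :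
    HasDerivAt (fun s => pair (u s) (a s)) (pair u' a') t :=
  hasDerivAt_sumElim hu (hasDerivAt_pi.2 fun _ => ha)

end Forms

/-! ### The normal variety -/

theorem IsZIrreducible.ideal_smoothPoints {σ : Type} [Fintype σ] {S : Set (σ → ℂ)}
    (hS : IsZIrreducible S) : vanishingIdeal ℂ (smoothPoints S) = vanishingIdeal ℂ S := by
  obtain ⟨h, hh, hs⟩ := exists_smooth_eval hS
  refine le_antisymm ?_ (vanishingIdeal_anti_mono fun x hx => hx.1)
  rw [← hS.ideal_open (isPoly_eval h) (notMem_ideal.1 hh)]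
  exact vanishingIdeal_anti_mono fun x hx => hs x hx.1 hx.2

theorem irreducible_ne_zero {σ : Type} [Fintype σ] (i : σ) :
    IsZIrreducible {y : σ → ℂ | y ≠ 0} := by
  refine irreducible_of ⟨fun _ => 1, fun h => one_ne_zero (congrFun h i)⟩ ?_
  rintro φ ψ hφ hψ ⟨x, -, hx⟩ ⟨y, -, hy⟩
  obtain ⟨u, -, h1, h2⟩ := irreducible_univ.exists_ne hφ (isPoly_coord i) ⟨x, trivial, hx⟩
    ⟨fun _ => 1, trivial, one_ne_zero⟩
  obtain ⟨z, -, h3, h4⟩ := irreducible_univ.exists_ne (hφ.mul (isPoly_coord i)) hψ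
    ⟨u, trivial, mul_ne_zero h1 h2⟩ ⟨y, trivial, hy⟩
  exact ⟨z, fun h => right_ne_zero_of_mul h3 (congrFun h i), left_ne_zero_of_mul h3, h4⟩

section Normal

variable {m : ℕ} {B : LinearMap.BilinForm ℂ (Fin m → ℂ)} {F : MvPolynomial (Fin m) ℂ}
  {X : Set (Fin m → ℂ)}

/-- The polynomial field of normal vectors. -/
theorem exists_normal_field (hBn : B.Nondegenerate) (F : MvPolynomial (Fin m) ℂ) :
    ∃ ν : (Fin m → ℂ) → (Fin m → ℂ), IsPolyMap ν ∧
      ∀ x ξ, B (ν x) ξ = ∑ i, eval x (pderiv i F) * ξ i := by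
  -- The vectors `e i` represent the coordinate functions through `B`, so `ν` is the gradient of `F`
  -- with respect to `B`.
  choose e he using fun i : Fin m => (B.toDual hBn).surjective (LinearMap.proj i)
  refine ⟨fun x => ∑ i, eval x (pderiv i F) • e i, fun j => ?_, fun x ξ => ?_⟩
  · simp only [Finset.sum_apply, Pi.smul_apply, smul_eq_mul]
    exact IsPoly.sum fun i _ => (isPoly_eval _).mul (isPoly_const _)
  · simp only [map_sum, map_smul, LinearMap.sum_apply, LinearMap.smul_apply, smul_eq_mul]
    refine Finset.sum_congr rfl fun i _ => ?_
    have := LinearMap.congr_fun (he i) ξ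
    rw [LinearMap.BilinForm.toDual_def] at this
    rw [this, LinearMap.proj_apply]

/-- A linear form killing the tangent space is a multiple of `dF`, and nondegeneracy transports this
to vectors. This also holds at singular points, where the orthogonal space is zero. -/
theorem orthogonal_tangentSpace_iff (hBn : B.Nondegenerate) (hF : Irreducible F)
    (hX : X = {x | eval x F = 0}) {ν : (Fin m → ℂ) → (Fin m → ℂ)}
    (hν : ∀ x ξ, B (ν x) ξ = ∑ i, eval x (pderiv i F) * ξ i) {x : Fin m → ℂ} (hx : x ∈ X)
    {u : Fin m → ℂ} : (∀ ξ ∈ tangentSpace X x, B u ξ = 0) ↔ ∃ t : ℂ, u = t • ν x := by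
  constructor
  · intro h
    have h1 := (finrank_add_finrank_annihilator {fun i => eval x (pderiv i F)} (tangentSpace X x)
      fun ξ => by
        rw [mem_tangentSpace_hypersurface hF hX hx]
        simp).2 (fun i => B u (Pi.single i 1)) fun ξ hξ => by
          rw [← h ξ hξ]
          conv_rhs => rw [pi_eq_sum_univ' ξ]
          simp only [map_sum, map_smul, smul_eq_mul]
          refine Finset.sum_congr rfl fun i _ => ?_
          rw [mul_comm]
    obtain ⟨t, ht⟩ := Submodule.mem_span_singleton.1 h1
    refine ⟨t, ?_⟩
    have h2 : B (u - t • ν x) = 0 := by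
      refine LinearMap.pi_ext' fun i => LinearMap.ext_ring ?_
      have h3 := congrFun ht i
      simp only [Pi.smul_apply, smul_eq_mul] at h3
      simp only [map_sub, map_smul, LinearMap.comp_apply, LinearMap.single_apply,
        LinearMap.sub_apply, LinearMap.smul_apply, hν, smul_eq_mul, ← h3, LinearMap.zero_apply]
      simp [Pi.single_apply]
    exact sub_eq_zero.1 (hBn.1 _ fun y => LinearMap.congr_fun h2 y)
  · rintro ⟨t, rfl⟩ ξ hξ
    rw [map_smul, LinearMap.smul_apply, hν, (mem_tangentSpace_hypersurface hF hX hx).1 hξ, smul_zero]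

/-- The parametrization `(x, a, t) ↦ (x, [a x + t ν(x) : a])` with `(a, t) ≠ 0`; smoothness of `x`
gives `ν(x) ≠ 0`, so the endpoint is nonzero. It reduces irreducibility and the dimension bound to a
product. -/
theorem normalVariety_eq_image (hBn : B.Nondegenerate) (hF : Irreducible F)
    (hX : X = {x | eval x F = 0}) {ν : (Fin m → ℂ) → (Fin m → ℂ)}
    (hν : ∀ x ξ, B (ν x) ξ = ∑ i, eval x (pderiv i F) * ξ i) :
    normalVariety B X = (fun p : Fin m ⊕ (Unit ⊕ Unit) → ℂ => Sum.elim (fun i => p (Sum.inl i))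
      (pair (p (Sum.inr (Sum.inl ())) • (fun i => p (Sum.inl i)) + p (Sum.inr (Sum.inr ())) •
        ν (fun i => p (Sum.inl i))) (p (Sum.inr (Sum.inl ()))))) ''
      {p | (fun i => p (Sum.inl i)) ∈ smoothPoints X ∧ (fun j => p (Sum.inr j)) ∈
        {y : Unit ⊕ Unit → ℂ | y ≠ 0}} := by
  ext p
  constructor
  · rintro ⟨h1, h2, h3⟩
    obtain ⟨t, ht⟩ := (orthogonal_tangentSpace_iff hBn hF hX hν h1.1).1 h3
    rw [sub_eq_iff_eq_add'] at ht
    refine ⟨Sum.elim (basePoint p) (Sum.elim (fun _ => last (endPoint p)) fun _ => t),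
      ⟨h1, fun h => h2 ?_⟩, ?_⟩
    · have ha : last (endPoint p) = 0 := congrFun h (Sum.inl ())
      have ht0 : t = 0 := congrFun h (Sum.inr ())
      rw [← pair_vec_last (endPoint p), ht, ha, ht0]
      funext k
      rcases k with k | k <;> simp [pair]
    · change Sum.elim (basePoint p) (pair (last (endPoint p) • basePoint p + t • ν (basePoint p))
        (last (endPoint p))) = p
      rw [← ht, pair_vec_last, elim_base_end]
  · rintro ⟨q, ⟨h1, h2⟩, rfl⟩
    refine ⟨h1, fun h => h2 ?_, ?_⟩
    · have ha : q (Sum.inr (Sum.inl ())) = 0 := congrFun h (Sum.inr ())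
      have hv : ∀ i, (q (Sum.inr (Sum.inl ())) • (fun i => q (Sum.inl i)) +
          q (Sum.inr (Sum.inr ())) • ν (fun i => q (Sum.inl i))) i = 0 := fun i =>
        congrFun h (Sum.inl i)
      have hν0 : ν (fun i => q (Sum.inl i)) ≠ 0 := fun h0 => by
        refine gradient_ne_zero hF hX h1 (funext fun i => ?_)
        have := hν (fun i => q (Sum.inl i)) (Pi.single i 1)
        rw [h0, map_zero, LinearMap.zero_apply] at this
        simpa [Pi.single_apply] using this.symm
      have ht : q (Sum.inr (Sum.inr ())) = 0 := by
        by_contra ht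
        refine hν0 (funext fun i => ?_)
        have := hv i
        rw [ha, zero_smul, zero_add, Pi.smul_apply, smul_eq_mul] at this
        exact (mul_eq_zero.1 this).resolve_left ht
      funext j
      rcases j with j | j
      · exact ha
      · exact ht
    · refine (orthogonal_tangentSpace_iff hBn hF hX hν h1.1).2 ⟨q (Sum.inr (Sum.inr ())), ?_⟩
      funext i
      simp [vec, last, endPoint, basePoint, pair]

theorem irreducible_normalVariety (hBn : B.Nondegenerate) (hF : Irreducible F)
    (hX : X = {x | eval x F = 0}) :
    IsZIrreducible (normalVariety B X) ∧
      zdim (normalVariety B X) ≤ ((m + 1 : ℕ) : WithBot ℕ∞) := by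
  obtain ⟨ν, hνp, hν⟩ := exists_normal_field hBn F
  have hXi := irreducible_hypersurface hF hX
  have h1 : IsZIrreducible (smoothPoints X) := (irreducible_congr hXi.ideal_smoothPoints).2 hXi
  have h2 := h1.prod (irreducible_ne_zero (Sum.inl () : Unit ⊕ Unit))
  have hpx : IsPolyMap fun (p : Fin m ⊕ (Unit ⊕ Unit) → ℂ) => (fun i => p (Sum.inl i)) :=
    fun _ => isPoly_coord _
  rw [normalVariety_eq_image hBn hF hX hν]
  have hΦ : IsPolyMap (fun p : Fin m ⊕ (Unit ⊕ Unit) → ℂ => (Sum.elim (fun i => p (Sum.inl i))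
      (pair (p (Sum.inr (Sum.inl ())) • (fun i => p (Sum.inl i)) + p (Sum.inr (Sum.inr ())) •
        ν (fun i => p (Sum.inl i))) (p (Sum.inr (Sum.inl ())))) : Fin m ⊕ (Fin m ⊕ Unit) → ℂ)) :=
    hpx.sumElim (((IsPolyMap.smul (isPoly_coord _) hpx).add
      (IsPolyMap.smul (isPoly_coord _) (hνp.comp hpx))).pair (isPoly_coord _))
  refine ⟨h2.image hΦ, (zdim_image_le h2 hΦ).trans ?_⟩
  obtain ⟨d, hd⟩ := h2.exists_zdim_eq
  -- The parameter set is not dense in a space of dimension `m + 2`. The resulting bound `m + 1` is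
  -- one above the dimension of `N_X`, because endpoints are coordinate vectors.
  have h3 := zdim_add_one_le_card (S := {p : Fin m ⊕ (Unit ⊕ Unit) → ℂ |
    (fun i => p (Sum.inl i)) ∈ smoothPoints X ∧ (fun j => p (Sum.inr j)) ∈
        {y : Unit ⊕ Unit → ℂ | y ≠ 0}}) fun h => by
      refine hypersurface_ne_univ hF hX (Set.eq_univ_of_forall fun x => ?_)
      refine mem_zcl.2 fun f hf => ?_
      have h4 : (Sum.elim x 0 : Fin m ⊕ (Unit ⊕ Unit) → ℂ) ∈ (Set.univ : Set _) := trivial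
      rw [← h] at h4
      exact mem_ideal_of_isPoly h4 ((isPoly_eval f).comp hpx) fun p hp => hf _ hp.1.1
  rw [hd] at h3 ⊢
  simp only [Fintype.card_sum, Fintype.card_fin, Fintype.card_unit] at h3
  have h4 : d + 1 ≤ m + (1 + 1) := by exact_mod_cast h3
  have h5 : d ≤ m + 1 := by omega
  exact_mod_cast h5

theorem endPoint_line (p ζ : Fin m ⊕ (Fin m ⊕ Unit) → ℂ) :
    HasDerivAt (fun t : ℂ => endPoint (p + t • ζ)) (endPoint ζ) 0 :=
  hasDerivAt_line (endPoint p) (endPoint ζ) 0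

theorem basePoint_line (p ζ : Fin m ⊕ (Fin m ⊕ Unit) → ℂ) :
    HasDerivAt (fun t : ℂ => basePoint (p + t • ζ)) (basePoint ζ) 0 :=
  hasDerivAt_line (basePoint p) (basePoint ζ) 0

/-- An irreducible subset of the normal variety which dominates `X`, of the dimension of `X` or
of the normal variety at least (up to scaling), and with image of smaller dimension, makes `X`
focally degenerate. -/
theorem exists_degenerateComponent (hBn : B.Nondegenerate) (hF : Irreducible F)
    (hX : X = {x | eval x F = 0}) {Z₀ : Set (Fin m ⊕ (Fin m ⊕ Unit) → ℂ)}
    (hZ₀ : IsZIrreducible Z₀) (hN : Z₀ ⊆ normalVariety B X) (hbase : zcl (basePoint '' Z₀) = X)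
    {k : ℕ} (hk : k = m ∨ k = m + 1) (hend : zdim (endPoint '' Z₀) < k) (hdim : k ≤ zdim Z₀) :
    ∃ Z, IsDegenerateComponent B X Z ∧ IsNonvertical X Z := by
  obtain ⟨hNi, hNd⟩ := irreducible_normalVariety hBn hF hX
  obtain ⟨h, hh, hne, hsm⟩ := hZ₀.exists_submersion isPolyMap_endPoint
  have hdense := hZ₀.zcl_open hh hne
  have hirr := hZ₀.open hh hne
  have hram : {p | p ∈ Z₀ ∧ h p ≠ 0} ⊆ ramificationLocus B X := by
    rintro p ⟨hp, hp'⟩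
    refine ⟨hN hp, ?_⟩
    obtain ⟨h1, h2, -⟩ := hsm p hp hp'
    -- The image has dimension below `k ≤ dim Z₀`, so the endpoint map has a kernel vector at every
    -- generic point of `Z₀`.
    obtain ⟨ζ, hζ, hζ0, hd⟩ := exists_kernel_vector isPolyMap_endPoint
      (Y := zcl (endPoint '' Z₀))
      (fun x hx => subset_zcl _ (subset_zcl _ (Set.mem_image_of_mem _ hx))) h1 h2
      (by rw [zdim_zcl]; exact hend.trans_le hdim)
    have h3 : endPoint ζ = 0 := (endPoint_line p ζ).unique hd
    have h4 : Sum.elim (basePoint ζ) 0 = ζ := by rw [← h3, elim_base_end]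
    refine ⟨basePoint ζ, fun h0 => hζ0 ?_, ?_⟩
    · rw [← h4, h0]
      funext k
      rcases k with k | k <;> rfl
    · rw [h4]
      exact tangentSpace_mono (hN.trans (subset_zcl _)) p hζ
  obtain ⟨Z, hZ, hZ₀Z⟩ := hirr.exists_component hram
  have hXc : zcl X = X := closed_hypersurface hX
  refine ⟨Z, ⟨hZ, ?_⟩, ?_⟩
  · by_cases hiso : IsIsotropicallyDegenerate B X
    · exact Or.inl hiso
    right
    rw [IsIsotropicallyDegenerate, not_not] at hiso
    obtain ⟨g, hg, hgne, hgs⟩ := hNi.exists_submersion_onto isPolyMap_endPoint hiso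
    obtain ⟨dN, hdN⟩ := hNi.exists_zdim_eq
    have hdN' : dN ≤ m + 1 := by
      rw [hdN] at hNd
      exact_mod_cast hNd
    obtain ⟨d₀, hd₀⟩ := hZ₀.exists_zdim_eq
    obtain ⟨d, hd⟩ := hZ.1.1.exists_zdim_eq
    have hkd : k ≤ d₀ := by
      rw [hd₀] at hdim
      exact_mod_cast hdim
    rcases hk with rfl | rfl
    -- When `π` is dominant, its differential at a generic point maps a space of dimension at most
    -- `m + 1` onto one of dimension `m + 1`, so it is injective. The ramification locus is thus a
    -- proper subset.
    · have hunram : ∀ p ∈ ramificationLocus B X, g p = 0 := by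
        rintro p ⟨hp, ξ, hξ0, hξ⟩
        by_contra hgp
        obtain ⟨h1, -, h3⟩ := hgs p hp hgp
        let L : tangentSpace (normalVariety B X) p →ₗ[ℂ] (Fin k ⊕ Unit → ℂ) :=
          { toFun := fun ζ => endPoint ζ.1
            map_add' := fun _ _ => rfl
            map_smul' := fun _ _ => rfl }
        have hL : Function.Surjective L := by
          intro η
          obtain ⟨ζ, hζ, hd⟩ := h3 η (by
            intro f hf
            rw [ideal_univ, Ideal.mem_bot] at hf
            simp [hf])
          exact ⟨⟨ζ, hζ⟩, (endPoint_line p ζ).unique hd⟩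
        have h4 := LinearMap.finrank_range_add_finrank_ker L
        rw [LinearMap.range_eq_top.2 hL, finrank_top, Module.finrank_fintype_fun_eq_card] at h4
        have h5 : Module.finrank ℂ (tangentSpace (normalVariety B X) p) = dN := by
          have := h1.2
          rw [hdN] at this
          exact_mod_cast this
        have h6 : Nontrivial (LinearMap.ker L) :=
          ⟨⟨⟨_, hξ⟩, rfl⟩, 0, fun h => hξ0
            (congrArg basePoint (congrArg Subtype.val (congrArg Subtype.val h)))⟩
        have h7 := Module.finrank_pos (R := ℂ) (M := LinearMap.ker L)
        simp only [Fintype.card_sum, Fintype.card_fin, Fintype.card_unit] at h4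
        omega
      have h1 : zdim Z + 1 ≤ zdim (normalVariety B X) := by
        refine zdim_add_one_le hNi ((hZ.1.2.trans fun p hp => hp.1).trans (subset_zcl _)) ?_
        intro h
        obtain ⟨p, hp, hgp⟩ := hgne
        refine hgp (mem_ideal_of_isPoly (S := Z) ?_ hg fun q hq => hunram q (hZ.1.2 hq))
        rw [h]
        exact subset_zcl _ hp
      rw [hd, hdN] at h1
      have h2 : d + 1 ≤ dN := by exact_mod_cast h1
      -- Properness gives `dim Z ≤ m ≤ dim Z₀`, so the open part of `Z₀` is dense in `Z` and the two
      -- images have the same closure.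
      have h3 := zcl_eq_of_zdim_le hirr hZ.1.1 (hZ₀Z.trans (subset_zcl _)) (by
        rw [← zdim_zcl {p | p ∈ Z₀ ∧ h p ≠ 0}, hdense, zdim_zcl, hd, hd₀]
        have : d ≤ d₀ := by omega
        exact_mod_cast this)
      rw [focalCone, zdim_zcl, ← zdim_zcl, ← zcl_image_congr h3 isPolyMap_endPoint,
        zcl_image_congr hdense isPolyMap_endPoint, zdim_zcl]
      exact hend
    -- For `k = m + 1` the set `Z₀` is dense in the normal variety, while its image has dimension
    -- below `m + 1`: the map `π` cannot be dominant.
    · exfalso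
      have h3 := zcl_eq_of_zdim_le hZ₀ hNi (hN.trans (subset_zcl _)) (by
        rw [hdN, hd₀]
        have : dN ≤ d₀ := by omega
        exact_mod_cast this)
      rw [← zdim_zcl, zcl_image_congr h3 isPolyMap_endPoint, hiso, zdim_univ] at hend
      simp at hend
  · refine Set.Subset.antisymm ?_ ?_
    · refine zcl_subset_of_closed hXc ?_
      rintro _ ⟨p, hp, rfl⟩
      exact (hZ.1.2 hp).1.1.1
    · rw [← hbase, ← zcl_image_congr hdense isPolyMap_basePoint]
      exact zcl_mono (Set.image_mono hZ₀Z)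

end Normal

section Bundle

variable {m : ℕ} {B : LinearMap.BilinForm ℂ (Fin m → ℂ)}

/-! ### Irreducibility of bundles of affine spaces -/

/-- The pairs `(x, q)` with `q` a smooth point of `R` in `U` and `⟨x, v⟩ = g q (v, ρ)` for all
tangent vectors `(v, ρ)` of `R` at `q`. -/
def linearBundle (B : LinearMap.BilinForm ℂ (Fin m → ℂ)) (R U : Set (Fin m ⊕ Unit → ℂ))
    (g : (Fin m ⊕ Unit → ℂ) → (Fin m ⊕ Unit → ℂ)) : Set (Fin m ⊕ (Fin m ⊕ Unit) → ℂ) :=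
  {p | endPoint p ∈ smoothPoints R ∧ endPoint p ∈ U ∧
    ∀ τ ∈ tangentSpace R (endPoint p), B (basePoint p) (vec τ) = ∑ j, g (endPoint p) j * τ j}

/-- Through each point of the bundle there is a rational section. -/
theorem exists_section (hBn : B.Nondegenerate) {R U : Set (Fin m ⊕ Unit → ℂ)}
    (hU : ∀ q ∈ U, ∃ χ : (Fin m ⊕ Unit → ℂ) → ℂ, IsPoly χ ∧ χ q ≠ 0 ∧ ∀ q', χ q' ≠ 0 → q' ∈ U)
    {g : (Fin m ⊕ Unit → ℂ) → (Fin m ⊕ Unit → ℂ)} (hg : IsPolyMap g) {c : ℂ} (hc : c ≠ 0)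
    (hgc : ∀ q, g q (Sum.inr ()) = c) {p : Fin m ⊕ (Fin m ⊕ Unit) → ℂ}
    (hp : p ∈ linearBundle B R U g) {φ : (Fin m ⊕ (Fin m ⊕ Unit) → ℂ) → ℂ} (hφ : IsPoly φ)
    (hφp : φ p ≠ 0) :
    ∃ ψ : (Fin m ⊕ Unit → ℂ) → ℂ, IsPoly ψ ∧ ψ (endPoint p) ≠ 0 ∧
      ∀ q ∈ smoothPoints R, ψ q ≠ 0 →
        ∃ x, Sum.elim x q ∈ linearBundle B R U g ∧ φ (Sum.elim x q) ≠ 0 := by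
  obtain ⟨hp1, hp2, hp3⟩ := hp
  obtain ⟨χ, hχ, hχp, hχU⟩ := hU _ hp2
  set q₀ := endPoint p with hq₀
  set x₀ := basePoint p with hx₀
  have hpq : p = Sum.elim x₀ q₀ := (elim_base_end p).symm
  -- The condition on `x₀` says that the form `τ ↦ ⟨x₀, v⟩ - g(τ)` kills the tangent space at `q₀`,
  -- so it is the differential there of some `f` in the ideal of `R`.
  obtain ⟨f, hf, hfq⟩ : ∃ f ∈ vanishingIdeal ℂ R, ∀ j, eval q₀ (pderiv j f) =
      Sum.elim (fun i => B x₀ (Pi.single i 1)) 0 j - g q₀ j := by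
    have h1 := (finrank_add_finrank_annihilator
      ((fun f j => eval q₀ (pderiv j f)) '' (vanishingIdeal ℂ R : Set (MvPolynomial _ ℂ)))
      (tangentSpace R q₀) fun ξ => by simp only [Set.forall_mem_image]; rfl).2
      (fun j => Sum.elim (fun i => B x₀ (Pi.single i 1)) 0 j - g q₀ j) fun τ hτ => by
        simp only [sub_mul, Finset.sum_sub_distrib, ← hp3 τ hτ, Fintype.sum_sum_type, Sum.elim_inl,
          Sum.elim_inr, Pi.zero_apply, zero_mul, Finset.sum_const_zero, add_zero]
        rw [sub_eq_zero]
        conv_rhs => rw [pi_eq_sum_univ' (vec τ)]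
        simp only [map_sum, map_smul, smul_eq_mul]
        exact Finset.sum_congr rfl fun i _ => mul_comm _ _
    let G : Submodule ℂ (Fin m ⊕ Unit → ℂ) :=
      { carrier := (fun f j => eval q₀ (pderiv j f)) '' (vanishingIdeal ℂ R : Set (MvPolynomial _ ℂ))
        add_mem' := by
          rintro _ _ ⟨a, ha, rfl⟩ ⟨b, hb, rfl⟩
          exact ⟨a + b, Ideal.add_mem _ ha hb, by funext j; simp⟩
        zero_mem' := ⟨0, Ideal.zero_mem _, by funext j; simp⟩
        smul_mem' := by
          rintro k _ ⟨a, ha, rfl⟩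
          exact ⟨C k * a, Ideal.mul_mem_left _ _ ha, by funext j; simp⟩ }
    have h2 : Submodule.span ℂ ((fun f j => eval q₀ (pderiv j f)) ''
        (vanishingIdeal ℂ R : Set (MvPolynomial _ ℂ))) ≤ G := Submodule.span_le.2 subset_rfl
    obtain ⟨f, hf, hfe⟩ := h2 h1
    exact ⟨f, hf, fun j => congrFun hfe j⟩
  choose e he using fun i : Fin m => (B.toDual hBn).surjective (LinearMap.proj i)
  have he' : ∀ i ξ, B (e i) ξ = ξ i := fun i ξ => by
    have := LinearMap.congr_fun (he i) ξ
    rwa [LinearMap.BilinForm.toDual_def] at this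
  -- On tangent vectors of `R` one has `df = 0`, so subtracting `(c / b) df` from `g` leaves a form
  -- without `ρ`-part, represented by `x(q) = a(q) / b(q)`. At `q₀` the value is `b = -c ≠ 0`, and
  -- the section passes through `x₀`.
  let b : (Fin m ⊕ Unit → ℂ) → ℂ := fun q => eval q (pderiv (Sum.inr ()) f)
  have hb : IsPoly b := isPoly_eval _
  have hb₀ : b q₀ = -c := by
    change eval q₀ (pderiv (Sum.inr ()) f) = -c
    rw [hfq, hgc, Sum.elim_inr]
    simp
  let a : (Fin m ⊕ Unit → ℂ) → (Fin m → ℂ) := fun q =>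
    ∑ i, (b q * g q (Sum.inl i) - c * eval q (pderiv (Sum.inl i) f)) • e i
  have ha : IsPolyMap a := fun j => by
    simp only [a, Finset.sum_apply, Pi.smul_apply, smul_eq_mul]
    exact IsPoly.sum fun i _ => ((hb.mul (hg _)).sub ((isPoly_const _).mul (isPoly_eval _))).mul
      (isPoly_const _)
  have hBa : ∀ q v, B (a q) v =
      ∑ i, (b q * g q (Sum.inl i) - c * eval q (pderiv (Sum.inl i) f)) * v i := fun q v => by
    simp only [a, map_sum, map_smul, LinearMap.sum_apply, LinearMap.smul_apply, smul_eq_mul, he']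
  obtain ⟨N, ψ, hψ, hψN⟩ := exists_numerator hφ
    (ha.sumElim (IsPolyMap.smul hb isPolyMap_id)) hb
  have hscale : ∀ q, b q ≠ 0 → (b q)⁻¹ • (Sum.elim (a q) (b q • q) : Fin m ⊕ (Fin m ⊕ Unit) → ℂ) =
      Sum.elim ((b q)⁻¹ • a q) q := fun q hq => by
    funext k
    rcases k with k | k
    · rfl
    · simp [hq]
  have hb₀' : b q₀ ≠ 0 := by rw [hb₀]; exact neg_ne_zero.2 hc
  have hx₀' : (b q₀)⁻¹ • a q₀ = x₀ := by
    rw [← sub_eq_zero]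
    refine hBn.1 _ fun v => ?_
    have h2 : a q₀ = b q₀ • x₀ := by
      rw [← sub_eq_zero]
      refine hBn.1 _ fun v => ?_
      rw [map_sub, LinearMap.sub_apply, hBa, map_smul, LinearMap.smul_apply, sub_eq_zero]
      conv_rhs => rw [pi_eq_sum_univ' v]
      simp only [map_sum, map_smul, smul_eq_mul, Finset.mul_sum]
      refine Finset.sum_congr rfl fun i _ => ?_
      rw [hfq, Sum.elim_inl, hb₀]
      ring
    rw [h2, smul_smul, inv_mul_cancel₀ hb₀', one_smul, sub_self, map_zero, LinearMap.zero_apply]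
  refine ⟨fun q => (ψ q * b q) * χ q, (hψ.mul hb).mul hχ, ?_, ?_⟩
  · refine mul_ne_zero (mul_ne_zero ?_ hb₀') hχp
    rw [hψN q₀ hb₀', hscale q₀ hb₀', hx₀', ← hpq]
    exact mul_ne_zero (pow_ne_zero _ hb₀') hφp
  · intro q hq hne
    have hbq : b q ≠ 0 := right_ne_zero_of_mul (left_ne_zero_of_mul hne)
    have hψq : ψ q ≠ 0 := left_ne_zero_of_mul (left_ne_zero_of_mul hne)
    rw [hψN q hbq, hscale q hbq] at hψq
    refine ⟨(b q)⁻¹ • a q, ⟨hq, hχU q (right_ne_zero_of_mul hne), fun τ hτ => ?_⟩,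
      right_ne_zero_of_mul hψq⟩
    change B ((b q)⁻¹ • a q) (vec τ) = ∑ j, g q j * τ j
    have h1 := hτ f hf
    rw [Fintype.sum_sum_type] at h1 ⊢
    simp only [Finset.univ_unique, Finset.sum_singleton, PUnit.default_eq_unit, hgc] at h1 ⊢
    rw [map_smul, LinearMap.smul_apply, hBa]
    simp only [sub_mul, Finset.sum_sub_distrib, mul_assoc, ← Finset.mul_sum, smul_eq_mul]
    have h2 : ∑ i, eval q (pderiv (Sum.inl i) f) * vec τ i = -(b q * τ (Sum.inr ())) :=
      eq_neg_of_add_eq_zero_left h1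
    rw [h2]
    change (b q)⁻¹ * (b q * ∑ i, g q (Sum.inl i) * τ (Sum.inl i) - _) = _
    field_simp
    ring

/-- Rational sections through one point of each of two open subsets show that both subsets meet the
fibre over a generic `q`. The fibre is an affine space, so the line joining the two points found
there meets both open subsets at once. -/
theorem irreducible_linearBundle (hBn : B.Nondegenerate) {R U : Set (Fin m ⊕ Unit → ℂ)}
    (hR : IsZIrreducible R)
    (hU : ∀ q ∈ U, ∃ χ : (Fin m ⊕ Unit → ℂ) → ℂ, IsPoly χ ∧ χ q ≠ 0 ∧ ∀ q', χ q' ≠ 0 → q' ∈ U)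
    {g : (Fin m ⊕ Unit → ℂ) → (Fin m ⊕ Unit → ℂ)} (hg : IsPolyMap g) {c : ℂ} (hc : c ≠ 0)
    (hgc : ∀ q, g q (Sum.inr ()) = c) (hne : (linearBundle B R U g).Nonempty) :
    IsZIrreducible (linearBundle B R U g) := by
  refine irreducible_of hne ?_
  rintro φ ψ hφ hψ ⟨p, hp, hφp⟩ ⟨p', hp', hψp⟩
  obtain ⟨α, hα, hαp, hα'⟩ := exists_section hBn hU hg hc hgc hp hφ hφp
  obtain ⟨β, hβ, hβp, hβ'⟩ := exists_section hBn hU hg hc hgc hp' hψ hψp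
  obtain ⟨h, hh, hs⟩ := exists_smooth_eval hR
  obtain ⟨r, hr, h1, h2⟩ := hR.exists_ne hα (isPoly_eval h) ⟨_, hp.1.1, hαp⟩ (notMem_ideal.1 hh)
  obtain ⟨q, hq, h3, h4⟩ := hR.exists_ne (hα.mul (isPoly_eval h)) hβ ⟨r, hr, mul_ne_zero h1 h2⟩
    ⟨_, hp'.1.1, hβp⟩
  have hqs := hs q hq (right_ne_zero_of_mul h3)
  obtain ⟨x, hx, hφx⟩ := hα' q hqs (left_ne_zero_of_mul h3)
  obtain ⟨y, hy, hψy⟩ := hβ' q hqs h4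
  have hline : ∀ t : ℂ, Sum.elim x q + t • (Sum.elim (y - x) 0 : Fin m ⊕ (Fin m ⊕ Unit) → ℂ) =
      Sum.elim (x + t • (y - x)) q := fun t => by
    funext k
    rcases k with k | k
    · rfl
    · simp
  obtain ⟨t, ht1, ht2⟩ := exists_ne_on_line hφ hψ (p := Sum.elim x q) (l := Sum.elim (y - x) 0)
    ⟨0, by rw [hline, zero_smul, add_zero]; exact hφx⟩
    ⟨1, by rw [hline, one_smul, add_sub_cancel]; exact hψy⟩
  refine ⟨_, ?_, ht1, ht2⟩
  rw [hline]
  refine ⟨hqs, hx.2.1, fun τ hτ => ?_⟩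
  have hx3 : B x (vec τ) = ∑ j, g q j * τ j := hx.2.2 τ hτ
  have hy3 : B y (vec τ) = ∑ j, g q j * τ j := hy.2.2 τ hτ
  change B (x + t • (y - x)) (vec τ) = ∑ j, g q j * τ j
  rw [map_add, LinearMap.add_apply, map_smul, LinearMap.smul_apply, map_sub, LinearMap.sub_apply,
    hy3, hx3, sub_self, smul_zero, add_zero]

/-- The set of points `(x, q)` of a set of pairs, in a single coordinate space. -/
def total (A : Set ((Fin m → ℂ) × (Fin m ⊕ Unit → ℂ))) : Set (Fin m ⊕ (Fin m ⊕ Unit) → ℂ) :=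
  {p | (basePoint p, endPoint p) ∈ A}

theorem image_total {α : Type*} (A : Set ((Fin m → ℂ) × (Fin m ⊕ Unit → ℂ)))
    (k : (Fin m → ℂ) × (Fin m ⊕ Unit → ℂ) → α) :
    k '' A = (fun p => k (basePoint p, endPoint p)) '' total A := by
  ext a
  constructor
  · rintro ⟨⟨x, q⟩, h, rfl⟩
    exact ⟨Sum.elim x q, h, rfl⟩
  · rintro ⟨p, h, rfl⟩
    exact ⟨_, h, rfl⟩

/-- The bundle equation is rewritten as `⟨x, v⟩ = ⟨O, v⟩ - ρ / 2`; the constant coefficient `-1/2`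
of `ρ` is the nonzero `c` of the sections. -/
theorem total_affineBundle (R : Set (Fin m ⊕ Unit → ℂ)) :
    total (affineBundle B R) = linearBundle B R Set.univ
      (fun q => pair (fun i => B (vec q) (Pi.single i 1)) (-(1 / 2))) := by
  ext p
  refine and_congr_right fun _ => ?_
  rw [← true_and (∀ τ ∈ tangentSpace R (basePoint p, endPoint p).2, _)]
  refine and_congr (by simp) (forall_congr' fun τ => imp_congr_right fun _ => ?_)
  have h : ∑ j, pair (fun i => B (vec (endPoint p)) (Pi.single i 1)) (-(1 / 2)) j * τ j =
      B (vec (endPoint p)) (vec τ) - 1 / 2 * last τ := by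
    rw [Fintype.sum_sum_type]
    conv_rhs => rw [pi_eq_sum_univ' (vec τ)]
    simp only [map_sum, map_smul, smul_eq_mul, Finset.univ_unique, Finset.sum_singleton]
    change _ + -(1 / 2) * last τ = _
    rw [sub_eq_add_neg, neg_mul]
    congr 1
    exact Finset.sum_congr rfl fun i _ => mul_comm _ _
  rw [h, map_sub, LinearMap.sub_apply]
  constructor
  · intro h1
    linear_combination h1
  · intro h1
    linear_combination h1

theorem total_asymptoticTotal (R : Set (Fin m ⊕ Unit → ℂ)) :
    total (asymptoticTotal B R) = linearBundle B R {q | vec q ≠ 0} (fun _ => pair 0 1) := by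
  ext p
  refine and_congr_right fun _ => and_congr_right fun _ => forall_congr' fun τ =>
    imp_congr_right fun _ => ?_
  have h : ∑ j, pair (0 : Fin m → ℂ) 1 j * τ j = last τ := by
    rw [Fintype.sum_sum_type]
    simp [pair, last]
  rw [h]

theorem irreducible_total_affineBundle (hBn : B.Nondegenerate) {R : Set (Fin m ⊕ Unit → ℂ)}
    (hR : IsZIrreducible R) (hne : (total (affineBundle B R)).Nonempty) :
    IsZIrreducible (total (affineBundle B R)) := by
  rw [total_affineBundle] at hne ⊢
  refine irreducible_linearBundle hBn hR (fun q _ => ⟨fun _ => 1, isPoly_const 1, one_ne_zero,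
    fun _ _ => trivial⟩) ?_ (c := -(1 / 2)) (by norm_num) (fun _ => rfl) hne
  exact IsPolyMap.pair (fun i => isPolyMap_vec.bilin (isPolyMap_const _)) (isPoly_const _)

theorem irreducible_total_asymptoticTotal (hBn : B.Nondegenerate) {R : Set (Fin m ⊕ Unit → ℂ)}
    (hR : IsZIrreducible R) (hne : (total (asymptoticTotal B R)).Nonempty) :
    IsZIrreducible (total (asymptoticTotal B R)) := by
  rw [total_asymptoticTotal] at hne ⊢
  refine irreducible_linearBundle hBn hR (fun q hq => ?_) (isPolyMap_const _) (c := 1) one_ne_zero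
    (fun _ => rfl) hne
  obtain ⟨i, hi⟩ := Function.ne_iff.1 hq
  exact ⟨fun q => vec q i, isPolyMap_vec i, hi, fun q' hq' h0 => hq' (congrFun h0 i)⟩

/-! ### Tangent vectors of the total spaces -/

/-- In the inverse construction, the radii are orthogonal to the constructed set. -/
theorem radius_orthogonal (hB : B.IsSymm) {R : Set (Fin m ⊕ Unit → ℂ)}
    {W : Set (Fin m ⊕ (Fin m ⊕ Unit) → ℂ)} (hW : W ⊆ total (inverseTotal B R))
    {w ζ : Fin m ⊕ (Fin m ⊕ Unit) → ℂ} (hw : w ∈ W) (hζ : ζ ∈ tangentSpace W w) :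
    B (basePoint w - vec (endPoint w)) (basePoint ζ) = 0 := by
  have hτ : endPoint ζ ∈ tangentSpace R (endPoint w) := map_mem_tangentSpace isPolyMap_endPoint
    (fun x hx => subset_zcl _ (hW hx).1.1) hζ (endPoint_line w ζ)
  have h1 := (hW hw).2.2 _ hτ
  have hy : ∀ p : Fin m ⊕ (Fin m ⊕ Unit) → ℂ, HasDerivAt
      (fun t : ℂ => basePoint (p + t • ζ) - vec (endPoint (p + t • ζ)))
      (basePoint ζ - vec (endPoint ζ)) 0 := fun p =>
    hasDerivAt_line (basePoint p) (basePoint ζ) 0 |>.sub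
      (hasDerivAt_line (vec (endPoint p)) (vec (endPoint ζ)) 0)
  have hl : HasDerivAt (fun t : ℂ => last (endPoint (w + t • ζ))) (last (endPoint ζ)) 0 :=
    hasDerivAt_pi.1 (hasDerivAt_line (endPoint w) (endPoint ζ) 0) (Sum.inr ())
  have h2 := deriv_eq_of_mem_tangentSpace hζ
    (((isPolyMap_basePoint.sub (isPolyMap_vec.comp isPolyMap_endPoint)).bilin (B := B)
      (isPolyMap_basePoint.sub (isPolyMap_vec.comp isPolyMap_endPoint))).sub
        (isPoly_last.comp isPolyMap_endPoint))
    (fun x hx => sub_eq_zero.2 (hW hx).1.2) ((hasDerivAt_bilin (hy w) (hy w)).sub hl)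
  simp only [zero_smul, add_zero] at h2
  rw [hB.eq (basePoint ζ - vec (endPoint ζ))] at h2
  rw [map_sub] at h2
  dsimp only at h1
  -- The sphere gives `⟨x - O, dx - dO⟩ = dr / 2` and the bundle gives `⟨x - O, dO⟩ = -dr / 2`.
  linear_combination (1 / 2) * h2 + h1

/-- In the asymptotic inverse construction, the points at infinity are orthogonal to the
constructed set. -/
theorem direction_orthogonal {R : Set (Fin m ⊕ Unit → ℂ)} (hR : ∀ (c : ℂ), ∀ q ∈ R, c • q ∈ R)
    {W : Set (Fin m ⊕ (Fin m ⊕ Unit) → ℂ)} (hW : W ⊆ total (asymptoticTotal B R))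
    {w ζ : Fin m ⊕ (Fin m ⊕ Unit) → ℂ} (hw : w ∈ W) (hζ : ζ ∈ tangentSpace W w) :
    B (basePoint ζ) (vec (endPoint w)) = 0 := by
  have hτ : endPoint ζ ∈ tangentSpace R (endPoint w) := map_mem_tangentSpace isPolyMap_endPoint
    (fun x hx => subset_zcl _ (hW hx).1.1) hζ (endPoint_line w ζ)
  have h1 := (hW hw).2.2 _ hτ
  -- Since `R` is a cone, the position vector is tangent. This yields `⟨x, O⟩ = r`, whose derivative
  -- is compared with the bundle equation.
  have hEuler : ∀ q ∈ R, q ∈ tangentSpace R q := fun q hq => by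
    have := mem_tangentSpace_of_curve (S := R) (u := fun s => q + s () • q) (isPolyMap_line q q)
      (isPoly_const 1) (t := 0) one_ne_zero (fun s _ => subset_zcl _ (by
        have := hR (1 + s ()) q hq
        rwa [add_smul, one_smul] at this)) (ξ := q) (τ₀ := fun _ => 1) (by
        have := hasDerivAt_line q q 0
        simpa using this)
    simpa using this
  have hl : HasDerivAt (fun t : ℂ => last (endPoint (w + t • ζ))) (last (endPoint ζ)) 0 :=
    hasDerivAt_pi.1 (hasDerivAt_line (endPoint w) (endPoint ζ) 0) (Sum.inr ())
  have h2 := deriv_eq_of_mem_tangentSpace hζ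
    ((isPolyMap_basePoint.bilin (B := B) (isPolyMap_vec.comp isPolyMap_endPoint)).sub
        (isPoly_last.comp isPolyMap_endPoint))
    (fun x hx => sub_eq_zero.2 ((hW hx).2.2 _ (hEuler _ (hW hx).1.1)))
    ((hasDerivAt_bilin (basePoint_line w ζ)
      (hasDerivAt_line (vec (endPoint w)) (vec (endPoint ζ)) 0)).sub hl)
  simp only [zero_smul, add_zero] at h2
  dsimp only at h1
  linear_combination h2 - h1

end Bundle

/-! ### The converse -/

/-- At a generic point the differential is onto the tangent space of the image closure and, by
hypothesis, not injective; rank and nullity give the drop. -/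
theorem zdim_image_add_one_le {σ τ : Type} [Fintype σ] [Fintype τ] {S : Set (σ → ℂ)}
    (hS : IsZIrreducible S) {Φ : (σ → ℂ) → (τ → ℂ)} (hΦ : IsPolyMap Φ)
    (h : ∀ w ∈ S, ∃ ξ ∈ tangentSpace S w, ξ ≠ 0 ∧ HasDerivAt (fun t : ℂ => Φ (w + t • ξ)) 0 0) :
    zdim (Φ '' S) + 1 ≤ zdim S := by
  obtain ⟨g, -, ⟨w, hw, hne⟩, hg⟩ := hS.exists_submersion hΦ
  obtain ⟨h1, h2, h3⟩ := hg w hw hne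
  obtain ⟨L, hL⟩ := exists_linear_deriv hΦ w
  obtain ⟨ξ, hξ, hξ0, hd⟩ := h w hw
  rw [← zdim_zcl, ← h1.2, ← h2.2]
  have h4 : tangentSpace (zcl (Φ '' S)) (Φ w) ≤ (tangentSpace S w).map L := fun η hη => by
    obtain ⟨ζ, hζ, hζd⟩ := h3 η hη
    exact ⟨ζ, hζ, (hL ζ).unique hζd⟩
  have h5 := Submodule.finrank_mono h4
  have h6 := LinearMap.finrank_range_add_finrank_ker (L.domRestrict (tangentSpace S w))
  have h7 : Nontrivial (LinearMap.ker (L.domRestrict (tangentSpace S w))) :=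
    ⟨⟨⟨ξ, hξ⟩, (hL ξ).unique hd⟩, 0, fun h0 => hξ0
      (congrArg Subtype.val (congrArg Subtype.val h0))⟩
  have h8 := Module.finrank_pos (R := ℂ) (M := LinearMap.ker (L.domRestrict (tangentSpace S w)))
  rw [LinearMap.range_domRestrict] at h6
  have h9 : Module.finrank ℂ (tangentSpace (zcl (Φ '' S)) (Φ w)) + 1 ≤
    Module.finrank ℂ (tangentSpace S w) := by omega
  exact_mod_cast h9

section Converse

variable {m : ℕ} {B : LinearMap.BilinForm ℂ (Fin m → ℂ)}

/-! ### Cones of normal pairs built from the inverse constructions. -/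

/-- The points `(x, c • δ w)` with `c ≠ 0` and `w ∈ W` over `x`. -/
def coneOver (δ : (Fin m ⊕ (Fin m ⊕ Unit) → ℂ) → (Fin m ⊕ Unit → ℂ))
    (W : Set (Fin m ⊕ (Fin m ⊕ Unit) → ℂ)) : Set (Fin m ⊕ (Fin m ⊕ Unit) → ℂ) :=
  {p | ∃ w ∈ W, ∃ c : ℂ, c ≠ 0 ∧ Sum.elim (basePoint w) (c • δ w) = p}

variable {δ : (Fin m ⊕ (Fin m ⊕ Unit) → ℂ) → (Fin m ⊕ Unit → ℂ)}
  {W : Set (Fin m ⊕ (Fin m ⊕ Unit) → ℂ)}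

theorem irreducible_coneOver (hδ : IsPolyMap δ) (hW : IsZIrreducible W) :
    IsZIrreducible (coneOver δ W) := by
  have h1 := hW.prod (irreducible_ne_zero ())
  have h2 : IsPolyMap fun q : (Fin m ⊕ (Fin m ⊕ Unit)) ⊕ Unit → ℂ =>
      (Sum.elim (basePoint fun i => q (Sum.inl i))
        (q (Sum.inr ()) • δ fun i => q (Sum.inl i)) : Fin m ⊕ (Fin m ⊕ Unit) → ℂ) := by
    have h3 : IsPolyMap fun q : (Fin m ⊕ (Fin m ⊕ Unit)) ⊕ Unit → ℂ => fun i => q (Sum.inl i) :=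
      fun _ => isPoly_coord _
    exact (isPolyMap_basePoint.comp h3).sumElim (IsPolyMap.smul (isPoly_coord _) (hδ.comp h3))
  convert h1.image h2 using 1
  ext p
  constructor
  · rintro ⟨w, hw, c, hc, rfl⟩
    exact ⟨Sum.elim w fun _ => c, ⟨hw, fun h => hc (congrFun h ())⟩, rfl⟩
  · rintro ⟨q, ⟨hq, hq0⟩, rfl⟩
    exact ⟨_, hq, _, fun h => hq0 (funext fun _ => h), rfl⟩

theorem basePoint_image_coneOver : basePoint '' coneOver δ W = basePoint '' W := by
  ext x
  constructor
  · rintro ⟨_, ⟨w, hw, c, hc, rfl⟩, rfl⟩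
    exact ⟨w, hw, rfl⟩
  · rintro ⟨w, hw, rfl⟩
    exact ⟨_, ⟨w, hw, 1, one_ne_zero, rfl⟩, rfl⟩

/-- Scaling the endpoint moves along `(0, δ w)`, a nonzero tangent direction over a fixed base
point. -/
theorem zdim_add_one_le_coneOver (hδ : IsPolyMap δ) (hW : IsZIrreducible W)
    (hδ0 : ∀ w ∈ W, δ w ≠ 0) : zdim (basePoint '' W) + 1 ≤ zdim (coneOver δ W) := by
  rw [← basePoint_image_coneOver (δ := δ)]
  refine zdim_image_add_one_le (irreducible_coneOver hδ hW) isPolyMap_basePoint ?_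
  rintro _ ⟨w, hw, c, hc, rfl⟩
  refine ⟨Sum.elim 0 (δ w), ?_, fun h => hδ0 w hw (congrArg endPoint h), ?_⟩
  · have := mem_tangentSpace_of_curve (S := coneOver δ W)
      (u := fun s => Sum.elim (basePoint w) (s () • δ w))
      ((isPolyMap_const _).sumElim (IsPolyMap.smul (isPoly_coord _) (isPolyMap_const _)))
      (isPoly_coord ()) (t := fun _ => c) hc (fun s hs => subset_zcl _ ⟨w, hw, _, hs, rfl⟩)
      (ξ := Sum.elim 0 (δ w)) (τ₀ := fun _ => 1) ?_
    · exact this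
    · refine hasDerivAt_sumElim (hasDerivAt_const _ _) ?_
      have := hasDerivAt_line (c • δ w) (δ w) 0
      simpa [add_smul] using this
  · exact basePoint_line _ (Sum.elim 0 (δ w))

/-- Over a generic point every tangent vector of `X` lifts to `W`, where orthogonality is assumed.
Shrinking `W` also makes the base points smooth. -/
theorem exists_coneOver_subset_normalVariety {X : Set (Fin m → ℂ)} (hW : IsZIrreducible W)
    (hX : zcl (basePoint '' W) = X) (hδ0 : ∀ w ∈ W, δ w ≠ 0)
    (horth : ∀ w ∈ W, ∀ ζ ∈ tangentSpace W w,
      B (vec (δ w) - last (δ w) • basePoint w) (basePoint ζ) = 0) :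
    ∃ h : (Fin m ⊕ (Fin m ⊕ Unit) → ℂ) → ℂ, IsPoly h ∧ (∃ w ∈ W, h w ≠ 0) ∧
      coneOver δ {w | w ∈ W ∧ h w ≠ 0} ⊆ normalVariety B X := by
  obtain ⟨h, hh, hne, hs⟩ := hW.exists_submersion_onto isPolyMap_basePoint hX
  refine ⟨h, hh, hne, ?_⟩
  rintro _ ⟨w, ⟨hw, hhw⟩, c, hc, rfl⟩
  obtain ⟨-, h2, h3⟩ := hs w hw hhw
  refine ⟨h2, smul_ne_zero hc (hδ0 w hw), fun ξ hξ => ?_⟩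
  obtain ⟨ζ, hζ, hd⟩ := h3 ξ hξ
  have h4 : basePoint ζ = ξ := (basePoint_line w ζ).unique hd
  have h5 := horth w hw ζ hζ
  have h6 : vec (c • δ w) - last (c • δ w) • basePoint w =
      c • (vec (δ w) - last (δ w) • basePoint w) := by
    rw [smul_sub, smul_smul]
    rfl
  change B (vec (c • δ w) - last (c • δ w) • basePoint w) ξ = 0
  rw [h6, map_smul, LinearMap.smul_apply, ← h4, h5, smul_zero]

theorem endPoint_image_coneOver_mono {W' : Set (Fin m ⊕ (Fin m ⊕ Unit) → ℂ)} (h : W' ⊆ W) :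
    endPoint '' coneOver δ W' ⊆ endPoint '' coneOver δ W := by
  rintro _ ⟨_, ⟨w, hw, c, hc, rfl⟩, rfl⟩
  exact ⟨_, ⟨w, h hw, c, hc, rfl⟩, rfl⟩

/-- Shared by the finite and asymptotic cases of small `Σ`: scaling makes the cone of dimension at
least `dim X + 1 = m`. -/
theorem exists_degenerateComponent_of_cone (hBn : B.Nondegenerate) {X : Set (Fin m → ℂ)}
    (hX : IsIrreducibleHypersurface X) (hδ : IsPolyMap δ) (hW : IsZIrreducible W)
    (hWX : zcl (basePoint '' W) = X) (hδ0 : ∀ w ∈ W, δ w ≠ 0)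
    (horth : ∀ w ∈ W, ∀ ζ ∈ tangentSpace W w,
      B (vec (δ w) - last (δ w) • basePoint w) (basePoint ζ) = 0)
    (hend : zdim (endPoint '' coneOver δ W) < m) :
    ∃ Z, IsDegenerateComponent B X Z ∧ IsNonvertical X Z := by
  obtain ⟨F, hF, hXF⟩ := hX
  obtain ⟨h, hh, hne, hN⟩ := exists_coneOver_subset_normalVariety hW hWX hδ0 horth
  have hW' := hW.open hh hne
  have hbase : zcl (basePoint '' {w | w ∈ W ∧ h w ≠ 0}) = X := by
    rw [zcl_image_congr (hW.zcl_open hh hne) isPolyMap_basePoint, hWX]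
  refine exists_degenerateComponent hBn hF hXF (irreducible_coneOver hδ hW') hN
    (by rw [basePoint_image_coneOver, hbase]) (Or.inl rfl)
    ((zdim_mono ((endPoint_image_coneOver_mono fun w hw => hw.1).trans
      (subset_zcl _))).trans_lt hend) ?_
  refine le_trans (le_of_eq ?_) (zdim_add_one_le_coneOver hδ hW' fun w hw => hδ0 w hw.1)
  rw [← zdim_zcl, hbase, zdim_hypersurface hF hXF, Fintype.card_fin]

/-- The point `[O : 1]` for `w = (x, (O, r))`. -/
def finiteEnd (w : Fin m ⊕ (Fin m ⊕ Unit) → ℂ) : Fin m ⊕ Unit → ℂ := pair (vec (endPoint w)) 1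

/-- The point `[O : 0]` for `w = (x, (O, r))`. -/
def infiniteEnd (w : Fin m ⊕ (Fin m ⊕ Unit) → ℂ) : Fin m ⊕ Unit → ℂ := pair (vec (endPoint w)) 0

theorem isPolyMap_finiteEnd : IsPolyMap (finiteEnd (m := m)) :=
  (isPolyMap_vec.comp isPolyMap_endPoint).pair (isPoly_const 1)

theorem isPolyMap_infiniteEnd : IsPolyMap (infiniteEnd (m := m)) :=
  (isPolyMap_vec.comp isPolyMap_endPoint).pair (isPoly_const 0)

theorem finiteEnd_ne_zero (w : Fin m ⊕ (Fin m ⊕ Unit) → ℂ) : finiteEnd w ≠ 0 := fun h =>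
  one_ne_zero (congrArg last h)

theorem finiteEnd_orthogonal (hB : B.IsSymm) {R : Set (Fin m ⊕ Unit → ℂ)}
    (hW : W ⊆ total (inverseTotal B R)) {w ζ : Fin m ⊕ (Fin m ⊕ Unit) → ℂ} (hw : w ∈ W)
    (hζ : ζ ∈ tangentSpace W w) :
    B (vec (finiteEnd w) - last (finiteEnd w) • basePoint w) (basePoint ζ) = 0 := by
  have h1 := radius_orthogonal hB hW hw hζ
  change B (vec (endPoint w) - (1 : ℂ) • basePoint w) (basePoint ζ) = 0
  rw [one_smul, ← neg_sub, map_neg, LinearMap.neg_apply, h1, neg_zero]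

/-- The endpoints `c • (O, 1)` are parametrized by `(O, c)` in the product of `S` with a line. -/
theorem zdim_coneOver_finiteEnd_le {S : Set (Fin m → ℂ)} (hS : IsZIrreducible S)
    (h : ∀ w ∈ W, vec (endPoint w) ∈ S) :
    zdim (endPoint '' coneOver finiteEnd W) ≤ zdim S + 1 := by
  have h1 : IsZIrreducible {p : Fin m ⊕ Unit → ℂ | (fun i => p (Sum.inl i)) ∈ S} := by
    have := hS.prod (irreducible_univ (σ := Unit))
    simpa using this
  have h2 : IsPolyMap fun p : Fin m ⊕ Unit → ℂ => pair (last p • vec p) (last p) :=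
    (IsPolyMap.smul isPoly_last isPolyMap_vec).pair isPoly_last
  refine le_trans ?_ ((zdim_image_le h1 h2).trans (zdim_prod_line_le S))
  refine zdim_mono (Set.Subset.trans ?_ (subset_zcl _))
  rintro _ ⟨_, ⟨w, hw, c, hc, rfl⟩, rfl⟩
  refine ⟨pair (vec (endPoint w)) c, h w hw, ?_⟩
  funext k
  rcases k with k | k
  · rfl
  · exact (mul_one c).symm

/-- The points `(O, 1)` lie on the hyperplane where the last coordinate is `1`, which the multiples
`2 • (O, 1)` leave, so the cone is strictly larger. -/
theorem add_one_le_zdim_coneOver_finiteEnd (hW : IsZIrreducible W) :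
    zdim ((fun w => vec (endPoint w)) '' W) + 1 ≤ zdim (endPoint '' coneOver finiteEnd W) := by
  have h1 : zdim ((fun w => vec (endPoint w)) '' W) ≤ zdim (finiteEnd '' W) := by
    refine le_trans (le_of_eq ?_)
      (zdim_image_le (hW.image isPolyMap_finiteEnd) isPolyMap_vec)
    rw [Set.image_image]
    rfl
  refine le_trans (add_le_add_left h1 1) (zdim_add_one_le
    ((irreducible_coneOver isPolyMap_finiteEnd hW).image isPolyMap_endPoint) ?_ ?_)
  · rintro _ ⟨w, hw, rfl⟩
    exact subset_zcl _ ⟨_, ⟨w, hw, 1, one_ne_zero, rfl⟩, one_smul _ _⟩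
  · intro h
    obtain ⟨w, hw⟩ := hW.nonempty
    have h2 : (2 : ℂ) • finiteEnd w ∈ zcl (finiteEnd '' W) := by
      rw [h]
      exact subset_zcl _ ⟨_, ⟨w, hw, 2, two_ne_zero, rfl⟩, rfl⟩
    have h3 := mem_ideal_of_isPoly h2 (isPoly_last.sub (isPoly_const 1)) (by
      rintro _ ⟨w, -, rfl⟩
      exact sub_self (1 : ℂ))
    have h4 : (2 : ℂ) * 1 - 1 = 0 := h3
    norm_num at h4

theorem image_inverseTotal (R : Set (Fin m ⊕ Unit → ℂ)) :
    inverseConstruction B R = zcl (basePoint '' total (inverseTotal B R)) := by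
  rw [inverseConstruction, image_total]

theorem image_asymptoticTotal (R : Set (Fin m ⊕ Unit → ℂ)) :
    asymptoticConstruction B R = zcl (basePoint '' total (asymptoticTotal B R)) := by
  rw [asymptoticConstruction, image_total]

theorem IsAlgebraicFunction.irreducible_base {S : Set (Fin m → ℂ)} {R : Set (Fin m ⊕ Unit → ℂ)}
    (hR : IsAlgebraicFunction S R) : IsZIrreducible S := by
  rw [← hR.dominant, irreducible_zcl]
  exact hR.irreducible.image isPolyMap_vec

theorem IsAlgebraicFunction.vec_mem {S : Set (Fin m → ℂ)} {R : Set (Fin m ⊕ Unit → ℂ)}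
    (hR : IsAlgebraicFunction S R) {q : Fin m ⊕ Unit → ℂ} (hq : q ∈ R) : vec q ∈ S := by
  rw [← hR.dominant]
  exact subset_zcl _ (Set.mem_image_of_mem _ hq)

/-! ### The inverse constructions produce degenerate hypersurfaces. -/

theorem degenerate_of_inverseConstruction (hB : B.IsSymm) (hBn : B.Nondegenerate)
    {S : Set (Fin m → ℂ)} {R : Set (Fin m ⊕ Unit → ℂ)} (hR : IsAlgebraicFunction S R)
    (hS : zdim S + 1 < m) {X : Set (Fin m → ℂ)} (hX : IsIrreducibleHypersurface X)
    (hXc : IsZComponent (inverseConstruction B R) X) :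
    ∃ Z, IsDegenerateComponent B X Z ∧ IsNonvertical X Z := by
  rw [image_inverseTotal] at hXc
  obtain ⟨W, hWT, hW, hWX⟩ := hXc.exists_irreducible isPolyMap_basePoint
  exact exists_degenerateComponent_of_cone hBn hX isPolyMap_finiteEnd hW hWX
    (fun w _ => finiteEnd_ne_zero w) (fun w hw ζ hζ => finiteEnd_orthogonal hB hWT hw hζ)
    ((zdim_coneOver_finiteEnd_le hR.irreducible_base fun w hw =>
      hR.vec_mem (hWT hw).1.1).trans_lt hS)

theorem degenerate_of_asymptoticConstruction (hB : B.IsSymm) (hBn : B.Nondegenerate)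
    {S : Set (Fin m → ℂ)} {R : Set (Fin m ⊕ Unit → ℂ)} (hR : IsAlgebraicSection S R)
    (hS : zdim S < m) {X : Set (Fin m → ℂ)} (hX : IsIrreducibleHypersurface X)
    (hXc : IsZComponent (asymptoticConstruction B R) X) :
    ∃ Z, IsDegenerateComponent B X Z ∧ IsNonvertical X Z := by
  rw [image_asymptoticTotal] at hXc
  obtain ⟨W, hWT, hW, hWX⟩ := hXc.exists_irreducible isPolyMap_basePoint
  refine exists_degenerateComponent_of_cone hBn hX isPolyMap_infiniteEnd hW hWX
    (fun w hw h => (hWT hw).2.1 (congrArg vec h)) (fun w hw ζ hζ => ?_) ?_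
  · have h1 := direction_orthogonal hR.homogeneous hWT hw hζ
    change B (vec (endPoint w) - (0 : ℂ) • basePoint w) (basePoint ζ) = 0
    rw [zero_smul, sub_zero, hB.eq, h1]
  · have h2 : IsPolyMap fun x : Fin m → ℂ => pair x 0 := isPolyMap_id.pair (isPoly_const 0)
    refine lt_of_le_of_lt (le_trans ?_ (zdim_image_le hR.graph.irreducible_base h2)) hS
    refine zdim_mono (Set.Subset.trans ?_ (subset_zcl _))
    rintro _ ⟨_, ⟨w, hw, c, hc, rfl⟩, rfl⟩
    refine ⟨c • vec (endPoint w),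
      hR.graph.vec_mem (q := c • endPoint w) (hR.homogeneous c _ (hWT hw).1.1), ?_⟩
    funext k
    rcases k with k | k
    · rfl
    · exact (mul_zero c).symm

/-- The `O`-parts of tangent vectors span fewer than `m` dimensions, so their orthogonal space is
nonzero. Such an `l` is the direction of a line in the fibre of the affine bundle over `q`. -/
theorem exists_orthogonal_tangentSpace (hB : B.IsSymm) (hBn : B.Nondegenerate)
    {R : Set (Fin m ⊕ Unit → ℂ)} {q : Fin m ⊕ Unit → ℂ} (hq : q ∈ smoothPoints R)
    (hR : zdim R < m) :
    ∃ l : Fin m → ℂ, l ≠ 0 ∧ ∀ τ ∈ tangentSpace R q, B l (vec τ) = 0 := by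
  rw [← hq.2] at hR
  have h1 : Module.finrank ℂ (tangentSpace R q) < m := by exact_mod_cast hR
  let V : (Fin m ⊕ Unit → ℂ) →ₗ[ℂ] (Fin m → ℂ) :=
    { toFun := vec
      map_add' := fun _ _ => rfl
      map_smul' := fun _ _ => rfl }
  have h2 := Submodule.finrank_map_le V (tangentSpace R q)
  have h3 := LinearMap.BilinForm.finrank_orthogonal hBn ((tangentSpace R q).map V)
  rw [Module.finrank_fintype_fun_eq_card, Fintype.card_fin] at h3
  have h4 : 0 < Module.finrank ℂ (B.orthogonal ((tangentSpace R q).map V)) := by omega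
  have h5 := Module.finrank_pos_iff.1 h4
  obtain ⟨l, hl⟩ := exists_ne (0 : B.orthogonal ((tangentSpace R q).map V))
  refine ⟨l, fun h => hl (Subtype.ext h), fun τ hτ => ?_⟩
  have h6 := l.2 (vec τ) ⟨τ, hτ, rfl⟩
  rw [← hB.eq]
  exact h6

/-- The cone has endpoint image of dimension `m`, since `Σ` is a hypersurface and the pair is
admissible, and one further dimension along the fibres. It therefore attains the dimension bound `m
+ 1` of the normal variety, which forces isotropic degeneracy. -/
theorem degenerate_of_inverseConstruction_of_subset (hB : B.IsSymm) (hBn : B.Nondegenerate)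
    {S : Set (Fin m → ℂ)} {R : Set (Fin m ⊕ Unit → ℂ)} (hR : IsAlgebraicFunction S R)
    (hadm : IsAdmissible B S R) (hS : zdim S + 1 = m)
    (hsub : affineBundle B R ⊆ sphereFamily B R) {X : Set (Fin m → ℂ)}
    (hX : IsIrreducibleHypersurface X) (hXc : IsZComponent (inverseConstruction B R) X) :
    ∃ Z, IsDegenerateComponent B X Z ∧ IsNonvertical X Z := by
  rw [image_inverseTotal] at hXc
  have htot : inverseTotal B R = affineBundle B R := Set.inter_eq_right.2 hsub
  rw [IsAdmissible, image_total] at hadm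
  have hSi := hR.irreducible_base
  set W := total (inverseTotal B R) with hWdef
  have hne : W.Nonempty := by
    rw [Set.nonempty_iff_ne_empty]
    intro h0
    obtain ⟨U, hUT, hU, -⟩ := hXc.exists_irreducible isPolyMap_basePoint
    obtain ⟨u, hu⟩ := hU.nonempty
    have := hUT hu
    rw [h0] at this
    exact this
  have hW : IsZIrreducible W := by
    rw [hWdef, htot] at hne ⊢
    exact irreducible_total_affineBundle hBn hR.irreducible hne
  -- The total space is the whole affine bundle, hence irreducible, so its only component is `X'`
  -- itself.
  have hWX : zcl (basePoint '' W) = X :=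
    Set.Subset.antisymm (hXc.2 ⟨irreducible_zcl.2 (hW.image isPolyMap_basePoint), subset_rfl⟩
      hXc.1.2) hXc.1.2
  obtain ⟨h, hh, hne', hN⟩ := exists_coneOver_subset_normalVariety hW hWX
    (fun w _ => finiteEnd_ne_zero w) fun w hw ζ hζ => finiteEnd_orthogonal hB subset_rfl hw hζ
  have hW' := hW.open hh hne'
  have hdense := hW.zcl_open hh hne'
  obtain ⟨F, hF, hXF⟩ := hX
  have hlt : ((m : ℕ) : WithBot ℕ∞) < ((m + 1 : ℕ) : WithBot ℕ∞) := by
    exact_mod_cast Nat.lt_succ_self m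
  obtain ⟨d, hd⟩ := hSi.exists_zdim_eq
  have hdm : d + 1 = m := by
    rw [hd] at hS
    exact_mod_cast hS
  have hRm : zdim R < m := by
    rw [hR.dim_eq, hd]
    exact_mod_cast (by omega : d < m)
  refine exists_degenerateComponent hBn hF hXF (irreducible_coneOver isPolyMap_finiteEnd hW') hN
    (by rw [basePoint_image_coneOver, zcl_image_congr hdense isPolyMap_basePoint, hWX])
    (Or.inr rfl) (lt_of_le_of_lt ?_ hlt) ?_
  · rw [← hS]
    exact zdim_coneOver_finiteEnd_le hSi fun w hw => hR.vec_mem hw.1.1.1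
  · have h1 := add_one_le_zdim_coneOver_finiteEnd hW'
    rw [← zdim_zcl, zcl_image_congr hdense (isPolyMap_vec.comp isPolyMap_endPoint)] at h1
    have h2 : zcl ((fun w => vec (endPoint w)) '' W) = S := hadm
    rw [h2, hS] at h1
    rw [Nat.cast_add, Nat.cast_one]
    refine (add_le_add_left h1 1).trans (zdim_image_add_one_le
      (irreducible_coneOver isPolyMap_finiteEnd hW') isPolyMap_endPoint ?_)
    rintro _ ⟨w, ⟨hw, hhw⟩, c, hc, rfl⟩
    have hwA : (basePoint w, endPoint w) ∈ affineBundle B R := hw.2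
    obtain ⟨l, hl0, hl⟩ := exists_orthogonal_tangentSpace hB hBn hwA.1 hRm
    refine ⟨Sum.elim l 0, ?_, fun h0 => hl0 (congrArg basePoint h0), ?_⟩
    · have hu : IsPolyMap fun s : Unit → ℂ => basePoint w + s () • l := isPolyMap_line _ _
      have := mem_tangentSpace_of_curve (S := coneOver finiteEnd {w | w ∈ W ∧ h w ≠ 0})
        (u := fun s => Sum.elim (basePoint w + s () • l) (c • finiteEnd w))
        (hu.sumElim (isPolyMap_const _))
        (hh.comp (hu.sumElim (isPolyMap_const (endPoint w)))) (t := 0)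
        (by
          have : (Sum.elim (basePoint w + (0 : Unit → ℂ) () • l) (endPoint w) :
              Fin m ⊕ (Fin m ⊕ Unit) → ℂ) = w := by
            simp only [Pi.zero_apply, zero_smul, add_zero, elim_base_end]
          rw [this]
          exact hhw)
        (fun s hs => subset_zcl _ ⟨Sum.elim (basePoint w + s () • l) (endPoint w), ⟨?_, hs⟩, c, hc,
          rfl⟩) (ξ := Sum.elim l 0) (τ₀ := fun _ => 1) ?_
      · simpa using this
      -- Moving `x` along `l` keeps the bundle equations; the inclusion `hsub` then supplies the
      -- sphere equation.
      · have h3 : (basePoint w + s () • l, endPoint w) ∈ affineBundle B R := by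
          refine ⟨hwA.1, fun τ hτ => ?_⟩
          have h4 := hwA.2 τ hτ
          dsimp only at h4 ⊢
          rw [add_sub_right_comm, map_add, LinearMap.add_apply, map_smul, LinearMap.smul_apply,
            hl τ hτ, smul_zero, add_zero, h4]
        exact ⟨hsub h3, h3⟩
      · refine hasDerivAt_sumElim ?_ (hasDerivAt_const _ _)
        have := hasDerivAt_line (basePoint w) l 0
        simpa using this
    · exact endPoint_line _ (Sum.elim l 0)

end Converse

/-! ### From focal components to algebraic functions -/

section Forward

variable {m : ℕ} {B : LinearMap.BilinForm ℂ (Fin m → ℂ)}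

theorem coneOver_normalVariety_subset (X : Set (Fin m → ℂ)) :
    coneOver endPoint (normalVariety B X) ⊆ normalVariety B X := by
  rintro _ ⟨p, ⟨h1, h2, h3⟩, c, hc, rfl⟩
  refine ⟨h1, smul_ne_zero hc h2, fun ξ hξ => ?_⟩
  have h4 : vec (c • endPoint p) - last (c • endPoint p) • basePoint p =
      c • (vec (endPoint p) - last (endPoint p) • basePoint p) := by
    rw [smul_sub, smul_smul]
    rfl
  change B (vec (c • endPoint p) - last (c • endPoint p) • basePoint p) ξ = 0
  rw [h4, map_smul, LinearMap.smul_apply, h3 ξ hξ, smul_zero]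

theorem coneOver_ramificationLocus_subset (X : Set (Fin m → ℂ)) :
    coneOver endPoint (ramificationLocus B X) ⊆ ramificationLocus B X := by
  rintro _ ⟨p, ⟨h1, ξ, hξ0, hξ⟩, c, hc, rfl⟩
  refine ⟨coneOver_normalVariety_subset X ⟨p, h1, c, hc, rfl⟩, ξ, hξ0, ?_⟩
  refine map_mem_tangentSpace (S := normalVariety B X)
    (Φ := fun p => Sum.elim (basePoint p) (c • endPoint p))
    (isPolyMap_basePoint.sumElim (IsPolyMap.smul (isPoly_const c) isPolyMap_endPoint))
    (fun p hp => subset_zcl _ (coneOver_normalVariety_subset X ⟨p, hp, c, hc, rfl⟩)) hξ ?_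
  have := hasDerivAt_sumElim (basePoint_line p (Sum.elim ξ 0))
    ((endPoint_line p (Sum.elim ξ 0)).const_smul c)
  have h0 : c • endPoint (Sum.elim ξ 0 : Fin m ⊕ (Fin m ⊕ Unit) → ℂ) = 0 := smul_zero c
  rw [h0] at this
  exact this

/-- Components of the ramification locus are invariant under scaling. -/
theorem IsZComponent.coneOver_subset {X : Set (Fin m → ℂ)}
    {Z : Set (Fin m ⊕ (Fin m ⊕ Unit) → ℂ)} (hZ : IsZComponent (ramificationLocus B X) Z) :
    coneOver endPoint Z ⊆ Z := by
  refine hZ.2 ⟨irreducible_coneOver isPolyMap_endPoint hZ.1.1, ?_⟩ fun p hp =>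
    ⟨p, hp, 1, one_ne_zero, by rw [one_smul, elim_base_end]⟩
  rintro _ ⟨p, hp, c, hc, rfl⟩
  exact coneOver_ramificationLocus_subset X ⟨p, hZ.1.2 hp, c, hc, rfl⟩

/-- A function on `W` whose differential factors through that of `O` defines an algebraic function
of `O`. -/
theorem isAlgebraicFunction_of_factor {W : Set (Fin m ⊕ (Fin m ⊕ Unit) → ℂ)}
    (hW : IsZIrreducible W) {ρ : (Fin m ⊕ (Fin m ⊕ Unit) → ℂ) → ℂ} (hρ : IsPoly ρ)
    {l : (Fin m ⊕ (Fin m ⊕ Unit) → ℂ) → ((Fin m → ℂ) →ₗ[ℂ] ℂ)}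
    (hl : ∀ w ∈ W, ∀ ζ ∈ tangentSpace W w,
      HasDerivAt (fun t : ℂ => ρ (w + t • ζ)) (l w (vec (endPoint ζ))) 0) :
    IsAlgebraicFunction (zcl ((fun w => vec (endPoint w)) '' W))
        (zcl ((fun w => pair (vec (endPoint w)) (ρ w)) '' W)) ∧
      ∃ h : (Fin m ⊕ (Fin m ⊕ Unit) → ℂ) → ℂ, IsPoly h ∧ (∃ w ∈ W, h w ≠ 0) ∧
        ∀ w ∈ W, h w ≠ 0 →
          pair (vec (endPoint w)) (ρ w) ∈
            smoothPoints (zcl ((fun w => pair (vec (endPoint w)) (ρ w)) '' W)) ∧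
          ∀ τ ∈ tangentSpace (zcl ((fun w => pair (vec (endPoint w)) (ρ w)) '' W))
            (pair (vec (endPoint w)) (ρ w)), last τ = l w (vec τ) := by
  set Φ := fun w : Fin m ⊕ (Fin m ⊕ Unit) → ℂ => pair (vec (endPoint w)) (ρ w) with hΦdef
  have hΦ : IsPolyMap Φ := (isPolyMap_vec.comp isPolyMap_endPoint).pair hρ
  obtain ⟨h, hh, hne, hs⟩ := hW.exists_submersion hΦ
  have hgen : ∀ w ∈ W, h w ≠ 0 → Φ w ∈ smoothPoints (zcl (Φ '' W)) ∧
      ∀ τ ∈ tangentSpace (zcl (Φ '' W)) (Φ w), last τ = l w (vec τ) := by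
    intro w hw hhw
    obtain ⟨-, h2, h3⟩ := hs w hw hhw
    refine ⟨h2, fun τ hτ => ?_⟩
    obtain ⟨ζ, hζ, hd⟩ := h3 τ hτ
    have h4 : pair (vec (endPoint ζ)) (l w (vec (endPoint ζ))) = τ :=
      (hasDerivAt_pair (hasDerivAt_line (vec (endPoint w)) (vec (endPoint ζ)) 0)
        (hl w hw ζ hζ)).unique hd
    rw [← h4]
    rfl
  have hR : IsZIrreducible (zcl (Φ '' W)) := irreducible_zcl.2 (hW.image hΦ)
  have hdom : zcl (vec '' zcl (Φ '' W)) = zcl ((fun w => vec (endPoint w)) '' W) := by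
    rw [zcl_image_zcl _ isPolyMap_vec, Set.image_image]
    rfl
  refine ⟨⟨isZClosed_zcl _, hR, hdom, ?_⟩, h, hh, hne, hgen⟩
  obtain ⟨g, hg, ⟨q, hq, hgq⟩, hgs⟩ := hR.exists_submersion_onto isPolyMap_vec hdom
  -- The image of `W` is dense in the graph, so the open condition from projecting the graph to `O`
  -- can be met at a point coming from `W`.
  have hgW : ∃ w ∈ W, g (Φ w) ≠ 0 := by
    by_contra! hc
    refine hgq (mem_ideal_of_isPoly hq hg ?_)
    rintro _ ⟨w, hw, rfl⟩
    exact hc w hw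
  obtain ⟨w, hw, h1, h2⟩ := hW.exists_ne hh (hg.comp hΦ) hne hgW
  obtain ⟨h3, h4⟩ := hgen w hw h1
  obtain ⟨-, h5, -⟩ := hgs _ h3.1 h2
  -- A tangent vector of the graph with zero `O`-part has zero `r`-part, so projecting the graph to
  -- `O` preserves dimension.
  refine zdim_eq_of_injective hR isPolyMap_vec hdom h3 h5 fun ξ hξ hd => ?_
  have h6 : vec ξ = 0 := (hasDerivAt_line (vec (Φ w)) (vec ξ) 0).unique hd
  have h7 := h4 ξ hξ
  rw [h6, map_zero] at h7
  rw [← pair_vec_last ξ, h6, h7]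
  funext k
  cases k <;> rfl

/-- If the base points were dense, `dx` would be arbitrary at a generic point, and `⟨dx, O⟩ = 0`
would give `O = 0`. -/
theorem asymptoticConstruction_ne_univ (hBn : B.Nondegenerate) {R : Set (Fin m ⊕ Unit → ℂ)}
    (hRi : IsZIrreducible R) (hR : ∀ (c : ℂ), ∀ q ∈ R, c • q ∈ R)
    (hne : (total (asymptoticTotal B R)).Nonempty) :
    asymptoticConstruction B R ≠ Set.univ := by
  rw [image_asymptoticTotal]
  intro h
  have hE := irreducible_total_asymptoticTotal hBn hRi hne
  obtain ⟨g, -, ⟨w, hw, hgw⟩, hg⟩ := hE.exists_submersion_onto isPolyMap_basePoint h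
  obtain ⟨-, -, h3⟩ := hg w hw hgw
  refine hw.2.1 (hBn.2 _ fun η => ?_)
  obtain ⟨ζ, hζ, hd⟩ := h3 η fun f hf => by
    rw [ideal_univ, Ideal.mem_bot] at hf
    simp [hf]
  rw [← (basePoint_line w ζ).unique hd]
  exact direction_orthogonal hR subset_rfl hw hζ

/-- With `dx` arbitrary, `⟨x - O, dx⟩ = 0` forces `x = O` generically, so the dense set of base
points lies in `S`. -/
theorem eq_univ_of_inverseConstruction_eq_univ (hB : B.IsSymm) (hBn : B.Nondegenerate)
    {S : Set (Fin m → ℂ)} {R : Set (Fin m ⊕ Unit → ℂ)} (hSc : IsZClosed S)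
    (hR : IsAlgebraicFunction S R) (h : inverseConstruction B R = Set.univ) : S = Set.univ := by
  rw [image_inverseTotal] at h
  have hc : IsZComponent (zcl (basePoint '' total (inverseTotal B R))) Set.univ := by
    rw [h]
    exact ⟨⟨irreducible_univ, subset_rfl⟩, fun _ _ _ => Set.subset_univ _⟩
  obtain ⟨W, hWT, hW, hWX⟩ := hc.exists_irreducible isPolyMap_basePoint
  obtain ⟨g, hg, hne, hs⟩ := hW.exists_submersion_onto isPolyMap_basePoint hWX
  rw [← Set.univ_subset_iff, ← hWX,
    ← zcl_image_congr (hW.zcl_open hg hne) isPolyMap_basePoint]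
  refine zcl_subset_of_closed hSc ?_
  rintro _ ⟨w, ⟨hw, hgw⟩, rfl⟩
  obtain ⟨-, -, h3⟩ := hs w hw hgw
  have h4 : basePoint w - vec (endPoint w) = 0 := hBn.1 _ fun η => by
    obtain ⟨ζ, hζ, hd⟩ := h3 η fun f hf => by
      rw [ideal_univ, Ideal.mem_bot] at hf
      simp [hf]
    rw [← (basePoint_line w ζ).unique hd]
    exact radius_orthogonal hB hWT hw hζ
  rw [sub_eq_zero.1 h4]
  exact hR.vec_mem (hWT hw).1.1

theorem normalVariety_orthogonal {X : Set (Fin m → ℂ)} {W : Set (Fin m ⊕ (Fin m ⊕ Unit) → ℂ)}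
    (hW : W ⊆ normalVariety B X) {w ζ : Fin m ⊕ (Fin m ⊕ Unit) → ℂ} (hw : w ∈ W)
    (hζ : ζ ∈ tangentSpace W w) :
    B (vec (endPoint w) - last (endPoint w) • basePoint w) (basePoint ζ) = 0 :=
  (hW hw).2.2 _ (map_mem_tangentSpace isPolyMap_basePoint
    (fun _ hx => subset_zcl _ (hW hx).1.1) hζ (basePoint_line w ζ))

/-- The section is `r = ⟨x, O⟩`. The constructed set is irreducible, is not the whole space, and
contains the hypersurface `X`, so it equals `X`. -/
theorem exists_asymptotic (hB : B.IsSymm) (hBn : B.Nondegenerate) {X : Set (Fin m → ℂ)}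
    (hX : IsIrreducibleHypersurface X) {Z : Set (Fin m ⊕ (Fin m ⊕ Unit) → ℂ)}
    (hZ : IsZComponent (ramificationLocus B X) Z) (hZX : IsNonvertical X Z)
    (hinf : AtInfinity (focalCone Z)) :
    ∃ R, IsAlgebraicSection (infinitePart (focalCone Z)) R ∧ X = asymptoticConstruction B R := by
  have hZi := hZ.1.1
  have hZN : Z ⊆ normalVariety B X := fun p hp => (hZ.1.2 hp).1
  have hlast : ∀ p ∈ Z, last (endPoint p) = 0 := fun p hp =>
    hinf _ (subset_zcl _ (Set.mem_image_of_mem _ hp))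
  have hvec : ∀ p ∈ Z, pair (vec (endPoint p)) 0 = endPoint p := fun p hp => by
    rw [← hlast p hp, pair_vec_last]
  have hvec0 : ∀ p ∈ Z, vec (endPoint p) ≠ 0 := fun p hp h0 => by
    refine (hZN hp).2.1 ?_
    rw [← hvec p hp, h0]
    funext k
    cases k <;> rfl
  have hS : infinitePart (focalCone Z) = zcl ((fun w => vec (endPoint w)) '' Z) := by
    ext u
    constructor
    · intro hu
      have := image_zcl_subset isPolyMap_vec (Set.mem_image_of_mem vec hu)
      rwa [Set.image_image] at this
    · intro hu
      have := image_zcl_subset (isPolyMap_id.pair (isPoly_const 0))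
        (Set.mem_image_of_mem (fun x : Fin m → ℂ => pair x 0) hu)
      rw [Set.image_image, Set.image_congr hvec] at this
      exact this
  have hρ : IsPoly fun w : Fin m ⊕ (Fin m ⊕ Unit) → ℂ => B (basePoint w) (vec (endPoint w)) :=
    isPolyMap_basePoint.bilin (isPolyMap_vec.comp isPolyMap_endPoint)
  obtain ⟨hR, h, hh, hne, hgen⟩ := isAlgebraicFunction_of_factor hZi hρ
    (l := fun w => B (basePoint w)) fun w hw ζ hζ => by
      have h1 := hasDerivAt_bilin (B := B) (basePoint_line w ζ)
        (hasDerivAt_line (vec (endPoint w)) (vec (endPoint ζ)) 0)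
      have h2 := normalVariety_orthogonal hZN hw hζ
      rw [hlast w hw, zero_smul, sub_zero, hB.eq] at h2
      simp only [zero_smul, add_zero, h2, zero_add] at h1
      exact h1
  rw [← hS] at hR
  set Φ := fun w : Fin m ⊕ (Fin m ⊕ Unit) → ℂ =>
    pair (vec (endPoint w)) (B (basePoint w) (vec (endPoint w)))
  have hhom0 : ∀ c : ℂ, c ≠ 0 → ∀ q ∈ zcl (Φ '' Z), c • q ∈ zcl (Φ '' Z) := by
    intro c hc q hq
    have := image_zcl_subset (IsPolyMap.smul (isPoly_const c) isPolyMap_id)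
      (Set.mem_image_of_mem (fun q : Fin m ⊕ Unit → ℂ => c • q) hq)
    refine zcl_mono ?_ this
    rintro _ ⟨_, ⟨w, hw, rfl⟩, rfl⟩
    refine ⟨_, hZ.coneOver_subset ⟨w, hw, c, hc, rfl⟩, ?_⟩
    funext k
    rcases k with k | k
    · rfl
    · exact map_smul (B (basePoint w)) c (vec (endPoint w))
  -- Components of the ramification locus are stable under nonzero scaling only; `c = 0` follows by
  -- closure.
  have hhom : ∀ c : ℂ, ∀ q ∈ zcl (Φ '' Z), c • q ∈ zcl (Φ '' Z) := by
    intro c q hq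
    have h1 : (fun _ => c : Unit → ℂ) ∈ zcl {s : Unit → ℂ | s ∈ Set.univ ∧ s () ≠ 0} := by
      rw [irreducible_univ.zcl_open (isPoly_coord ()) ⟨fun _ => 1, trivial, one_ne_zero⟩]
      exact subset_zcl _ trivial
    have h2 := image_zcl_subset (IsPolyMap.smul (isPoly_coord ()) (isPolyMap_const q))
      (Set.mem_image_of_mem (fun s : Unit → ℂ => s () • q) h1)
    refine zcl_subset_of_closed (isZClosed_zcl _) ?_ h2
    rintro _ ⟨s, ⟨-, hs⟩, rfl⟩
    exact hhom0 _ hs q hq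
  obtain ⟨F, hF, hXF⟩ := hX
  have hmem : ∀ w ∈ Z, h w ≠ 0 →
      (Sum.elim (basePoint w) (Φ w) : Fin m ⊕ (Fin m ⊕ Unit) → ℂ) ∈
        total (asymptoticTotal B (zcl (Φ '' Z))) := fun w hw hhw =>
    ⟨(hgen w hw hhw).1, hvec0 w hw, fun τ hτ => ((hgen w hw hhw).2 τ hτ).symm⟩
  have hne' : (total (asymptoticTotal B (zcl (Φ '' Z)))).Nonempty := by
    obtain ⟨w, hw, hhw⟩ := hne
    exact ⟨_, hmem w hw hhw⟩
  refine ⟨zcl (Φ '' Z), ⟨hR, hhom, ?_⟩, ?_⟩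
  · obtain ⟨w, hw⟩ := hZi.nonempty
    refine ⟨vec (endPoint w), ?_, hvec0 w hw⟩
    rw [hS]
    exact subset_zcl _ (Set.mem_image_of_mem (fun w => vec (endPoint w)) hw)
  · have hnu := asymptoticConstruction_ne_univ hBn hR.irreducible hhom hne'
    rw [image_asymptoticTotal] at hnu ⊢
    refine (eq_of_hypersurface_subset hF hXF (irreducible_zcl.2
      ((irreducible_total_asymptoticTotal hBn hR.irreducible hne').image isPolyMap_basePoint))
      (by rwa [zcl_zcl]) ?_).symm
    have h1 : zcl (basePoint '' Z) = X := hZX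
    rw [← h1, ← zcl_image_congr (hZi.zcl_open hh hne) isPolyMap_basePoint]
    refine zcl_mono ?_
    rintro _ ⟨w, ⟨hw, hhw⟩, rfl⟩
    exact ⟨_, hmem w hw hhw, rfl⟩

/-! ### Finite focal components: dehomogenization and the algebraic function. -/

/-- Representatives of the finite points, with last coordinate `1`. -/
def finiteRepresentatives (Z : Set (Fin m ⊕ (Fin m ⊕ Unit) → ℂ)) :
    Set (Fin m ⊕ (Fin m ⊕ Unit) → ℂ) :=
  {p | p ∈ Z ∧ last (endPoint p) = 1}

theorem normalize_mem {Z : Set (Fin m ⊕ (Fin m ⊕ Unit) → ℂ)} (hZ : coneOver endPoint Z ⊆ Z)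
    {p : Fin m ⊕ (Fin m ⊕ Unit) → ℂ} (hp : p ∈ Z) (h : last (endPoint p) ≠ 0) :
    Sum.elim (basePoint p) ((last (endPoint p))⁻¹ • endPoint p) ∈ finiteRepresentatives Z :=
  ⟨hZ ⟨p, hp, _, inv_ne_zero h, rfl⟩, inv_mul_cancel₀ h⟩

/-- The set is the image of an open part of `Z` under `(x, v) ↦ (x, v / a)`, where `a` is the last
coordinate of `v`. This map is only rational, so polynomial functions are pulled back to their
numerators. -/
theorem irreducible_finiteRepresentatives {Z : Set (Fin m ⊕ (Fin m ⊕ Unit) → ℂ)}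
    (hZ : coneOver endPoint Z ⊆ Z) (hZi : IsZIrreducible Z)
    (hne : ∃ p ∈ Z, last (endPoint p) ≠ 0) : IsZIrreducible (finiteRepresentatives Z) := by
  have hb : IsPoly fun p : Fin m ⊕ (Fin m ⊕ Unit) → ℂ => last (endPoint p) :=
    isPoly_last.comp isPolyMap_endPoint
  -- The base point is premultiplied by the last coordinate so that one common denominator serves
  -- all coordinates.
  have ha : IsPolyMap fun p : Fin m ⊕ (Fin m ⊕ Unit) → ℂ =>
      (Sum.elim (last (endPoint p) • basePoint p) (endPoint p) : Fin m ⊕ (Fin m ⊕ Unit) → ℂ) :=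
    (IsPolyMap.smul hb isPolyMap_basePoint).sumElim isPolyMap_endPoint
  have hab : ∀ p : Fin m ⊕ (Fin m ⊕ Unit) → ℂ, last (endPoint p) ≠ 0 →
      (last (endPoint p))⁻¹ • (Sum.elim (last (endPoint p) • basePoint p) (endPoint p) :
        Fin m ⊕ (Fin m ⊕ Unit) → ℂ) =
      Sum.elim (basePoint p) ((last (endPoint p))⁻¹ • endPoint p) := fun p hp => by
    funext k
    rcases k with k | k
    · simp [hp]
    · rfl
  refine irreducible_of ?_ ?_
  · obtain ⟨p, hp, hp0⟩ := hne
    exact ⟨_, normalize_mem hZ hp hp0⟩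
  · rintro φ ψ hφ hψ ⟨p, ⟨hp, hp1⟩, hφp⟩ ⟨q, ⟨hq, hq1⟩, hψq⟩
    obtain ⟨M, α, hα, hα'⟩ := exists_numerator hφ ha hb
    obtain ⟨N, β, hβ, hβ'⟩ := exists_numerator hψ ha hb
    have h1 : ∀ p : Fin m ⊕ (Fin m ⊕ Unit) → ℂ, last (endPoint p) = 1 →
        (Sum.elim (basePoint p) ((last (endPoint p))⁻¹ • endPoint p) :
          Fin m ⊕ (Fin m ⊕ Unit) → ℂ) = p := fun p hp => by
      rw [hp, inv_one, one_smul, elim_base_end]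
    have hp0 : last (endPoint p) ≠ 0 := by rw [hp1]; exact one_ne_zero
    have hq0 : last (endPoint q) ≠ 0 := by rw [hq1]; exact one_ne_zero
    obtain ⟨r, hr, h2, h3⟩ := hZi.exists_ne hα (hβ.mul hb)
      ⟨p, hp, by
        rw [hα' p hp0, hab p hp0, h1 p hp1]
        exact mul_ne_zero (pow_ne_zero _ hp0) hφp⟩
      ⟨q, hq, by
        refine mul_ne_zero ?_ hq0
        rw [hβ' q hq0, hab q hq0, h1 q hq1]
        exact mul_ne_zero (pow_ne_zero _ hq0) hψq⟩
    have hr0 := right_ne_zero_of_mul h3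
    have h4 := left_ne_zero_of_mul h3
    rw [hα' r hr0, hab r hr0] at h2
    rw [hβ' r hr0, hab r hr0] at h4
    exact ⟨_, normalize_mem hZ hr hr0, right_ne_zero_of_mul h2, right_ne_zero_of_mul h4⟩

/-- Dehomogenizing commutes with closure: a polynomial vanishing on the finite points has a
numerator which, times the last coordinate, vanishes on the whole cone, including its points at
infinity. -/
theorem affinePart_focalCone {Z : Set (Fin m ⊕ (Fin m ⊕ Unit) → ℂ)}
    (hZ : coneOver endPoint Z ⊆ Z) :
    affinePart (focalCone Z) = zcl ((fun w => vec (endPoint w)) '' finiteRepresentatives Z) := by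
  ext u
  constructor
  · intro hu
    refine mem_zcl.2 fun f hf => ?_
    obtain ⟨N, ψ, hψ, hψ'⟩ := exists_numerator (isPoly_eval f) (isPolyMap_vec (m := m)) isPoly_last
    have h1 := mem_ideal_of_isPoly (S := endPoint '' Z) hu (hψ.mul isPoly_last) (by
      rintro _ ⟨p, hp, rfl⟩
      by_cases h0 : last (endPoint p) = 0
      · rw [h0, mul_zero]
      · rw [hψ' _ h0]
        have := hf _ ⟨_, normalize_mem hZ hp h0, rfl⟩
        have h2 : eval ((last (endPoint p))⁻¹ • vec (endPoint p)) f = 0 := this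
        rw [h2, mul_zero, zero_mul])
    have h2 : last (pair u 1) = 1 := rfl
    rw [hψ' _ (by rw [h2]; exact one_ne_zero), h2, one_pow, one_mul, mul_one, inv_one,
      one_smul] at h1
    exact h1
  · intro hu
    have := image_zcl_subset (isPolyMap_id.pair (isPoly_const 1))
      (Set.mem_image_of_mem (fun x : Fin m → ℂ => pair x 1) hu)
    refine zcl_mono ?_ this
    rintro _ ⟨_, ⟨w, hw, rfl⟩, rfl⟩
    refine ⟨w, hw.1, ?_⟩
    change _ = pair (vec (endPoint w)) 1
    rw [← hw.2, pair_vec_last]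

theorem focalCone_eq_univ {Z : Set (Fin m ⊕ (Fin m ⊕ Unit) → ℂ)} (hZ : coneOver endPoint Z ⊆ Z)
    (h : affinePart (focalCone Z) = Set.univ) : focalCone Z = Set.univ := by
  have h1 : zcl {q : Fin m ⊕ Unit → ℂ | q ∈ Set.univ ∧ last q ≠ 0} = Set.univ := by
    rw [irreducible_univ.zcl_open isPoly_last ⟨pair 0 1, trivial, one_ne_zero⟩]
    exact Set.eq_univ_of_univ_subset (subset_zcl _)
  rw [← Set.univ_subset_iff, ← h1]
  refine zcl_subset_of_closed (isZClosed_zcl _) ?_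
  rintro q ⟨-, hq⟩
  have h2 : (last q)⁻¹ • vec q ∈ affinePart (focalCone Z) := by
    rw [h]
    trivial
  have h3 := image_zcl_subset (IsPolyMap.smul (isPoly_const (last q)) isPolyMap_id)
    (Set.mem_image_of_mem (fun q' : Fin m ⊕ Unit → ℂ => last q • q') h2)
  have h4 : last q • pair ((last q)⁻¹ • vec q) 1 = q := by
    funext k
    rcases k with k | k
    · change last q * ((last q)⁻¹ * q (Sum.inl k)) = _
      rw [mul_inv_cancel_left₀ hq]
    · exact mul_one _
  simp only [h4] at h3
  refine zcl_mono ?_ h3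
  rintro _ ⟨_, ⟨w, hw, rfl⟩, rfl⟩
  exact ⟨_, hZ ⟨w, hw, _, hq, rfl⟩, rfl⟩

theorem focalCone_ne_univ {X : Set (Fin m → ℂ)} {Z : Set (Fin m ⊕ (Fin m ⊕ Unit) → ℂ)}
    (hZ : IsDegenerateComponent B X Z) : focalCone Z ≠ Set.univ := by
  intro h
  rcases hZ.2 with h1 | h1
  · refine h1 (Set.eq_univ_of_univ_subset ?_)
    rw [← h]
    exact zcl_mono (Set.image_mono fun p hp => (hZ.1.1.2 hp).1)
  · rw [h, zdim_univ] at h1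
    simp only [Fintype.card_sum, Fintype.card_fin, Fintype.card_unit] at h1
    have : m + 1 < m := by exact_mod_cast h1
    omega

theorem exists_inverse (hB : B.IsSymm) (hBn : B.Nondegenerate) {X : Set (Fin m → ℂ)}
    (hX : IsIrreducibleHypersurface X) {Z : Set (Fin m ⊕ (Fin m ⊕ Unit) → ℂ)}
    (hZ : IsDegenerateComponent B X Z) (hZX : IsNonvertical X Z)
    (hfin : ¬ AtInfinity (focalCone Z)) :
    ∃ R, IsAlgebraicFunction (affinePart (focalCone Z)) R ∧
      IsAdmissible B (affinePart (focalCone Z)) R ∧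
      zdim (inverseConstruction B R) + 1 = m ∧ IsZComponent (inverseConstruction B R) X := by
  have hcone := hZ.1.coneOver_subset
  have hZi := hZ.1.1.1
  have hne : ∃ p ∈ Z, last (endPoint p) ≠ 0 := by
    by_contra! hc
    refine hfin fun q hq => mem_ideal_of_isPoly hq isPoly_last ?_
    rintro _ ⟨p, hp, rfl⟩
    exact hc p hp
  set W := finiteRepresentatives Z
  have hW : IsZIrreducible W := irreducible_finiteRepresentatives hcone hZi hne
  have hWZ : W ⊆ Z := fun p hp => hp.1
  have hWN : W ⊆ normalVariety B X := fun p hp => (hZ.1.1.2 (hWZ hp)).1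
  have hWX : X ⊆ zcl (basePoint '' W) := by
    have h1 : zcl (basePoint '' Z) = X := hZX
    rw [← h1, ← zcl_image_congr (hZi.zcl_open (isPoly_last.comp isPolyMap_endPoint) hne)
      isPolyMap_basePoint]
    refine zcl_mono ?_
    rintro _ ⟨p, ⟨hp, hp0⟩, rfl⟩
    exact ⟨_, normalize_mem hcone hp hp0, rfl⟩
  have hr : IsPolyMap fun w : Fin m ⊕ (Fin m ⊕ Unit) → ℂ => basePoint w - vec (endPoint w) :=
    isPolyMap_basePoint.sub (isPolyMap_vec.comp isPolyMap_endPoint)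
  obtain ⟨hR, h, hh, hne', hgen⟩ := isAlgebraicFunction_of_factor hW (hr.bilin (B := B) hr)
    -- From `r = ⟨x - O, x - O⟩` and `⟨x - O, dx⟩ = 0` comes `dr = -2⟨x - O, dO⟩`.
    (l := fun w => (-2 : ℂ) • B (basePoint w - vec (endPoint w))) fun w hw ζ hζ => by
      have hy : HasDerivAt (fun t : ℂ => basePoint (w + t • ζ) - vec (endPoint (w + t • ζ)))
          (basePoint ζ - vec (endPoint ζ)) 0 := (basePoint_line w ζ).sub
        (hasDerivAt_line (vec (endPoint w)) (vec (endPoint ζ)) 0)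
      have h1 := hasDerivAt_bilin (B := B) hy hy
      have h2 := normalVariety_orthogonal hWN hw hζ
      rw [hw.2, one_smul, ← neg_sub, map_neg, LinearMap.neg_apply, neg_eq_zero] at h2
      simp only [zero_smul, add_zero] at h1
      rw [hB.eq (basePoint ζ - vec (endPoint ζ)), map_sub _ (basePoint ζ), h2] at h1
      convert h1 using 1
      rw [LinearMap.smul_apply, smul_eq_mul]
      ring
  rw [← affinePart_focalCone hcone] at hR
  set S := affinePart (focalCone Z) with hSdef
  have hS : S = zcl ((fun w => vec (endPoint w)) '' W) := affinePart_focalCone hcone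
  have hSc : IsZClosed S := by
    rw [hS]
    exact isZClosed_zcl _
  set Φ := fun w : Fin m ⊕ (Fin m ⊕ Unit) → ℂ => pair (vec (endPoint w))
    (B (basePoint w - vec (endPoint w)) (basePoint w - vec (endPoint w)))
  have hmem : ∀ w ∈ W, h w ≠ 0 → (basePoint w, Φ w) ∈ inverseTotal B (zcl (Φ '' W)) :=
    fun w hw hhw => by
      refine ⟨⟨(hgen w hw hhw).1.1, rfl⟩, (hgen w hw hhw).1, fun τ hτ => ?_⟩
      have h1 := (hgen w hw hhw).2 τ hτ
      rw [LinearMap.smul_apply, smul_eq_mul] at h1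
      change B (basePoint w - vec (endPoint w)) (vec τ) + (1 / 2) * last τ = 0
      rw [h1]
      ring
  have hdense := hW.zcl_open hh hne'
  have hXX' : X ⊆ inverseConstruction B (zcl (Φ '' W)) := by
    refine hWX.trans ?_
    rw [← zcl_image_congr hdense isPolyMap_basePoint]
    refine zcl_mono ?_
    rintro _ ⟨w, ⟨hw, hhw⟩, rfl⟩
    exact ⟨_, hmem w hw hhw, rfl⟩
  -- If `X'` were everything, so would be `S` and then the focal cone, which degeneracy excludes.
  -- Properness gives both the dimension of `X'` and the maximality of `X`.
  have hnu : inverseConstruction B (zcl (Φ '' W)) ≠ Set.univ := fun h0 =>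
    focalCone_ne_univ hZ (focalCone_eq_univ hcone
      (eq_univ_of_inverseConstruction_eq_univ hB hBn hSc hR h0))
  have hcl : IsZClosed (inverseConstruction B (zcl (Φ '' W))) := isZClosed_zcl _
  obtain ⟨F, hF, hXF⟩ := hX
  refine ⟨zcl (Φ '' W), hR, ?_, ?_, ⟨irreducible_hypersurface hF hXF, hXX'⟩, fun T hT hXT => ?_⟩
  · refine Set.Subset.antisymm (zcl_subset_of_closed hSc ?_) ?_
    · rintro _ ⟨p, hp, rfl⟩
      exact hR.vec_mem hp.1.1
    · rw [hS, ← zcl_image_congr hdense (isPolyMap_vec.comp isPolyMap_endPoint)]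
      refine zcl_mono ?_
      rintro _ ⟨w, ⟨hw, hhw⟩, rfl⟩
      exact ⟨_, hmem w hw hhw, rfl⟩
  · refine le_antisymm ?_ ?_
    · refine (zdim_add_one_le_card ?_).trans_eq (by rw [Fintype.card_fin])
      rwa [hcl]
    · have h1 := zdim_hypersurface hF hXF
      rw [Fintype.card_fin] at h1
      rw [← h1]
      exact add_le_add_left (zdim_mono (hXX'.trans (subset_zcl _))) 1
  · refine (eq_of_hypersurface_subset hF hXF hT.1 (fun h0 => hnu ?_) hXT).subset
    have h1 := zcl_subset_of_closed hcl hT.2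
    rw [h0] at h1
    exact Set.univ_subset_iff.1 h1

end Forward

end FocalLoci

end

/-! ### Assembly of the theorem. -/

theorem theorem2 (n : ℕ) (hn : 1 ≤ n)
    (B : LinearMap.BilinForm ℂ (Fin (n + 1) → ℂ)) (hB : B.IsSymm) (hBn : B.Nondegenerate) :
    (∀ X : Set (Fin (n + 1) → ℂ), FocalLoci.IsIrreducibleHypersurface X →
      ∀ Z, FocalLoci.IsDegenerateComponent B X Z → FocalLoci.IsNonvertical X Z →
        (FocalLoci.AtInfinity (FocalLoci.focalCone Z) →
          ∃ R, FocalLoci.IsAlgebraicSection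
              (FocalLoci.infinitePart (FocalLoci.focalCone Z)) R ∧
            X = FocalLoci.asymptoticConstruction B R) ∧
        (¬ FocalLoci.AtInfinity (FocalLoci.focalCone Z) →
          ∃ R, FocalLoci.IsAlgebraicFunction
              (FocalLoci.affinePart (FocalLoci.focalCone Z)) R ∧
            FocalLoci.IsAdmissible B (FocalLoci.affinePart (FocalLoci.focalCone Z)) R ∧
            FocalLoci.zdim (FocalLoci.inverseConstruction B R) = (n : WithBot ℕ∞) ∧
            FocalLoci.IsZComponent (FocalLoci.inverseConstruction B R) X)) ∧
    (∀ (S : Set (Fin (n + 1) → ℂ)) (R : Set (Fin (n + 1) ⊕ Unit → ℂ)),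
      FocalLoci.IsAlgebraicFunction S R → FocalLoci.IsAdmissible B S R →
      (FocalLoci.zdim S < (n : WithBot ℕ∞) ∨
        (FocalLoci.zdim S = (n : WithBot ℕ∞) ∧
          FocalLoci.affineBundle B R ⊆ FocalLoci.sphereFamily B R)) →
      ∀ X, FocalLoci.IsIrreducibleHypersurface X →
        FocalLoci.IsZComponent (FocalLoci.inverseConstruction B R) X →
        ∃ Z, FocalLoci.IsDegenerateComponent B X Z ∧ FocalLoci.IsNonvertical X Z) ∧
    (∀ (S : Set (Fin (n + 1) → ℂ)) (R : Set (Fin (n + 1) ⊕ Unit → ℂ)),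
      FocalLoci.IsAlgebraicSection S R → FocalLoci.zdim S < ((n + 1 : ℕ) : WithBot ℕ∞) →
      ∀ X, FocalLoci.IsIrreducibleHypersurface X →
        FocalLoci.IsZComponent (FocalLoci.asymptoticConstruction B R) X →
        ∃ Z, FocalLoci.IsDegenerateComponent B X Z ∧ FocalLoci.IsNonvertical X Z) := by
  -- Both `⊥` and `⊤` absorb `1`; the finite right-hand side rules them out and permits
  -- cancellation.
  have hcancel : ∀ d : WithBot ℕ∞, d + 1 = ((n + 1 : ℕ) : WithBot ℕ∞) → d = n := fun d hd => by
    induction d using WithBot.recBotCoe with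
    | bot => exact absurd hd (by
      rw [WithBot.bot_add]
      exact WithBot.bot_ne_coe (a := ((n + 1 : ℕ) : ℕ∞)))
    | coe e =>
      induction e using ENat.recTopCoe with
      | top =>
        have : (⊤ : ℕ∞) + 1 = ((n + 1 : ℕ) : ℕ∞) := by exact_mod_cast hd
        rw [top_add] at this
        exact absurd this (ENat.top_ne_natCast _)
      | coe e =>
        have : e + 1 = n + 1 := by exact_mod_cast hd
        have : e = n := by omega
        rw [this]
        rfl
  refine ⟨fun X hX Z hZ hZX => ⟨FocalLoci.exists_asymptotic hB hBn hX hZ.1 hZX, fun hfin => ?_⟩,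
    fun S R hR hadm hS X hX hXc => ?_, fun S R hR hS X hX hXc =>
      FocalLoci.degenerate_of_asymptoticConstruction hB hBn hR hS hX hXc⟩
  · obtain ⟨R, h1, h2, h3, h4⟩ := FocalLoci.exists_inverse hB hBn hX hZ hZX hfin
    exact ⟨R, h1, h2, hcancel _ h3, h4⟩
  · rcases hS with hS | ⟨hS, hsub⟩
    · refine FocalLoci.degenerate_of_inverseConstruction hB hBn hR ?_ hX hXc
      obtain ⟨d, hd⟩ := hR.irreducible_base.exists_zdim_eq
      rw [hd] at hS ⊢
      have : d < n := by exact_mod_cast hS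
      exact_mod_cast (by omega : d + 1 < n + 1)
    · exact FocalLoci.degenerate_of_inverseConstruction_of_subset hB hBn hR hadm
        (by rw [hS]; rfl) hsub hX hXc
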